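/- Let $p$ be a prime and $X$ a nonempty totally ordered set, let $X^*$ be the free monoid on $X$, and let $\mathcal M_X$ be the free magma on $X$ (nonempty non-associative words), with $f\colon\mathcal M_X\to X^*$ the map that drops brackets. Let $\mathcal H\subseteq\mathcal M_X$ with a total order $\le$ be a Hall set, i.e.: (1) $X\subseteq\mathcal H$ as ordered sets; (2) if $h=(h'h'')\in\mathcal H$, then $h''\in\mathcal H$ and $h<h''$; (3) $(h'h'')\in\mathcal H$ if and only if $h',h''\in\mathcal H$, $h'<h''$, and either $h'\in X$ or $h'=(h_1h_2)$ with $h_2\ge h''$. Let $H=f(\mathcal H)$. Each $w\in H$ is $f(h)$ for a unique $h\in\mathcal H$; if $h=(h'h'')$, put $u=f(h')$, $v=f(h'')$ and call $w=uv$ the standard factorization of $w$. Let $|w|$ denote the length of $w$. A restricted Lie algebra over a field $k$ of characteristic $p$ is a Lie $k$-algebra $L$ with a map $a\mapsto a^{[p]}$ that embeds into an associative $k$-algebra, with bracket $ab-ba$, so that $a^{[p]}$ becomes the $p$-th power. Given $X\to L$, define $P_L(x)=x$ for $x\in X$ (identified with its image in $L$) and $P_L(w)=[P_L(u),P_L(v)]$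 if $w\in H$ has standard factorization $w=uv$. (1) Let $k$ be a field of characteristic $p$. Let $\widehat L(X)$ be the restricted Lie subalgebra of the free associative algebra $k\langle X\rangle$ generated by $X$. Then $\widehat L(X)$ is a free restricted Lie $k$-algebra on $X$, and the polynomials $P(w)^{p^j}$, with $j\ge0$ and $w\in H$, form a $k$-linear basis of it. Likewise, for every free restricted Lie $k$-algebra $L$ on $X$, the family $P_L(w)^{[p]^j}$, indexed by $j\ge0$ and $w\in H$, is a $k$-linear basis of $L$, where $(\cdot)^{[p]^j}$ is the operation $(\cdot)^{[p]}$ applied $j$ times. (2) Let $S$ be a free profinite group on the basis $X$ (in the usual sense: $X\to S$ converges to $1$, generates $S$ topologically, and is universal among maps converging to $1$ from $X$ to profinite groups). Write $[\sigma,\tau]=\sigma^{-1}\tau^{-1}\sigma\tau$. Let $S^{(1)}=S$ and let $S^{(i+1)}=[S,S^{(i)}]$ be the closed subgroup generated by the commutators $[\sigma,\tau]$, $\sigma\in S$, $\tau\in S^{(i)}$. Let $S_{(n,p)}$ be the closed subgroup generated by all $\sigma^{p^j}$ with $\sigma\in S^{(i)}$, $i\ge1$, $j\ge0$, $ip^j\ge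 n$. Put $\tau_x=x$ for $x\in X$ and $\tau_w=[\tau_u,\tau_v]$ if $w\in H$ has standard factorization $w=uv$. Let $n\ge1$. Then $\tau_w^{p^j}\in S_{(n,p)}$ for all $w\in H$, $j\ge0$ with $|w|p^j=n$, and the cosets of these $\tau_w^{p^j}$ form a basis of $S_{(n,p)}/S_{(n+1,p)}$ over $\mathbb F_p$: if $X$ is finite, this quotient is an abelian group of exponent dividing $p$ and they form a basis of it as an $\mathbb F_p$-linear space; for arbitrary $X$ they form a basis of it as a profinite $\mathbb F_p$-linear space, i.e. there is an isomorphism of topological groups $\prod_{(w,j):\,|w|p^j=n}\mathbb F_p\to S_{(n,p)}/S_{(n+1,p)}$ that maps the unit vector of index $(w,j)$ to the coset of $\tau_w^{p^j}$. -/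

import Mathlib

open scoped Topology

universe u v w

attribute [local instance 100] LieRing.ofAssociativeRing

namespace HallZassenhaus

section Hall

variable {X : Type u}

/-- The foliage (bracket-dropping) map from non-associative words to associative words. -/
def foliage : FreeMagma X →ₙ* FreeMonoid X :=
  FreeMagma.lift (FreeMonoid.of : X → FreeMonoid X)

/-- `𝓗`, with the given total order on it, is a Hall set in the free magma on the totally ordered
set `X`. -/
structure IsHallSet [LinearOrder X] (𝓗 : Set (FreeMagma X)) [LinearOrder 𝓗] : Prop where
  /-- `X ⊆ 𝓗` ... -/
  of_mem : ∀ x : X, FreeMagma.of x ∈ 𝓗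
  /-- ... as ordered sets. -/
  of_lt_of_iff : ∀ x y : X,
    (⟨FreeMagma.of x, of_mem x⟩ : 𝓗) < ⟨FreeMagma.of y, of_mem y⟩ ↔ x < y
  /-- If `h = (a b) ∈ 𝓗`, then `b ∈ 𝓗` and `h < b`. -/
  lt_right : ∀ (a b : FreeMagma X) (h : a * b ∈ 𝓗),
    ∃ hb : b ∈ 𝓗, (⟨a * b, h⟩ : 𝓗) < ⟨b, hb⟩
  /-- `(a b) ∈ 𝓗` iff `a, b ∈ 𝓗`, `a < b`, and either `a ∈ X` or `a = (c d)` with `d ≥ b`. -/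
  mul_mem_iff : ∀ a b : FreeMagma X, a * b ∈ 𝓗 ↔
    ∃ (ha : a ∈ 𝓗) (hb : b ∈ 𝓗), (⟨a, ha⟩ : 𝓗) < ⟨b, hb⟩ ∧
      ((∃ x : X, a = FreeMagma.of x) ∨
        ∃ (c d : FreeMagma X) (hd : d ∈ 𝓗), a = c * d ∧ (⟨b, hb⟩ : 𝓗) ≤ ⟨d, hd⟩)

/-- The Hall set of associative words attached to `𝓗`. -/
def hallWords (𝓗 : Set (FreeMagma X)) : Set (FreeMonoid X) := foliage '' 𝓗

/-- The bracketing of a Hall word `w`: the element `h ∈ 𝓗` whose foliage is `w`. (When `𝓗` is a Hall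
set there is exactly one such `h`. If `h = (a b)`, then the standard factorization of `w` is
`w = u v` with `u`, `v` the foliages of `a`, `b`, which are then the bracketings of `u`, `v`.) -/
noncomputable def bracketing {𝓗 : Set (FreeMagma X)} (w : hallWords 𝓗) : FreeMagma X :=
  w.2.choose

theorem bracketing_mem {𝓗 : Set (FreeMagma X)} (w : hallWords 𝓗) : bracketing w ∈ 𝓗 :=
  w.2.choose_spec.1

theorem foliage_bracketing {𝓗 : Set (FreeMagma X)} (w : hallWords 𝓗) :
    foliage (bracketing w) = w :=
  w.2.choose_spec.2

/-- The length `|w|` of a Hall word. -/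
def wordLength {𝓗 : Set (FreeMagma X)} (w : hallWords 𝓗) : ℕ := FreeMonoid.length (w : FreeMonoid X)

/-- The pairs `(w, j)` of a Hall word `w` and an integer `j ≥ 0` with `|w| p ^ j = n`. -/
def LevelIndex (p : ℕ) (𝓗 : Set (FreeMagma X)) (n : ℕ) : Type u :=
  {wj : hallWords 𝓗 × ℕ // wordLength wj.1 * p ^ wj.2 = n}

end Hall

section Lie

/-- Evaluation of a non-associative word in a Lie ring, multiplication becoming the Lie bracket. -/
def lieEval {X : Type u} {L : Type w} [LieRing L] (ι : X → L) : FreeMagma X → L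
  | FreeMagma.of x => ι x
  | FreeMagma.mul a b => ⁅lieEval ι a, lieEval ι b⁆

/-- The element `P_L(w)` of `L` attached to a Hall word `w`: `P_L(x) = x` for a letter `x`, and
`P_L(w) = [P_L(u), P_L(v)]` if `w = u v` is the standard factorization. -/
noncomputable def hallLie {X : Type u} {L : Type w} [LieRing L] (ι : X → L) {𝓗 : Set (FreeMagma X)}
    (w : hallWords 𝓗) : L :=
  lieEval ι (bracketing w)

/-- A restricted Lie algebra over a field `k` (of characteristic `p`): a Lie algebra with a unary
operation `a ↦ a^[p]` which embeds into an associative algebra `A`, with bracket `ab - ba`, in such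
a way that `a^[p]` becomes the `p`-th power. -/
class RestrictedLieAlgebra (k : Type v) (p : ℕ) (L : Type w) [Field k] [LieRing L]
    [LieAlgebra k L] where
  /-- The operation `a ↦ a^[p]`. -/
  pMap : L → L
  exists_embedding : ∃ (A : Type w) (_ : Ring A) (_ : Algebra k A) (θ : L →ₗ⁅k⁆ A),
    Function.Injective θ ∧ ∀ a : L, θ (pMap a) = θ a ^ p

variable (k : Type v) (p : ℕ) [Field k] {X : Type u}

/-- `L` together with `ι : X → L` is a free restricted Lie `k`-algebra on the set `X`. -/
def IsFreeRestrictedLie {L : Type w} [LieRing L] [LieAlgebra k L] [RestrictedLieAlgebra k p L]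
    (ι : X → L) : Prop :=
  ∀ (M : Type w) [LieRing M] [LieAlgebra k M] [RestrictedLieAlgebra k p M] (f : X → M),
    ∃! φ : L →ₗ⁅k⁆ M,
      (∀ a : L, φ (RestrictedLieAlgebra.pMap k p a) = RestrictedLieAlgebra.pMap k p (φ a)) ∧
      ∀ x : X, φ (ι x) = f x

/-- The element `P_L(w)^[p]^j`, the operation `(·)^[p]` being applied `j` times to `P_L(w)`. -/
noncomputable def hallLiePow {L : Type w} [LieRing L] [LieAlgebra k L] [RestrictedLieAlgebra k p L]
    (ι : X → L) {𝓗 : Set (FreeMagma X)} (jw : ℕ × hallWords 𝓗) : L :=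
  (RestrictedLieAlgebra.pMap k p)^[jw.1] (hallLie ι jw.2)

variable (X) in
/-- The restricted Lie subalgebra of the free associative algebra `k⟨X⟩` generated by `X`: the
smallest Lie subalgebra which contains `X` and is closed under `a ↦ a ^ p`. -/
def resLieSubalgebra : LieSubalgebra k (FreeAlgebra k X) :=
  sInf {K | (∀ x : X, FreeAlgebra.ι k x ∈ K) ∧ ∀ a ∈ K, a ^ p ∈ K}

variable {k p} in
theorem mem_resLieSubalgebra {a : FreeAlgebra k X} : a ∈ resLieSubalgebra k p X ↔
    ∀ K : LieSubalgebra k (FreeAlgebra k X), (∀ x : X, FreeAlgebra.ι k x ∈ K) →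
      (∀ b ∈ K, b ^ p ∈ K) → a ∈ K := by
  rw [← SetLike.mem_coe, resLieSubalgebra, LieSubalgebra.coe_sInf]
  simp only [Set.mem_iInter, SetLike.mem_coe, Set.mem_ofPred_eq, and_imp]

theorem ι_mem_resLieSubalgebra (x : X) : FreeAlgebra.ι k x ∈ resLieSubalgebra k p X :=
  mem_resLieSubalgebra.2 fun _ hX _ => hX x

theorem pow_mem_resLieSubalgebra {a : FreeAlgebra k X} (ha : a ∈ resLieSubalgebra k p X) :
    a ^ p ∈ resLieSubalgebra k p X :=
  mem_resLieSubalgebra.2 fun K hX hp => hp a (mem_resLieSubalgebra.1 ha K hX hp)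

/-- `a^[p]` in the restricted Lie subalgebra of `k⟨X⟩` generated by `X` is the `p`-th power. -/
instance : RestrictedLieAlgebra k p (resLieSubalgebra k p X) where
  pMap a := ⟨(a : FreeAlgebra k X) ^ p, pow_mem_resLieSubalgebra k p a.2⟩
  exists_embedding := ⟨FreeAlgebra k X, inferInstance, inferInstance,
    (resLieSubalgebra k p X).incl, Subtype.val_injective, fun _ => rfl⟩

/-- The inclusion of `X` in the restricted Lie subalgebra of `k⟨X⟩` generated by `X`. -/
def resLieι (x : X) : resLieSubalgebra k p X :=
  ⟨FreeAlgebra.ι k x, ι_mem_resLieSubalgebra k p x⟩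

end Lie

section Profinite

/-- The commutator `[σ, τ] = σ⁻¹ τ⁻¹ σ τ`. -/
def comm {G : Type u} [Group G] (σ τ : G) : G := σ⁻¹ * τ⁻¹ * σ * τ

variable {G : Type u} [Group G] [TopologicalSpace G] [IsTopologicalGroup G]

/-- `[K, K']`: the closed subgroup generated by the commutators `[σ, τ]`, `σ ∈ K`, `τ ∈ K'`. -/
def closedCommutator (K K' : Subgroup G) : Subgroup G :=
  (Subgroup.closure {g : G | ∃ σ ∈ K, ∃ τ ∈ K', g = comm σ τ}).topologicalClosure

variable (G) in
/-- The profinite lower central series `G^(1) = G`, `G^(i+1) = [G, G^(i)]` (the value at `0` is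
irrelevant). -/
def lowerCentral : ℕ → Subgroup G
  | 0 => ⊤
  | 1 => ⊤
  | i + 2 => closedCommutator ⊤ (lowerCentral (i + 1))

variable (G) in
/-- The `p`-Zassenhaus filtration: `G_(n,p)` is the closed subgroup of `G` generated by the
`p ^ j`-th powers of the elements of `G^(i)`, for all `i ≥ 1` and `j ≥ 0` with `i p ^ j ≥ n`. -/
def zassenhaus (p n : ℕ) : Subgroup G :=
  (Subgroup.closure {g : G | ∃ i j : ℕ, 1 ≤ i ∧ n ≤ i * p ^ j ∧
    ∃ σ ∈ lowerCentral G i, g = σ ^ p ^ j}).topologicalClosure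

theorem closure_normal_of_conj {s : Set G} (hs : ∀ g : G, ∀ x ∈ s, g * x * g⁻¹ ∈ s) :
    (Subgroup.closure s).topologicalClosure.Normal := by
  have h : (Subgroup.closure s).Normal := by
    constructor
    intro x hx g
    induction hx using Subgroup.closure_induction with
    | mem y hy => exact Subgroup.subset_closure (hs g y hy)
    | one => simp
    | mul y z _ _ hy hz =>
      have := mul_mem hy hz
      convert this using 1
      group
    | inv y _ hy =>
      have := inv_mem hy
      convert this using 1
      group
  exact Subgroup.is_normal_topologicalClosure _

theorem lowerCentral_normal : ∀ i : ℕ, (lowerCentral G i).Normal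
  | 0 => inferInstanceAs (⊤ : Subgroup G).Normal
  | 1 => inferInstanceAs (⊤ : Subgroup G).Normal
  | i + 2 => closure_normal_of_conj (by
      rintro g _ ⟨σ, -, τ, hτ, rfl⟩
      refine ⟨g * σ * g⁻¹, trivial, g * τ * g⁻¹, (lowerCentral_normal (i + 1)).conj_mem τ hτ g, ?_⟩
      simp only [comm]
      group)

instance zassenhaus_normal (p n : ℕ) : (zassenhaus G p n).Normal :=
  closure_normal_of_conj (by
    rintro g _ ⟨i, j, hi, hn, σ, hσ, rfl⟩
    exact ⟨i, j, hi, hn, g * σ * g⁻¹, (lowerCentral_normal i).conj_mem σ hσ g, conj_pow.symm⟩)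

variable (G) in
/-- The quotient `G_(n,p) / G_(n+1,p)`, a topological group. -/
abbrev ZassenhausQuotient (p n : ℕ) : Type u :=
  zassenhaus G p n ⧸ (zassenhaus G p (n + 1)).subgroupOf (zassenhaus G p n)

/-- The profinite group `S` is a free profinite group on the basis `ι : X → S`: the map `ι` converges
to `1` (every neighbourhood of `1` contains `ι x` for all but finitely many `x`), its image
generates `S` as a profinite group, and every map from `X` to a profinite group which converges to
`1` extends uniquely to a continuous homomorphism on `S`. -/
structure IsFreeProfinite {X S : Type u} [Group S] [TopologicalSpace S] [IsTopologicalGroup S]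
    (ι : X → S) : Prop where
  tendsto_one : Filter.Tendsto ι Filter.cofinite (𝓝 1)
  generates : (Subgroup.closure (Set.range ι)).topologicalClosure = ⊤
  existsUnique_lift : ∀ (T : Type u) [Group T] [TopologicalSpace T] [IsTopologicalGroup T]
    [CompactSpace T] [TotallyDisconnectedSpace T] (f : X → T),
    Filter.Tendsto f Filter.cofinite (𝓝 1) → ∃! φ : S →ₜ* T, ∀ x : X, φ (ι x) = f x

/-- Evaluation of a non-associative word in a group, multiplication becoming the commutator. -/
def commEval {X S : Type u} [Group S] (ι : X → S) : FreeMagma X → S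
  | FreeMagma.of x => ι x
  | FreeMagma.mul a b => comm (commEval ι a) (commEval ι b)

/-- The element `τ_w` of `S` attached to a Hall word `w`: `τ_x = x` for a letter `x`, and
`τ_w = [τ_u, τ_v]` if `w = u v` is the standard factorization. -/
noncomputable def hallTau {X S : Type u} [Group S] (ι : X → S) {𝓗 : Set (FreeMagma X)}
    (w : hallWords 𝓗) : S :=
  commEval ι (bracketing w)

/-- The (multiplicatively written) group `Q` is abelian of exponent dividing `p`, and `b` is a basis
of it as a vector space over the field with `p` elements. -/
def IsFpBasis (p : ℕ) {I Q : Type u} [Group Q] (b : I → Q) : Prop :=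
  ∃ (hcomm : ∀ x y : Q, x * y = y * x) (hexp : ∀ x : Q, x ^ p = 1),
    letI : AddCommGroup (Additive Q) :=
      { (inferInstance : AddGroup (Additive Q)) with add_comm := hcomm }
    letI : Module (ZMod p) (Additive Q) := AddCommGroup.zmodModule (n := p) (G := Additive Q) hexp
    LinearIndependent (ZMod p) (fun i => Additive.ofMul (b i)) ∧
      Submodule.span (ZMod p) (Set.range fun i => Additive.ofMul (b i)) =
        (⊤ : Submodule (ZMod p) (Additive Q))

open Classical in
/-- `b` is a basis of the topological group `Q` as a profinite vector space over the field with `p`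
elements: there is an isomorphism of topological groups from the full product of copies of
`ZMod p`, indexed by `I`, onto `Q` which takes the `i`-th unit vector to `b i`. -/
def IsProfiniteFpBasis (p : ℕ) {I Q : Type u} [Group Q] [TopologicalSpace Q] (b : I → Q) : Prop :=
  ∃ e : Multiplicative (I → ZMod p) ≃ₜ* Q, ∀ i : I, e (Multiplicative.ofAdd (Pi.single i 1)) = b i

end Profinite

end HallZassenhaus

open HallZassenhaus

/-!
The proof has an algebraic and a group-theoretic half, linked by the Magnus embedding.

*Independence.* Let a family of elements generate a free associative algebra freely. By Lazard
elimination (`IsFreeFamily.elimFamily`), replacing one member `x` and all the others `z` by the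
iterated brackets `[...[[z, x], x]..., x]` leaves a free family, and no nonzero polynomial in `x`
without constant term lies in the algebra generated by it. The defining condition of a Hall set says
precisely that, after the elimination of its greatest member, the rest of a finite piece of it
consists of products of members of the new alphabet (`IsSpannedBy.erase`). Eliminating the members
one by one from the top shows that all powers `P(h) ^ m`, `m ≥ 1`, for `h` in the Hall set are
linearly independent (`linearIndependent_qEval_pow`). The elimination works for the bracket
`a b - q b a` with any `q`: for `q = 1` it concerns Lie polynomials, and for `q = 0` the value of a
non-associative word is its foliage, so that foliage is injective on a Hall set
(`IsHallSet.foliage_injOn`).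

*Spanning.* By the Jacobi identity a bracket of two Hall polynomials is a combination of Hall
polynomials (`lie_mem_hallSpan`), and Jacobson's formula, that `(a + b) ^ p - a ^ p - b ^ p` is a Lie
polynomial (`add_pow_sub_mem`), shows that the span of the `P(w) ^ p ^ j` is closed under `p`-th
powers. Hence it is the restricted Lie algebra generated by the letters, which is free since every
restricted Lie algebra embeds into an associative algebra (`isFreeRestrictedLie_resLieι`).

*Leading terms.* Since the units `1 + x` of the ring of power series in non-commuting variables over
`ZMod p` converge to `1`, there is a continuous homomorphism `μ` from `S` to the units with
`μ x = 1 + x`. The leading term of `μ (τ_w ^ p ^ j)` is `P(w) ^ p ^ j`, of degree `|w| p ^ j`, and `μ`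
maps `S_(n,p)` to series congruent to `1` up to order `n` (`zassenhaus_le_comap`). Conversely the
preimage of these is contained in `S_(n,p)` (`mem_zassenhaus_of_mem_deepUnits`). For finite products
of generators this follows by Hall's collection process (`exists_collect`): modulo commutators of
large weight such a product is an ordered product of powers `τ_h ^ a`, and independence of the
leading terms forces each factor into `S_(n,p)` (`exists_dvd_of_prod_mem`). For arbitrary elements it
follows by approximation, after retracting `S` onto finitely many generators.

Hence `S_(n,p) / S_(n+1,p)` is identified with a closed group of homogeneous polynomials of degree
`n`, topologically generated by the `P(w) ^ p ^ j` with `|w| p ^ j = n`. Each word of length `n`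
occurs in only finitely many of these, because all monomials of `P(w) ^ p ^ j` have the same multiset
of letters, and there are only finitely many `(w, j)` with a given one. So infinite linear
combinations of them make sense, and define an isomorphism of the full product of copies of `ZMod p`
with the quotient.
-/

namespace HallZassenhaus

/-! ### Lazard elimination for free families in associative algebras -/

section Elimination

variable {k : Type*} [CommRing k] {A : Type*} [Ring A] [Algebra k A]

/-- Evaluation of a non-associative word in an associative algebra, multiplication becoming the
`q`-bracket `a b - q b a`. The case `q = 1` is the Lie bracket, the case `q = 0` is foliage. -/
def qEval (q : k) {X : Type*} (e : X → A) : FreeMagma X → A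
  | FreeMagma.of x => e x
  | FreeMagma.mul a b => qEval q e a * qEval q e b - q • (qEval q e b * qEval q e a)

@[simp] theorem qEval_of (q : k) {X : Type*} (e : X → A) (x : X) :
    qEval q e (FreeMagma.of x) = e x := rfl

@[simp] theorem qEval_mul (q : k) {X : Type*} (e : X → A) (a b : FreeMagma X) :
    qEval q e (a * b) = qEval q e a * qEval q e b - q • (qEval q e b * qEval q e a) := rfl

variable (k) in
/-- A family in an associative algebra is free if it generates a free algebra, freely. -/
def IsFreeFamily {I : Type*} (e : I → A) : Prop := Function.Injective (FreeAlgebra.lift k e)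

/-- The iterated right `q`-bracket `z ↦ [...[[z, x], x]..., x]`. -/
def qAdPow (q : k) (x : A) : ℕ → A → A
  | 0, z => z
  | n + 1, z => qAdPow q x n z * x - q • (x * qAdPow q x n z)

theorem map_qAdPow {B : Type*} [Ring B] [Algebra k B] (φ : A →ₐ[k] B) (q : k) (x z : A) (n : ℕ) :
    φ (qAdPow q x n z) = qAdPow q (φ x) n (φ z) := by
  induction n with
  | zero => rfl
  | succ n ih => simp [qAdPow, ih]

/-- The family `[...[z, x]..., x]` obtained from a family `e` by eliminating its member `x`. -/
def elimFamily (q : k) {I : Type*} (e : I → A) (x : I) : {i // i ≠ x} × ℕ → A :=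
  fun a => qAdPow q (e x) a.2 (e a.1)

section Operators

variable {J : Type*}

/-- Prepending the letter `a` to a word. -/
noncomputable def consOp (a : J) : Module.End k (List J →₀ k) := Finsupp.lmapDomain k k (List.cons a)

/-- The `q`-derivation of a word with letters `(i, n)`, which raises the letters' second component. -/
noncomputable def shiftWord (q : k) : List (J × ℕ) → (List (J × ℕ) →₀ k)
  | [] => 0
  | a :: l => Finsupp.single ((a.1, a.2 + 1) :: l) 1 + q • consOp a (shiftWord q l)

/-- The linear extension of `shiftWord`. -/
noncomputable def shiftOp (q : k) : Module.End k (List (J × ℕ) →₀ k) :=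
  Finsupp.linearCombination k (shiftWord q)

theorem shiftOp_mul_consOp (q : k) (a : J × ℕ) :
    shiftOp q * consOp a - q • (consOp a * shiftOp q) =
      (consOp (a.1, a.2 + 1) : Module.End k (List (J × ℕ) →₀ k)) := by
  refine Finsupp.lhom_ext' fun l => LinearMap.ext_ring ?_
  simp [shiftOp, consOp, shiftWord]

/-- The linear map which takes a reversed word to its value in the free algebra. -/
noncomputable def wordValue : (List J →₀ k) →ₗ[k] FreeAlgebra k J :=
  Finsupp.linearCombination k fun l => (l.reverse.map (FreeAlgebra.ι k)).prod

theorem wordValue_lift_consOp (g : FreeAlgebra k J) (v : List J →₀ k) :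
    wordValue (((FreeAlgebra.lift k fun a : J => MulOpposite.op (consOp (k := k) a)) g).unop v) =
      wordValue v * g := by
  induction g using FreeAlgebra.induction generalizing v with
  | grade0 r =>
    rw [AlgHom.commutes, ← Algebra.commutes r (wordValue v), ← Algebra.smul_def]
    simp [Algebra.algebraMap_eq_smul_one]
  | grade1 a =>
    induction v using Finsupp.induction_linear with
    | zero => simp
    | add f g hf hg => rw [map_add, map_add, hf, hg, map_add, add_mul]
    | single l r =>
      simp [wordValue, consOp]
  | mul a b ha hb => simp [hb, ha, mul_assoc]
  | add a b ha hb => simp [hb, ha, mul_add]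

/-- The operators prepending letters act as freely as possible: the value of a polynomial in them at
the empty word determines the polynomial. Prepending reverses the order of the letters, which is why
opposites are taken. -/
theorem isFreeFamily_consOp :
    IsFreeFamily k fun a : J => MulOpposite.op (consOp (k := k) a) := by
  intro g h hgh
  have h1 := wordValue_lift_consOp g (Finsupp.single [] 1)
  rw [hgh, wordValue_lift_consOp h] at h1
  simpa [wordValue] using h1.symm

end Operators

/-- In the representation on words with letters `(i, n)` in which `x` acts by `shiftOp` and every other
`i` by prepending `(i, 0)`, the member `(i, n)` of the family obtained by eliminating `x` acts by
prepending `(i, n)`. -/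
theorem isFreeFamily_elimFamily_ι (q : k) {I : Type*} (x : I) :
    IsFreeFamily k (elimFamily q (FreeAlgebra.ι k : I → FreeAlgebra k I) x) := by
  classical
  let Φ : FreeAlgebra k I →ₐ[k] (Module.End k (List ({i // i ≠ x} × ℕ) →₀ k))ᵐᵒᵖ :=
    FreeAlgebra.lift k fun i =>
      if h : i = x then MulOpposite.op (shiftOp q) else MulOpposite.op (consOp (⟨i, h⟩, 0))
  have hΦ (a : {i // i ≠ x} × ℕ) :
      Φ (elimFamily q (FreeAlgebra.ι k) x a) = MulOpposite.op (consOp a) := by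
    obtain ⟨⟨i, hi⟩, n⟩ := a
    refine (map_qAdPow (A := FreeAlgebra k I)
      (B := (Module.End k (List ({i // i ≠ x} × ℕ) →₀ k))ᵐᵒᵖ) Φ q _ _ _).trans ?_
    have hx : Φ (FreeAlgebra.ι k x) = MulOpposite.op (shiftOp q) := by simp [Φ]
    have hz : Φ (FreeAlgebra.ι k i) = MulOpposite.op (consOp (⟨i, hi⟩, 0)) := by simp [Φ, hi]
    simp only [hx, hz]
    induction n with
    | zero => rfl
    | succ n ih =>
      rw [qAdPow, ih]
      exact congrArg MulOpposite.op (shiftOp_mul_consOp (J := {i // i ≠ x}) q (⟨i, hi⟩, n))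
  have hcomp : Φ.comp (FreeAlgebra.lift k (elimFamily q (FreeAlgebra.ι k) x)) =
      FreeAlgebra.lift k fun a => MulOpposite.op (consOp a) := by
    ext a
    simp [hΦ]
  have hinj := isFreeFamily_consOp (k := k) (J := {i // i ≠ x} × ℕ)
  rw [IsFreeFamily, ← hcomp] at hinj
  exact Function.Injective.of_comp (f := Φ) hinj

theorem lift_elimFamily (q : k) {I : Type*} (e : I → A) (x : I) :
    FreeAlgebra.lift k (elimFamily q e x) = (FreeAlgebra.lift k e).comp
      (FreeAlgebra.lift k (elimFamily q (FreeAlgebra.ι k) x)) := by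
  ext a
  simp [elimFamily, map_qAdPow]

/-- Lazard elimination: eliminating a member of a free family leaves a free family. -/
theorem IsFreeFamily.elimFamily (q : k) {I : Type*} {e : I → A} (he : IsFreeFamily k e) (x : I) :
    IsFreeFamily k (elimFamily q e x) := by
  rw [IsFreeFamily, lift_elimFamily]
  exact he.comp (isFreeFamily_elimFamily_ι q x)

/-- The homomorphism to a polynomial ring which kills all letters but `x` kills the family obtained
by eliminating `x`, so that a polynomial in `x` without constant term which lies in the algebra
generated by that family vanishes. -/
theorem eq_zero_of_aeval_add_lift_elimFamily (q : k) {I : Type*} {e : I → A}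
    (he : IsFreeFamily k e) (x : I) {Q : Polynomial k} (hQ : Q.coeff 0 = 0)
    {g : FreeAlgebra k ({i // i ≠ x} × ℕ)}
    (h : Polynomial.aeval (e x) Q + FreeAlgebra.lift k (HallZassenhaus.elimFamily q e x) g = 0) :
    Q = 0 := by
  classical
  have h1 : Polynomial.aeval (FreeAlgebra.ι k x) Q +
      FreeAlgebra.lift k (HallZassenhaus.elimFamily q (FreeAlgebra.ι k) x) g = 0 := by
    apply he
    rw [map_add, map_zero, ← h, lift_elimFamily q e, ← Polynomial.aeval_algHom_apply,
      FreeAlgebra.lift_ι_apply, AlgHom.comp_apply]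
  let π : FreeAlgebra k I →ₐ[k] Polynomial k :=
    FreeAlgebra.lift k fun i => if i = x then Polynomial.X else 0
  have hπ : π.comp (FreeAlgebra.lift k (HallZassenhaus.elimFamily q (FreeAlgebra.ι k) x)) =
      (Algebra.ofId k (Polynomial k)).comp (FreeAlgebra.lift k fun _ => 0) := by
    ext ⟨⟨i, hi⟩, n⟩ : 2
    have : ∀ n, qAdPow q (Polynomial.X : Polynomial k) n 0 = 0 := by
      intro n
      induction n with
      | zero => rfl
      | succ n ih => simp [qAdPow, ih]
    simp [HallZassenhaus.elimFamily, map_qAdPow, π, hi, this]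
  have h2 := congrArg π h1
  rw [map_add, map_zero, ← Polynomial.aeval_algHom_apply, ← AlgHom.comp_apply π, hπ] at h2
  simp only [π, FreeAlgebra.lift_ι_apply, if_true, Polynomial.aeval_X_left_apply,
    AlgHom.comp_apply, Algebra.ofId_apply, Polynomial.algebraMap_eq] at h2
  have h3 := congrArg (Polynomial.coeff · 0) h2
  simp only [Polynomial.coeff_add, hQ, Polynomial.coeff_C_zero, zero_add,
    Polynomial.coeff_zero] at h3
  simpa [h3] using h2

end Elimination

/-! ### Linear independence of powers of Hall polynomials -/

section Independence

variable {X : Type u}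

theorem magma_induction {C : FreeMagma X → Prop} (of : ∀ x, C (FreeMagma.of x))
    (mul : ∀ a b, C a → C b → C (a * b)) (t : FreeMagma X) : C t := by
  induction t with
  | ih1 x => exact of x
  | ih2 a b ha hb => exact mul a b ha hb

theorem of_ne_mul (x : X) (a b : FreeMagma X) : FreeMagma.of x ≠ a * b := nofun

theorem mul_inj' {a b c d : FreeMagma X} (h : a * b = c * d) : a = c ∧ b = d := by
  rw [← FreeMagma.mul_eq, ← FreeMagma.mul_eq] at h
  injection h with h1 h2
  exact ⟨h1, h2⟩

theorem lieEval_eq_qEval {k : Type*} [CommRing k] {A : Type*} [Ring A] [Algebra k A] (e : X → A)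
    (t : FreeMagma X) : lieEval e t = qEval (1 : k) e t := by
  induction t using magma_induction with
  | of x => rfl
  | mul a b ha hb => rw [qEval_mul, ← ha, ← hb, one_smul, ← Ring.lie_def]; rfl

theorem isFreeFamily_ι (k : Type*) [CommRing k] :
    IsFreeFamily k (FreeAlgebra.ι k : X → FreeAlgebra k X) := by
  intro a b hab
  have h : FreeAlgebra.lift k (FreeAlgebra.ι k : X → FreeAlgebra k X) = AlgHom.id k _ := by
    ext; simp
  simpa [h] using hab

/-- The non-associative word `(...((z x) x)...) x`. -/
def rightPow (x : FreeMagma X) : ℕ → FreeMagma X → FreeMagma X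
  | 0, z => z
  | n + 1, z => rightPow x n z * x

/-- The alphabet of non-associative words left after the elimination of one of them. -/
def elimWords {I : Type*} (ev : I → FreeMagma X) (x : I) : {i // i ≠ x} × ℕ → FreeMagma X :=
  fun a => rightPow (ev x) a.2 (ev a.1)

theorem qEval_elimWords {k : Type*} [CommRing k] {A : Type*} [Ring A] [Algebra k A] (q : k)
    (e : X → A) {I : Type*} (ev : I → FreeMagma X) (x : I) :
    (fun a => qEval q e (elimWords ev x a)) = elimFamily q (fun i => qEval q e (ev i)) x := by
  ext ⟨i, n⟩
  simp only [elimWords, elimFamily]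
  induction n with
  | zero => rfl
  | succ n ih => rw [rightPow, qEval_mul, ih, qAdPow]

variable {𝓗 : Set (FreeMagma X)}

/-- All words in the finite subset `F` of the Hall set are products, within `F`, of members of the
alphabet `ev`. -/
def IsSpannedBy {I : Type*} (F : Finset 𝓗) (ev : I → FreeMagma X) : Prop :=
  ∀ h ∈ F, h.1 ∈ Set.range ev ∨ ∃ a ∈ F, ∃ b ∈ F, h.1 = a.1 * b.1

theorem IsSpannedBy.exists_lift {I : Type*} {F : Finset 𝓗} {ev : I → FreeMagma X}
    (hF : IsSpannedBy F ev) {k : Type*} [CommRing k] {A : Type*} [Ring A] [Algebra k A] (q : k)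
    (e : X → A) (h : 𝓗) (hh : h ∈ F) :
    ∃ g, FreeAlgebra.lift k (fun i => qEval q e (ev i)) g = qEval q e h := by
  obtain ⟨t, ht⟩ := h
  induction t using magma_induction with
  | of x =>
    rcases hF _ hh with ⟨i, hi⟩ | ⟨a, -, b, -, hab⟩
    · exact ⟨FreeAlgebra.ι k i, by simp [hi]⟩
    · exact (of_ne_mul _ _ _ hab).elim
  | mul c d hc hd =>
    rcases hF _ hh with ⟨i, hi⟩ | ⟨a, ha, b, hb, hab⟩
    · exact ⟨FreeAlgebra.ι k i, by simp [hi]⟩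
    · obtain ⟨rfl, rfl⟩ := mul_inj' hab
      obtain ⟨g, hg⟩ := hc a.2 ha
      obtain ⟨g', hg'⟩ := hd b.2 hb
      exact ⟨g * g' - q • (g' * g), by simp [hg, hg']⟩

variable [LinearOrder X] [LinearOrder 𝓗]

theorem IsHallSet.lt_of_mul_mem (h𝓗 : IsHallSet 𝓗) {a b : 𝓗} (h : a.1 * b.1 ∈ 𝓗) : a < b := by
  obtain ⟨_, _, h1, -⟩ := (h𝓗.mul_mem_iff a.1 b.1).1 h
  exact h1

theorem IsHallSet.mul_lt (h𝓗 : IsHallSet 𝓗) {h a b : 𝓗} (hab : h.1 = a.1 * b.1) : h < b := by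
  obtain ⟨h, hh⟩ := h
  subst hab
  exact (h𝓗.lt_right _ _ hh).2

/-- The greatest word of `F` is in the alphabet, since a product in `F` is less than its right
factor. -/
theorem IsSpannedBy.exists_eq_max (h𝓗 : IsHallSet 𝓗) {I : Type*} {F : Finset 𝓗}
    {ev : I → FreeMagma X} (hF : IsSpannedBy F ev) {m : 𝓗} (hm : m ∈ F) (hmax : ∀ h ∈ F, h ≤ m) :
    ∃ i, ev i = m.1 := by
  rcases hF m hm with hi | ⟨a, ha, b, hb, hab⟩
  · exact hi
  · exact absurd (hmax b hb) (not_le.2 (h𝓗.mul_lt hab))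

/-- After the greatest word of `F` has been eliminated, the remaining words of `F` are products of
members of the new alphabet. -/
theorem IsSpannedBy.erase (h𝓗 : IsHallSet 𝓗) {I : Type*} {F : Finset 𝓗}
    {ev : I → FreeMagma X} (hF : IsSpannedBy F ev) {x : I} {m : 𝓗} (hx : ev x = m.1)
    (hmax : ∀ h ∈ F, h ≤ m) :
    IsSpannedBy (F.erase m) (elimWords ev x) := by
  have hold : ∀ h ∈ F.erase m, h.1 ∈ Set.range ev → h.1 ∈ Set.range (elimWords ev x) := by
    rintro h hh ⟨i, hi⟩
    have hne : i ≠ x := by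
      rintro rfl
      exact (Finset.mem_erase.1 hh).1 (Subtype.ext (hi.symm.trans hx))
    exact ⟨(⟨i, hne⟩, 0), hi⟩
  -- words `(...(z m)...) m` of the new alphabet are recognized by their right factor being at least `m`
  have key : ∀ t : FreeMagma X, ∀ ht : t ∈ 𝓗, (⟨t, ht⟩ : 𝓗) ∈ F.erase m →
      (∀ c (d : 𝓗), t = c * d.1 → m ≤ d) → t ∈ Set.range (elimWords ev x) := by
    intro t
    induction t using magma_induction with
    | of y =>
      intro ht hF' _
      refine hold _ hF' ?_
      rcases hF _ (Finset.mem_of_mem_erase hF') with hi | ⟨a, -, b, -, hab⟩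
      · exact hi
      · exact (of_ne_mul _ _ _ hab).elim
    | mul c d hc hd =>
      intro ht hF' hle
      rcases hF _ (Finset.mem_of_mem_erase hF') with hi | ⟨a, ha, b, hb, hab⟩
      · exact hold _ hF' hi
      · obtain ⟨rfl, rfl⟩ := mul_inj' hab
        have hbm : b = m := le_antisymm (hmax b hb) (hle _ b rfl)
        obtain ⟨_, _, hlt, hor⟩ := (h𝓗.mul_mem_iff _ _).1 ht
        have ham : a ≠ m :=
          fun ham => lt_irrefl m (lt_of_eq_of_lt ham.symm (lt_of_lt_of_eq hlt hbm))
        obtain ⟨i, hi⟩ := hc a.2 (Finset.mem_erase.2 ⟨ham, ha⟩) (by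
          intro c d hcd
          rcases hor with ⟨y, hy⟩ | ⟨c', d', hd', h1, h2⟩
          · exact (of_ne_mul _ _ _ (hy.symm.trans hcd)).elim
          · obtain ⟨rfl, rfl⟩ := mul_inj' (h1.symm.trans hcd)
            rw [← hbm]
            exact h2)
        refine ⟨(i.1, i.2 + 1), ?_⟩
        rw [← hi, hbm, ← hx]
        rfl
  intro h hh
  rcases hF h (Finset.mem_of_mem_erase hh) with hi | ⟨a, ha, b, hb, hab⟩
  · exact .inl (hold h hh hi)
  · by_cases hbm : b = m
    · refine .inl (key h.1 h.2 hh ?_)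
      intro c d hcd
      have := (mul_inj' (hab.symm.trans hcd)).2
      rw [← hbm, Subtype.ext this]
    · have hlt : a < b := h𝓗.lt_of_mul_mem (hab ▸ h.2)
      have ham : a ≠ m := (hlt.trans_le (hmax b hb)).ne
      exact .inr ⟨a, Finset.mem_erase.2 ⟨ham, ha⟩, b, Finset.mem_erase.2 ⟨hbm, hb⟩, hab⟩

/-- A sum over `h ∈ F` of polynomials `Q h` without constant term, evaluated at the `q`-bracketings,
vanishes only if all `Q h` do: eliminating the greatest `m ∈ F` separates `Q m` from the other
terms. -/
theorem IsSpannedBy.eq_zero_of_sum_aeval_eq_zero (h𝓗 : IsHallSet 𝓗) {k : Type*} [CommRing k]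
    {A : Type*} [Ring A] [Algebra k A] (q : k) (e : X → A) {I : Type u} {F : Finset 𝓗}
    {ev : I → FreeMagma X} (hF : IsSpannedBy F ev)
    (he : IsFreeFamily k fun i => qEval q e (ev i)) (Q : 𝓗 → Polynomial k)
    (hQ : ∀ h, (Q h).coeff 0 = 0) (hsum : ∑ h ∈ F, Polynomial.aeval (qEval q e h.1) (Q h) = 0) :
    ∀ h ∈ F, Q h = 0 := by
  induction hn : F.card generalizing I F with
  | zero => simp [Finset.card_eq_zero.1 hn]
  | succ n ih =>
    have hne : F.Nonempty := Finset.card_pos.1 (by omega)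
    set m := F.max' hne with hm
    have hmF : m ∈ F := F.max'_mem hne
    have hmax : ∀ h ∈ F, h ≤ m := fun h hh => F.le_max' h hh
    obtain ⟨x, hx⟩ := hF.exists_eq_max h𝓗 hmF hmax
    have hF' := hF.erase h𝓗 hx hmax
    have he' : IsFreeFamily k fun a => qEval q e (elimWords ev x a) := by
      rw [qEval_elimWords]
      exact he.elimFamily q x
    have hmem : ∑ h ∈ F.erase m, Polynomial.aeval (qEval q e h.1) (Q h) ∈
        (FreeAlgebra.lift k fun a => qEval q e (elimWords ev x a)).range := by
      refine sum_mem fun h hh => ?_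
      obtain ⟨g, hg⟩ := hF'.exists_lift q e h hh
      refine ⟨Polynomial.aeval g (Q h), ?_⟩
      change FreeAlgebra.lift k _ _ = _
      rw [← hg, Polynomial.aeval_algHom_apply]
    obtain ⟨g, hg⟩ := hmem
    rw [← Finset.add_sum_erase _ _ hmF] at hsum
    have hQm : Q m = 0 := by
      refine eq_zero_of_aeval_add_lift_elimFamily (g := g) q he x (hQ m) ?_
      rw [← qEval_elimWords, hx, ← hsum, ← hg]
      rfl
    rw [hQm, map_zero, zero_add] at hsum
    have := ih hF' he' hsum (by rw [Finset.card_erase_of_mem hmF, hn]; rfl)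
    intro h hh
    by_cases hhm : h = m
    · rw [hhm, hQm]
    · exact this h (Finset.mem_erase.2 ⟨hhm, hh⟩)

/-- The members of a finite set `F` as required here are the subtrees of `h`, all of which are in the
Hall set. -/
theorem exists_finset_subtrees (h𝓗 : IsHallSet 𝓗) (h : 𝓗) : ∃ F : Finset 𝓗, h ∈ F ∧
    IsSpannedBy F (FreeMagma.of : X → FreeMagma X) := by
  classical
  obtain ⟨t, ht⟩ := h
  induction t using magma_induction with
  | of x => exact ⟨{⟨_, ht⟩}, by simp, fun h hh => .inl (by simp_all)⟩
  | mul a b ha hb =>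
    obtain ⟨hma, hmb, -⟩ := (h𝓗.mul_mem_iff a b).1 ht
    obtain ⟨F, hF, hF'⟩ := ha hma
    obtain ⟨G, hG, hG'⟩ := hb hmb
    refine ⟨insert ⟨_, ht⟩ (F ∪ G), by simp, fun h hh => ?_⟩
    rcases Finset.mem_insert.1 hh with rfl | hh
    · exact .inr ⟨⟨a, hma⟩, by simp [hF], ⟨b, hmb⟩, by simp [hG], rfl⟩
    · rcases Finset.mem_union.1 hh with hh | hh
      · exact (hF' h hh).imp_right fun ⟨a, ha, b, hb, hab⟩ => ⟨a, by simp [ha], b, by simp [hb], hab⟩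
      · exact (hG' h hh).imp_right fun ⟨a, ha, b, hb, hab⟩ => ⟨a, by simp [ha], b, by simp [hb], hab⟩

theorem exists_finset_isSpannedBy_of (h𝓗 : IsHallSet 𝓗) (F : Finset 𝓗) : ∃ G, F ⊆ G ∧
    IsSpannedBy G (FreeMagma.of : X → FreeMagma X) := by
  classical
  choose T hT hT' using exists_finset_subtrees h𝓗
  refine ⟨F.biUnion T, fun h hh => Finset.mem_biUnion.2 ⟨h, hh, hT h⟩, fun h hh => ?_⟩
  obtain ⟨f, hf, hh⟩ := Finset.mem_biUnion.1 hh
  exact (hT' f h hh).imp_right fun ⟨a, ha, b, hb, hab⟩ =>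
    ⟨a, Finset.mem_biUnion.2 ⟨f, hf, ha⟩, b, Finset.mem_biUnion.2 ⟨f, hf, hb⟩, hab⟩

/-- The positive powers of the `q`-bracketings of the members of a Hall set, evaluated at a free
family, are linearly independent. -/
theorem linearIndependent_qEval_pow (h𝓗 : IsHallSet 𝓗) {k : Type*} [CommRing k]
    {A : Type*} [Ring A] [Algebra k A] (q : k) {e : X → A} (he : IsFreeFamily k e) :
    LinearIndependent k fun hn : 𝓗 × ℕ => qEval q e hn.1.1 ^ (hn.2 + 1) := by
  classical
  rw [linearIndependent_iff']
  intro s c hc ⟨h, n⟩ hh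
  obtain ⟨G, hG, hG'⟩ := exists_finset_isSpannedBy_of h𝓗 (s.image Prod.fst)
  let Q : 𝓗 → Polynomial k := fun h =>
    ∑ i ∈ s with i.1 = h, Polynomial.monomial (i.2 + 1) (c i)
  have h1 := hG'.eq_zero_of_sum_aeval_eq_zero h𝓗 q e he Q (by
    intro h
    simp [Q, Polynomial.finsetSum_coeff, Polynomial.coeff_monomial]) (by
    rw [← hc, ← Finset.sum_fiberwise_of_maps_to (t := G) (g := Prod.fst)
      (fun i hi => hG (Finset.mem_image_of_mem _ hi))]
    refine Finset.sum_congr rfl fun h _ => ?_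
    rw [map_sum]
    refine Finset.sum_congr rfl fun i hi => ?_
    rw [Polynomial.aeval_monomial, ← Algebra.smul_def, (Finset.mem_filter.1 hi).2])
    h (hG (Finset.mem_image_of_mem Prod.fst hh))
  have h2 := congrArg (Polynomial.coeff · (n + 1)) h1
  simp only [Q, Polynomial.finsetSum_coeff, Polynomial.coeff_monomial, Polynomial.coeff_zero] at h2
  rw [Finset.sum_eq_single (h, n)] at h2
  · simpa using h2
  · rintro ⟨h', n'⟩ hi hne
    rw [if_neg]
    intro hn
    have := (Finset.mem_filter.1 hi).2
    simp_all
  · intro hn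
    simp [hh] at hn

/-- Different members of a Hall set have different foliages: at `q = 0` the foliage of a
non-associative word is its `q`-bracketing. -/
theorem IsHallSet.foliage_injOn (h𝓗 : IsHallSet 𝓗) : Set.InjOn foliage 𝓗 := by
  have h1 (t : FreeMagma X) : qEval (0 : ℚ) (FreeAlgebra.ι ℚ : X → FreeAlgebra ℚ X) t =
      FreeMonoid.lift (FreeAlgebra.ι ℚ) (foliage t) := by
    induction t using magma_induction with
    | of x => simp [foliage]
    | mul a b ha hb => simp [ha, hb]
  intro a ha b hb hab
  have h2 := (linearIndependent_qEval_pow h𝓗 (0 : ℚ) (isFreeFamily_ι (X := X) ℚ)).injective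
  have h3 := @h2 (⟨a, ha⟩, 0) (⟨b, hb⟩, 0) (by simp [h1, hab])
  simpa using h3

end Independence


/-! ### Lie brackets of Hall elements -/

section LieSpan

variable {X : Type u}

/-- The multiset of the letters of a non-associative word. -/
def content (t : FreeMagma X) : Multiset X := (FreeMonoid.toList (foliage t) : Multiset X)

@[simp] theorem content_of (x : X) : content (FreeMagma.of x) = {x} := rfl

@[simp] theorem content_mul (a b : FreeMagma X) : content (a * b) = content a + content b := by
  simp [content, ← Multiset.coe_add]

theorem card_content (t : FreeMagma X) : (content t).card = (foliage t).length := rfl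

theorem content_card_pos (t : FreeMagma X) : 0 < (content t).card := by
  induction t using magma_induction with
  | of x => simp
  | mul a b ha hb => simp [ha]

/-- Finitely many non-associative words can be formed with at most given letters, counted with
multiplicity. -/
theorem finite_content_le (C : Multiset X) : {t : FreeMagma X | content t ≤ C}.Finite := by
  classical
  induction C using WellFoundedLT.induction with
  | ind C ih =>
    set U : Set (FreeMagma X) := ⋃ B ∈ Set.Iio C, {t | content t ≤ B} with hU
    have hUf : U.Finite := Set.Finite.biUnion (Set.finite_Iio C) fun B hB => ih B hB
    refine ((C.toFinset.finite_toSet.image FreeMagma.of).union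
      (Set.Finite.image2 (· * ·) hUf hUf)).subset fun t ht => ?_
    induction t using magma_induction with
    | of x => exact .inl ⟨x, by simpa using ht, rfl⟩
    | mul a b =>
      have hmem : ∀ c d : FreeMagma X, content c + content d ≤ C → c ∈ U := fun c d h => by
        refine Set.mem_biUnion (x := content c) ?_ (le_refl (content c))
        refine lt_of_lt_of_le ?_ h
        refine lt_of_le_of_ne (Multiset.le_add_right _ _) fun h => ?_
        have h1 := congrArg Multiset.card h
        rw [Multiset.card_add] at h1
        have := content_card_pos d
        omega
      rw [Set.mem_ofPred_eq, content_mul] at ht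
      exact .inr ⟨a, hmem a b ht, b, hmem b a (by rwa [add_comm]), rfl⟩

variable {𝓗 : Set (FreeMagma X)} [LinearOrder 𝓗] {L : Type*} [LieRing L]

/-- The additive group generated by the Lie elements of the composite Hall words of content `C`
whose right factor is at most `m`. -/
def hallSpan (e : X → L) (C : Multiset X) (m : 𝓗) : AddSubgroup L :=
  AddSubgroup.closure ((fun t : 𝓗 => lieEval e t.1) ''
    {t : 𝓗 | content t.1 = C ∧ ∃ (a : FreeMagma X) (b : 𝓗), t.1 = a * b.1 ∧ b ≤ m})

theorem hallSpan_mono (e : X → L) (C : Multiset X) {m m' : 𝓗} (h : m ≤ m') :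
    hallSpan e C m ≤ hallSpan e C m' :=
  AddSubgroup.closure_mono (Set.image_mono fun _ ⟨h1, a, b, h2, h3⟩ => ⟨h1, a, b, h2, h3.trans h⟩)

variable [LinearOrder X]

/-- The bracket of two Hall elements is a sum of Hall elements `(a b)` with `b` at most the greater
of the two. If `h = (c d)` and `k > h` do not form a Hall word, then `d < k`, and in
`[[c, d], k] = [[c, k], d] + [c, [d, k]]` the inner brackets have smaller degree, while their
expansions meet the outer ones in pairs of elements less than `k`. So the induction is on the degree
and, in each degree, on the number of Hall words less than `m` which can occur. -/
theorem lie_mem_hallSpan (h𝓗 : IsHallSet 𝓗) (e : X → L) (h k m : 𝓗) (hm : h ≤ m) (km : k ≤ m) :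
    ⁅lieEval e h.1, lieEval e k.1⁆ ∈ hallSpan e (content h.1 + content k.1) m := by
  obtain ⟨C, hC⟩ : ∃ C, content h.1 + content k.1 = C := ⟨_, rfl⟩
  rw [hC]
  induction hn : C.card using Nat.strong_induction_on generalizing C h k m with
  | _ n ihn =>
  induction hs : {t : 𝓗 | content t.1 ≤ C ∧ t < m}.ncard using Nat.strong_induction_on
    generalizing h k m with
  | _ s ihs =>
  wlog hlt : h < k generalizing h k with W
  · rcases eq_or_lt_of_le (not_lt.1 hlt) with rfl | hlt'
    · rw [lie_self]
      exact zero_mem _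
    · rw [← lie_skew]
      exact neg_mem (W k h km hm (by rwa [add_comm]) hlt')
  by_cases hmem : h.1 * k.1 ∈ 𝓗
  · exact AddSubgroup.subset_closure
      ⟨⟨_, hmem⟩, ⟨by rw [← hC, content_mul], h.1, k, rfl, km⟩, rfl⟩
  obtain ⟨⟨t, ht⟩, hh⟩ : ∃ t : 𝓗, t = h := ⟨h, rfl⟩
  induction t using magma_induction with
  | of x =>
    refine absurd ((h𝓗.mul_mem_iff _ _).2 ⟨h.2, k.2, hlt, .inl ⟨x, ?_⟩⟩) hmem
    rw [← hh]
  | mul c d =>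
    obtain ⟨hc, hd, hcd, -⟩ := (h𝓗.mul_mem_iff c d).1 ht
    subst hh
    have hdk : (⟨d, hd⟩ : 𝓗) < k := by
      by_contra hcon
      exact hmem ((h𝓗.mul_mem_iff _ _).2 ⟨ht, k.2, hlt, .inr ⟨c, d, hd, rfl, not_lt.1 hcon⟩⟩)
    have hfin : {t : 𝓗 | content t.1 ≤ C ∧ t < m}.Finite :=
      ((finite_content_le C).preimage Subtype.val_injective.injOn).subset fun t ht => ht.1
    -- the inner induction hypothesis, in the form in which it is used
    have hstep (a b : 𝓗) (ha : a < k) (hb : b < k) (hab : content a.1 + content b.1 = C) :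
        ⁅lieEval e a.1, lieEval e b.1⁆ ∈ hallSpan e C m := by
      have hmax : max a b < m := (max_lt ha hb).trans_le km
      refine hallSpan_mono e C hmax.le (ihs _ ?_ a b (max a b) (le_max_left _ _) (le_max_right _ _)
        hab rfl)
      rw [← hs]
      refine Set.ncard_lt_ncard ⟨fun t ht => ⟨ht.1, ht.2.trans hmax⟩, fun hsub => ?_⟩ hfin
      refine lt_irrefl (max a b) (hsub (a := max a b) ⟨?_, hmax⟩).2
      rcases max_choice a b with h | h <;> rw [h, ← hab] <;> simp
    have hjac : ⁅lieEval e (c * d), lieEval e k.1⁆ =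
        ⁅⁅lieEval e c, lieEval e k.1⁆, lieEval e d⁆ +
          ⁅lieEval e c, ⁅lieEval e d, lieEval e k.1⁆⁆ := by
      rw [leibniz_lie (lieEval e c), ← lie_skew (lieEval e d), add_comm, neg_add_cancel_right]
      rfl
    change ⁅lieEval e (c * d), _⁆ ∈ _
    have hCsum : content c + content d + content k.1 = C := by rw [← hC, content_mul]
    have hcard : ∀ a b c : FreeMagma X, content a + content b + content c = C →
        (content a + content b).card < n := by
      intro a b c h
      rw [← hn, ← h, Multiset.card_add (content a + content b)]
      exact Nat.lt_add_of_pos_right (content_card_pos c)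
    rw [hjac]
    refine add_mem ?_ ?_
    · have h1 := ihn _ (hcard c k.1 d (by rw [← hCsum]; abel)) ⟨c, hc⟩ k k (hcd.le.trans hdk.le)
        le_rfl _ rfl rfl
      change ⁅lieEval e c, lieEval e k.1⁆ ∈ _ at h1
      generalize ⁅lieEval e c, lieEval e k.1⁆ = y at h1 ⊢
      induction h1 using AddSubgroup.closure_induction with
      | mem y hy =>
        obtain ⟨u, ⟨hu, a, b, hab, hb⟩, rfl⟩ := hy
        refine hstep u ⟨d, hd⟩ ?_ hdk ?_
        · obtain ⟨u, hu'⟩ := u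
          subst hab
          exact (h𝓗.lt_right _ _ hu').2.trans_le hb
        · rw [hu, ← hCsum]
          simp only
          abel
      | zero => simp
      | add y z _ _ hy hz => rw [add_lie]; exact add_mem hy hz
      | neg y _ hy => rw [neg_lie]; exact neg_mem hy
    · have h1 := ihn _ (hcard d k.1 c (by rw [← hCsum]; abel)) ⟨d, hd⟩ k k hdk.le
        le_rfl _ rfl rfl
      change ⁅lieEval e d, lieEval e k.1⁆ ∈ _ at h1
      generalize ⁅lieEval e d, lieEval e k.1⁆ = y at h1 ⊢
      induction h1 using AddSubgroup.closure_induction with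
      | mem y hy =>
        obtain ⟨u, ⟨hu, a, b, hab, hb⟩, rfl⟩ := hy
        refine hstep ⟨c, hc⟩ u (hcd.trans hdk) ?_ ?_
        · obtain ⟨u, hu'⟩ := u
          subst hab
          exact (h𝓗.lt_right _ _ hu').2.trans_le hb
        · rw [hu, ← hCsum]
          simp only
          abel
      | zero => simp
      | add y z _ _ hy hz => rw [lie_add]; exact add_mem hy hz
      | neg y _ hy => rw [lie_neg]; exact neg_mem hy

/-- The linear span of the Lie elements attached to a Hall set is a Lie subalgebra. -/
def hallLieSubalgebra (h𝓗 : IsHallSet 𝓗) (k : Type*) [CommRing k] [LieAlgebra k L] (e : X → L) :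
    LieSubalgebra k L where
  __ := Submodule.span k (Set.range fun h : 𝓗 => lieEval e h.1)
  lie_mem' {a b} ha hb := by
    change a ∈ Submodule.span k _ at ha
    change b ∈ Submodule.span k _ at hb
    change ⁅a, b⁆ ∈ Submodule.span k _
    induction ha, hb using Submodule.span_induction₂ with
    | mem_mem x y hx hy =>
      obtain ⟨h, rfl⟩ := hx
      obtain ⟨h', rfl⟩ := hy
      have h1 := lie_mem_hallSpan h𝓗 e h h' (max h h') (le_max_left _ _) (le_max_right _ _)
      refine (AddSubgroup.closure_le (K := (Submodule.span k
        (Set.range fun h : 𝓗 => lieEval e h.1)).toAddSubgroup)).2 ?_ h1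
      rintro _ ⟨t, -, rfl⟩
      exact Submodule.subset_span ⟨t, rfl⟩
    | zero_left y hy => simp
    | zero_right x hx => simp
    | add_left x y z _ _ _ hx hy => rw [add_lie]; exact add_mem hx hy
    | add_right x y z _ _ _ hx hy => rw [lie_add]; exact add_mem hx hy
    | smul_left r x y _ _ h => rw [smul_lie]; exact Submodule.smul_mem _ _ h
    | smul_right r x y _ _ h => rw [lie_smul]; exact Submodule.smul_mem _ _ h

end LieSpan

/-! ### Jacobson's formula for the `p`-th power of a sum -/

section Jacobson

variable {p : ℕ} [Fact p.Prime]

theorem cast_choose_sub_one {R : Type*} [CommRing R] [CharP R p] {j : ℕ} (hj : j < p) :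
    ((p - 1).choose j : R) = (-1) ^ j := by
  have hp : p - 1 + 1 = p := Nat.sub_add_cancel (Fact.out (p := p.Prime)).one_le
  induction j with
  | zero => simp
  | succ j ih =>
    have h1 : ((p.choose (j + 1) : ℕ) : R) = 0 := by
      rw [CharP.cast_eq_zero_iff R p]
      exact (Fact.out (p := p.Prime)).dvd_choose_self (by omega) hj
    rw [← hp, Nat.choose_succ_succ, Nat.cast_add, ih (by omega)] at h1
    rw [pow_succ, mul_neg_one, add_eq_zero_iff_neg_eq.1 h1]

/-- In characteristic `p`, the `(p - 1)`-st power of `ad y` takes `a` to the sum of the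
`y ^ j * a * y ^ (p - 1 - j)`. -/
theorem sum_pow_mul_mul_pow {k A : Type*} [Field k] [CharP k p] [Ring A] [Algebra k A] (y a : A) :
    ∑ j ∈ Finset.range p, y ^ j * a * y ^ (p - 1 - j) = (fun z => ⁅y, z⁆)^[p - 1] a := by
  have hcomm : Commute (LinearMap.mulLeft k y) (-LinearMap.mulRight k y) :=
    (LinearMap.commute_mulLeft_right y y).neg_right
  have h1 : (LinearMap.mulLeft k y + -LinearMap.mulRight k y) ^ (p - 1) =
      ∑ j ∈ Finset.range p, LinearMap.mulLeft k (y ^ j) * LinearMap.mulRight k (y ^ (p - 1 - j)) := by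
    have hp : p - 1 + 1 = p := Nat.sub_add_cancel (Fact.out (p := p.Prime)).one_le
    rw [hcomm.add_pow, hp]
    refine Finset.sum_congr rfl fun j hj => ?_
    have hj' : j < p := Finset.mem_range.1 hj
    have hc : ((p - 1).choose j : Module.End k A) = algebraMap k _ ((-1) ^ (p - 1 - j)) := by
      rw [← Nat.choose_symm (by omega), ← cast_choose_sub_one (p := p) (by omega)]
      simp
    rw [hc, neg_pow, ← LinearMap.pow_mulLeft, ← LinearMap.pow_mulRight, mul_assoc,
      ← Algebra.commutes, map_pow, map_neg, map_one, ← mul_assoc ((-1) ^ _), ← pow_add,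
      Even.neg_one_pow ⟨_, rfl⟩, one_mul]
  have h2 : (fun z => ⁅y, z⁆) = ⇑(LinearMap.mulLeft k y + -LinearMap.mulRight k y) := by
    ext z
    simp [Ring.lie_def, sub_eq_add_neg]
  rw [h2, ← Module.End.coe_pow, h1]
  simp [mul_assoc]

theorem derivative_pow_noncomm {A : Type*} [Ring A] (f : Polynomial A) (n : ℕ) :
    Polynomial.derivative (f ^ n) =
      ∑ j ∈ Finset.range n, f ^ j * Polynomial.derivative f * f ^ (n - 1 - j) := by
  induction n with
  | zero => simp
  | succ n ih =>
    rw [pow_succ, Polynomial.derivative_mul, ih, Finset.sum_range_succ, Finset.sum_mul]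
    simp only [Nat.add_sub_cancel, Nat.sub_self, pow_zero, mul_one]
    congr 1
    refine Finset.sum_congr rfl fun j hj => ?_
    have : n - j = n - 1 - j + 1 := by have := Finset.mem_range.1 hj; omega
    rw [this, pow_succ, mul_assoc _ _ f]

/-- Jacobson's formula: `(a + b) ^ p - a ^ p - b ^ p` lies in every Lie subalgebra containing `a` and
`b`. It is the sum of the middle coefficients of the polynomial `(a T + b) ^ p`, and the derivative
of this polynomial is an iterated bracket of `a T + b` with `a`. -/
theorem add_pow_sub_mem {k A : Type*} [Field k] [CharP k p] [Ring A] [Algebra k A]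
    (K : LieSubalgebra k A) {a b : A} (ha : a ∈ K) (hb : b ∈ K) :
    (a + b) ^ p - a ^ p - b ^ p ∈ K := by
  have hp0 : 0 < p := (Fact.out (p := p.Prime)).pos
  set f : Polynomial A := Polynomial.C a * Polynomial.X + Polynomial.C b with hf
  have hder : Polynomial.derivative f = Polynomial.C a := by simp [hf]
  have hcoeff (n : ℕ) : ∀ i, ((fun z => ⁅f, z⁆)^[n] (Polynomial.C a)).coeff i ∈ K := by
    induction n with
    | zero =>
      intro i
      rw [Function.iterate_zero, id, Polynomial.coeff_C]
      split_ifs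
      exacts [ha, zero_mem _]
    | succ n ih =>
      intro i
      rw [Function.iterate_succ_apply']
      set g := (fun z => ⁅f, z⁆)^[n] (Polynomial.C a)
      have hlie : ⁅f, g⁆ = (Polynomial.C a * g - g * Polynomial.C a) * Polynomial.X +
          (Polynomial.C b * g - g * Polynomial.C b) := by
        rw [Ring.lie_def, hf, add_mul, mul_add, mul_assoc, Polynomial.X_mul]
        noncomm_ring
      rw [hlie, Polynomial.coeff_add]
      refine add_mem ?_ ?_
      · cases i with
        | zero => simp
        | succ i =>
          rw [Polynomial.coeff_mul_X, Polynomial.coeff_sub, Polynomial.coeff_C_mul,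
            Polynomial.coeff_mul_C, ← Ring.lie_def]
          exact K.lie_mem ha (ih i)
      · rw [Polynomial.coeff_sub, Polynomial.coeff_C_mul, Polynomial.coeff_mul_C, ← Ring.lie_def]
        exact K.lie_mem hb (ih i)
  have hmid : ∀ i, i + 1 < p → (f ^ p).coeff (i + 1) ∈ K := by
    intro i hi
    have h1 := hcoeff (p - 1) i
    rw [← sum_pow_mul_mul_pow (k := k), ← hder, ← derivative_pow_noncomm,
      Polynomial.coeff_derivative] at h1
    have h2 : ((i + 1 : ℕ) : k) ≠ 0 := by
      rw [Ne, CharP.cast_eq_zero_iff k p]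
      exact Nat.not_dvd_of_pos_of_lt (by omega) hi
    have h3 := K.smul_mem ((i + 1 : ℕ) : k)⁻¹ h1
    convert h3 using 1
    rw [← Nat.cast_succ, ← Nat.cast_comm, ← map_natCast (algebraMap k A), ← Algebra.smul_def,
      smul_smul, Nat.succ_eq_add_one, inv_mul_cancel₀ h2, one_smul]
  have hdeg : f.natDegree ≤ 1 := by rw [hf]; exact Polynomial.natDegree_linear_le
  have hdeg' : (f ^ p).natDegree < p + 1 :=
    Nat.lt_succ_of_le ((Polynomial.natDegree_pow_le_of_le p hdeg).trans (by simp))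
  have htop : (f ^ p).coeff p = a ^ p := by
    have := Polynomial.coeff_pow_of_natDegree_le (m := p) hdeg
    simpa [hf] using this
  have hbot : (f ^ p).coeff 0 = b ^ p := by
    rw [Polynomial.coeff_zero_eq_eval_zero, ← Polynomial.coeff_zero_eq_eval_zero,
      ← Polynomial.constantCoeff_apply, map_pow]
    simp [hf]
  have heval : (a + b) ^ p = ∑ i ∈ Finset.range (p + 1), (f ^ p).coeff i := by
    have h1 : Polynomial.eval 1 (f ^ p) = (a + b) ^ p := by
      have := map_pow (Polynomial.eval₂RingHom' (RingHom.id A) 1 fun _ => Commute.one_right _) f p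
      simpa [Polynomial.eval₂RingHom', hf, Polynomial.eval₂_id] using this
    rw [← h1, Polynomial.eval_eq_sum_range' hdeg']
    simp
  have hsum : (a + b) ^ p - a ^ p - b ^ p =
      ∑ i ∈ Finset.range (p - 1), (f ^ p).coeff (i + 1) := by
    obtain ⟨m, rfl⟩ : ∃ m, p = m + 1 := ⟨p - 1, by omega⟩
    rw [heval, Finset.sum_range_succ, Finset.sum_range_succ', htop, hbot]
    simp
  rw [hsum]
  exact sum_mem fun i hi => hmid i (by have := Finset.mem_range.1 hi; omega)

/-- In characteristic `p`, the `p ^ j`-th power of `ad x` is `ad (x ^ p ^ j)`. -/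
theorem lie_pow_char_pow {k A : Type*} [Field k] [CharP k p] [Ring A] [Algebra k A] (x y : A)
    (j : ℕ) : ⁅x ^ p ^ j, y⁆ = (fun z => ⁅x, z⁆)^[p ^ j] y := by
  have h2 : (fun z => ⁅x, z⁆) = ⇑(LinearMap.mulLeft k x - LinearMap.mulRight k x) := by
    ext z
    simp [Ring.lie_def]
  have : CharP (Module.End k A) p ∨ Subsingleton A := by
    rcases subsingleton_or_nontrivial A with h | h
    · exact .inr h
    · exact .inl (charP_of_injective_algebraMap (algebraMap k (Module.End k A)).injective p)
  rcases this with h | h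
  · rw [h2, ← Module.End.coe_pow,
      sub_pow_char_pow_of_commute _ _ (LinearMap.commute_mulLeft_right x x)]
    simp [Ring.lie_def]
  · exact Subsingleton.elim _ _

end Jacobson

/-! ### The basis of the free restricted Lie algebra -/

section RestrictedLie

variable {X : Type u} {𝓗 : Set (FreeMagma X)} [LinearOrder X] [LinearOrder 𝓗]

omit [LinearOrder X] [LinearOrder 𝓗] in
/-- The length of a Hall word is the number of letters of its bracketing. -/
theorem wordLength_eq (w : hallWords 𝓗) : wordLength w = (foliage (bracketing w)).length := by
  rw [foliage_bracketing, wordLength]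

/-- Hall words correspond to the members of the Hall set, by bracketing. -/
noncomputable def hallWordsEquiv (h𝓗 : IsHallSet 𝓗) : hallWords 𝓗 ≃ 𝓗 :=
  Equiv.ofBijective (fun w => ⟨bracketing w, bracketing_mem w⟩) <| by
    constructor
    · intro w w' h
      have h1 : bracketing w = bracketing w' := congrArg Subtype.val h
      exact Subtype.ext (by rw [← foliage_bracketing w, h1, foliage_bracketing w'])
    · intro h
      refine ⟨⟨foliage h.1, h.1, h.2, rfl⟩, Subtype.ext ?_⟩
      exact h𝓗.foliage_injOn (bracketing_mem _) h.2 (foliage_bracketing _)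

theorem lieEval_hallWordsEquiv (h𝓗 : IsHallSet 𝓗) {L : Type*} [LieRing L] (e : X → L)
    (w : hallWords 𝓗) : lieEval e (hallWordsEquiv h𝓗 w).1 = hallLie e w := rfl

/-- The `p`-power powers of Hall polynomials in a free family are linearly independent. -/
theorem linearIndependent_hallLie_pow (h𝓗 : IsHallSet 𝓗) (p : ℕ) [Fact p.Prime] {k : Type*}
    [CommRing k] {A : Type*} [Ring A] [Algebra k A] {e : X → A} (he : IsFreeFamily k e) :
    LinearIndependent k fun jw : ℕ × hallWords 𝓗 => hallLie e jw.2 ^ p ^ jw.1 := by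
  have hp := (Fact.out : p.Prime)
  have hsub (j : ℕ) : p ^ j - 1 + 1 = p ^ j := Nat.sub_add_cancel (Nat.pow_pos hp.pos)
  have h1 := (linearIndependent_qEval_pow h𝓗 (1 : k) he).comp
    (fun jw : ℕ × hallWords 𝓗 => (hallWordsEquiv h𝓗 jw.2, p ^ jw.1 - 1)) (by
      rintro ⟨j, w⟩ ⟨j', w'⟩ h
      simp only [Prod.mk.injEq, EmbeddingLike.apply_eq_iff_eq] at h
      have h2 := hsub j
      rw [h.2, hsub] at h2
      rw [h.1, Nat.pow_right_injective hp.two_le h2])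
  convert h1 using 1
  ext jw
  simp only [Function.comp_apply, hsub, ← lieEval_eq_qEval, lieEval_hallWordsEquiv]

variable {k : Type v} {p : ℕ} [Fact p.Prime] [Field k] [CharP k p]

/-- The span of the `p`-power powers of Hall polynomials is a Lie subalgebra: the bracket of any two
of them is already a combination of Hall polynomials. -/
def hallPowSubalgebra (h𝓗 : IsHallSet 𝓗) (p : ℕ) [Fact p.Prime] (k : Type*) [Field k] [CharP k p]
    {A : Type*} [Ring A] [Algebra k A] (e : X → A) : LieSubalgebra k A where
  __ := Submodule.span k (Set.range fun jw : ℕ × hallWords 𝓗 => hallLie e jw.2 ^ p ^ jw.1)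
  lie_mem' {a b} ha hb := by
    change a ∈ Submodule.span k _ at ha
    change b ∈ Submodule.span k _ at hb
    change ⁅a, b⁆ ∈ Submodule.span k _
    have hle : ∀ x ∈ hallLieSubalgebra h𝓗 k e, x ∈ Submodule.span k
        (Set.range fun jw : ℕ × hallWords 𝓗 => hallLie e jw.2 ^ p ^ jw.1) := by
      intro x hx
      refine Submodule.span_mono ?_ hx
      rintro _ ⟨h, rfl⟩
      exact ⟨(0, (hallWordsEquiv h𝓗).symm h), by simp [← lieEval_hallWordsEquiv h𝓗]⟩
    have hmem : ∀ w : hallWords 𝓗, hallLie e w ∈ hallLieSubalgebra h𝓗 k e := fun w =>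
      Submodule.subset_span ⟨hallWordsEquiv h𝓗 w, rfl⟩
    have hiter : ∀ x ∈ hallLieSubalgebra h𝓗 k e, ∀ n, ∀ y ∈ hallLieSubalgebra h𝓗 k e,
        (fun z => ⁅x, z⁆)^[n] y ∈ hallLieSubalgebra h𝓗 k e := by
      intro x hx n y hy
      induction n with
      | zero => exact hy
      | succ n ih =>
        rw [Function.iterate_succ_apply']
        exact LieSubalgebra.lie_mem _ hx ih
    have hpow : ∀ w : hallWords 𝓗, ∀ j, ∀ y ∈ hallLieSubalgebra h𝓗 k e,
        ⁅hallLie e w ^ p ^ j, y⁆ ∈ hallLieSubalgebra h𝓗 k e := by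
      intro w j y hy
      rw [lie_pow_char_pow (k := k)]
      exact hiter _ (hmem w) _ _ hy
    induction ha, hb using Submodule.span_induction₂ with
    | mem_mem x y hx hy =>
      obtain ⟨⟨i, w⟩, rfl⟩ := hx
      obtain ⟨⟨j, w'⟩, rfl⟩ := hy
      refine hle _ ?_
      obtain ⟨m, hm⟩ : ∃ m, p ^ j = m + 1 :=
        ⟨p ^ j - 1, (Nat.sub_add_cancel (Nat.pow_pos (Fact.out : p.Prime).pos)).symm⟩
      rw [← lie_skew]
      refine neg_mem ?_
      simp only
      rw [lie_pow_char_pow (k := k), hm, Function.iterate_succ_apply]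
      refine hiter _ (hmem w') _ _ ?_
      rw [← lie_skew]
      exact neg_mem (hpow _ _ _ (hmem w'))
    | zero_left y hy => simp
    | zero_right x hx => simp
    | add_left x y z _ _ _ hx hy => rw [add_lie]; exact add_mem hx hy
    | add_right x y z _ _ _ hx hy => rw [lie_add]; exact add_mem hx hy
    | smul_left r x y _ _ h => rw [smul_lie]; exact Submodule.smul_mem _ _ h
    | smul_right r x y _ _ h => rw [lie_smul]; exact Submodule.smul_mem _ _ h

theorem pow_mem_hallPowSubalgebra (h𝓗 : IsHallSet 𝓗) {A : Type*} [Ring A] [Algebra k A]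
    (e : X → A) {a : A} (ha : a ∈ hallPowSubalgebra h𝓗 p k e) :
    a ^ p ∈ hallPowSubalgebra h𝓗 p k e := by
  change a ∈ Submodule.span k _ at ha
  induction ha using Submodule.span_induction with
  | mem x hx =>
    obtain ⟨⟨j, w⟩, rfl⟩ := hx
    exact Submodule.subset_span ⟨(j + 1, w), by simp [pow_succ, pow_mul]⟩
  | zero =>
    rw [zero_pow (Fact.out : p.Prime).ne_zero]
    exact zero_mem _
  | add x y hx hy hx' hy' =>
    have := add_mem (add_mem (add_pow_sub_mem (hallPowSubalgebra h𝓗 p k e) hx hy) hy') hx'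
    simpa using this
  | smul r x _ h =>
    rw [smul_pow]
    exact LieSubalgebra.smul_mem _ _ h

omit [LinearOrder X] in
theorem lieEval_mem {L : Type*} [LieRing L] [LieAlgebra k L] {e : X → L} {K : LieSubalgebra k L}
    (hK : ∀ x, e x ∈ K) (t : FreeMagma X) : lieEval e t ∈ K := by
  induction t using magma_induction with
  | of x => exact hK x
  | mul a b ha hb => exact K.lie_mem ha hb

theorem hallPowSubalgebra_eq (h𝓗 : IsHallSet 𝓗) :
    hallPowSubalgebra h𝓗 p k (FreeAlgebra.ι k) = resLieSubalgebra k p X := by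
  apply le_antisymm
  · intro a ha
    refine Submodule.span_le (p := (resLieSubalgebra k p X).toSubmodule).2 ?_ ha
    rintro _ ⟨⟨j, w⟩, rfl⟩
    have h1 : hallLie (FreeAlgebra.ι k) w ∈ resLieSubalgebra k p X :=
      lieEval_mem (ι_mem_resLieSubalgebra k p) _
    change _ ∈ resLieSubalgebra k p X
    simp only
    induction j with
    | zero => simpa using h1
    | succ j ih =>
      rw [pow_succ, pow_mul]
      exact pow_mem_resLieSubalgebra k p ih
  · intro a ha
    refine mem_resLieSubalgebra.1 ha _ (fun x => Submodule.subset_span ?_)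
      fun b hb => pow_mem_hallPowSubalgebra h𝓗 _ hb
    exact ⟨(0, (hallWordsEquiv h𝓗).symm ⟨_, h𝓗.of_mem x⟩), by
      simp [← lieEval_hallWordsEquiv h𝓗, lieEval]⟩

omit [LinearOrder X] [Fact p.Prime] [CharP k p] in
/-- The restricted Lie subalgebra of the free associative algebra which is generated by the letters
is free: an embedding of the target in an associative algebra provides the homomorphism. -/
theorem isFreeRestrictedLie_resLieι :
    IsFreeRestrictedLie k p (resLieι k p : X → resLieSubalgebra k p X) := by
  intro M _ _ _ f
  obtain ⟨A, _, _, θ, hθ, hθp⟩ := RestrictedLieAlgebra.exists_embedding (k := k) (p := p) (L := M)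
  let g : FreeAlgebra k X →ₐ[k] A := FreeAlgebra.lift k fun x => θ (f x)
  have hrange : ∀ a ∈ resLieSubalgebra k p X, ∃ m, θ m = g a := by
    intro a ha
    refine mem_resLieSubalgebra.1 ha (θ.range.comap g.toLieHom) (fun x => ⟨f x, ?_⟩) ?_
    · simp [g]
    · rintro b ⟨m, hm⟩
      refine ⟨RestrictedLieAlgebra.pMap k p m, ?_⟩
      change θ _ = g (b ^ p)
      change θ m = g b at hm
      rw [hθp, hm, map_pow]
  choose F hF using fun a : resLieSubalgebra k p X => hrange a.1 a.2
  refine ⟨⟨⟨⟨F, ?_⟩, ?_⟩, ?_⟩, ⟨fun a => hθ ?_, fun x => hθ ?_⟩, ?_⟩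
  · intro a b
    exact hθ (by simp [hF])
  · intro r a
    exact hθ (by simp [hF])
  · intro a b
    apply hθ
    rw [LieHom.map_lie]
    simp [hF, Ring.lie_def]
  · change θ (F _) = θ (RestrictedLieAlgebra.pMap k p (F _))
    rw [hθp, hF, hF]
    exact map_pow g _ _
  · change θ (F _) = _
    rw [hF]
    simp [g, resLieι]
  · rintro φ ⟨hφp, hφ⟩
    ext ⟨a, ha⟩
    apply hθ
    change _ = θ (F _)
    rw [hF]
    have hmem : ∀ b ∈ resLieSubalgebra k p X,
        ∃ hb : b ∈ resLieSubalgebra k p X, θ (φ ⟨b, hb⟩) = g b := by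
      intro b hb
      let K : LieSubalgebra k (FreeAlgebra k X) :=
        { carrier := {b | ∃ hb : b ∈ resLieSubalgebra k p X, θ (φ ⟨b, hb⟩) = g b}
          add_mem' := by
            rintro x y ⟨hx, hx'⟩ ⟨hy, hy'⟩
            refine ⟨add_mem hx hy, ?_⟩
            rw [map_add, ← hx', ← hy', ← map_add, ← map_add]
            rfl
          zero_mem' := ⟨zero_mem _, by rw [map_zero]; exact (congrArg θ (map_zero φ)).trans (map_zero θ)⟩
          smul_mem' := by
            rintro r x ⟨hx, hx'⟩
            refine ⟨LieSubalgebra.smul_mem _ r hx, ?_⟩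
            rw [map_smul, ← hx', ← map_smul, ← map_smul]
            rfl
          lie_mem' := by
            rintro x y ⟨hx, hx'⟩ ⟨hy, hy'⟩
            refine ⟨LieSubalgebra.lie_mem _ hx hy, ?_⟩
            have hg : g ⁅x, y⁆ = ⁅g x, g y⁆ := g.toLieHom.map_lie x y
            rw [hg, ← hx', ← hy', ← LieHom.map_lie, ← LieHom.map_lie]
            rfl }
      refine mem_resLieSubalgebra.1 hb K (fun x => ⟨ι_mem_resLieSubalgebra k p x, ?_⟩) ?_
      · have := hφ x
        rw [resLieι] at this
        rw [this]
        simp [g]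
      · rintro b ⟨hb, hb'⟩
        refine ⟨pow_mem_resLieSubalgebra k p hb, ?_⟩
        have := hφp ⟨b, hb⟩
        rw [map_pow, ← hb', ← hθp, ← this]
        rfl
    exact (hmem a ha).2

omit [LinearOrder X] [LinearOrder 𝓗] [Fact p.Prime] [CharP k p] in
theorem map_hallLiePow {L M : Type*} [LieRing L] [LieAlgebra k L] [RestrictedLieAlgebra k p L]
    [LieRing M] [LieAlgebra k M] [RestrictedLieAlgebra k p M] (φ : L →ₗ⁅k⁆ M)
    (hφ : ∀ a : L, φ (RestrictedLieAlgebra.pMap k p a) = RestrictedLieAlgebra.pMap k p (φ a))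
    (ι : X → L) (jw : ℕ × hallWords 𝓗) :
    φ (hallLiePow k p ι jw) = hallLiePow k p (fun x => φ (ι x)) jw := by
  obtain ⟨j, w⟩ := jw
  have h1 : ∀ t : FreeMagma X, φ (lieEval ι t) = lieEval (fun x => φ (ι x)) t := by
    intro t
    induction t using magma_induction with
    | of x => rfl
    | mul a b ha hb =>
      change φ ⁅_, _⁆ = ⁅_, _⁆
      rw [LieHom.map_lie, ha, hb]
  induction j with
  | zero => exact h1 _
  | succ j ih =>
    simp only [hallLiePow, Function.iterate_succ_apply'] at ih ⊢
    rw [hφ, ih]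

omit [LinearOrder X] [LinearOrder 𝓗] [Fact p.Prime] [CharP k p] in
theorem coe_hallLiePow_resLieι (jw : ℕ × hallWords 𝓗) :
    ((hallLiePow k p (resLieι k p : X → resLieSubalgebra k p X) jw : resLieSubalgebra k p X) :
      FreeAlgebra k X) =
      hallLie (FreeAlgebra.ι k) jw.2 ^ p ^ jw.1 := by
  obtain ⟨j, w⟩ := jw
  have h1 : ∀ t : FreeMagma X,
      ((lieEval (resLieι k p : X → resLieSubalgebra k p X) t : resLieSubalgebra k p X) :
        FreeAlgebra k X) =
        lieEval (FreeAlgebra.ι k) t := by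
    intro t
    induction t using magma_induction with
    | of x => rfl
    | mul a b ha hb =>
      change (⁅((_ : resLieSubalgebra k p X) : FreeAlgebra k X), _⁆ : FreeAlgebra k X) = ⁅_, _⁆
      rw [ha, hb]
  induction j with
  | zero => simpa [hallLiePow, hallLie] using h1 _
  | succ j ih =>
    simp only [hallLiePow, Function.iterate_succ_apply'] at ih ⊢
    rw [pow_succ, pow_mul, ← ih]
    rfl

omit [LinearOrder X] [LinearOrder 𝓗] [Fact p.Prime] [CharP k p] in
/-- Two free restricted Lie algebras on the same set are isomorphic. -/
theorem IsFreeRestrictedLie.exists_equiv {L M : Type w} [LieRing L] [LieAlgebra k L]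
    [RestrictedLieAlgebra k p L] [LieRing M] [LieAlgebra k M] [RestrictedLieAlgebra k p M]
    {ι : X → L} {κ : X → M} (hL : IsFreeRestrictedLie k p ι) (hM : IsFreeRestrictedLie k p κ) :
    ∃ φ : L →ₗ⁅k⁆ M, Function.Bijective φ ∧
      (∀ a : L, φ (RestrictedLieAlgebra.pMap k p a) = RestrictedLieAlgebra.pMap k p (φ a)) ∧
      ∀ x, φ (ι x) = κ x := by
  obtain ⟨φ, ⟨hφp, hφ⟩, -⟩ := hL M κ
  obtain ⟨ψ, ⟨hψp, hψ⟩, -⟩ := hM L ι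
  have h1 : ψ.comp φ = LieHom.id := (hL L ι).unique
    ⟨fun a => by simp [hφp, hψp], fun x => by simp [hφ, hψ]⟩ ⟨fun a => rfl, fun x => rfl⟩
  have h2 : φ.comp ψ = LieHom.id := (hM M κ).unique
    ⟨fun a => by simp [hφp, hψp], fun x => by simp [hφ, hψ]⟩ ⟨fun a => rfl, fun x => rfl⟩
  refine ⟨φ, Function.bijective_iff_has_inverse.2 ⟨ψ, fun a => ?_, fun a => ?_⟩, hφp, hφ⟩
  · exact LieHom.congr_fun h1 a
  · exact LieHom.congr_fun h2 a

/-- The powers of Hall polynomials form a basis of the restricted Lie algebra inside the free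
associative algebra. -/
theorem hallLie_pow_basis (h𝓗 : IsHallSet 𝓗) :
    LinearIndependent k (fun jw : ℕ × hallWords 𝓗 =>
      (hallLie (FreeAlgebra.ι k) jw.2 : FreeAlgebra k X) ^ p ^ jw.1) ∧
    Submodule.span k (Set.range fun jw : ℕ × hallWords 𝓗 =>
      (hallLie (FreeAlgebra.ι k) jw.2 : FreeAlgebra k X) ^ p ^ jw.1) =
      (resLieSubalgebra k p X).toSubmodule :=
  ⟨linearIndependent_hallLie_pow h𝓗 p (isFreeFamily_ι k),
    congrArg LieSubalgebra.toSubmodule (hallPowSubalgebra_eq (k := k) (p := p) h𝓗)⟩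

/-- The powers of Hall elements form a basis of every free restricted Lie algebra. -/
theorem IsFreeRestrictedLie.hallLiePow_basis (h𝓗 : IsHallSet 𝓗) {L : Type (max u v)} [LieRing L]
    [LieAlgebra k L] [RestrictedLieAlgebra k p L] {ι : X → L} (hι : IsFreeRestrictedLie k p ι) :
    LinearIndependent k (hallLiePow k p ι : ℕ × hallWords 𝓗 → L) ∧
      Submodule.span k (Set.range (hallLiePow k p ι : ℕ × hallWords 𝓗 → L)) = ⊤ := by
  obtain ⟨φ, hφ, hφp, hφι⟩ :=
    hι.exists_equiv (isFreeRestrictedLie_resLieι (k := k) (p := p) (X := X))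
  let ψ : L →ₗ[k] FreeAlgebra k X :=
    (resLieSubalgebra k p X).toSubmodule.subtype ∘ₗ (φ : L →ₗ[k] resLieSubalgebra k p X)
  have hψ : ψ ∘ (hallLiePow k p ι : ℕ × hallWords 𝓗 → L) = fun jw : ℕ × hallWords 𝓗 =>
      (hallLie (FreeAlgebra.ι k) jw.2 : FreeAlgebra k X) ^ p ^ jw.1 := by
    ext jw
    rw [← coe_hallLiePow_resLieι]
    change ((φ (hallLiePow k p ι jw) : resLieSubalgebra k p X) : FreeAlgebra k X) = _
    rw [map_hallLiePow φ hφp, funext hφι]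
  have hinj : Function.Injective ψ := Subtype.val_injective.comp hφ.1
  obtain ⟨h1, h2⟩ := hallLie_pow_basis (k := k) (p := p) h𝓗
  refine ⟨LinearIndependent.of_comp ψ (hψ ▸ h1), ?_⟩
  refine Submodule.map_injective_of_injective hinj ?_
  rw [Submodule.map_span, ← Set.range_comp, hψ, h2]
  ext a
  constructor
  · intro ha
    obtain ⟨b, hb⟩ := hφ.2 ⟨a, ha⟩
    exact ⟨b, trivial, congrArg Subtype.val hb⟩
  · rintro ⟨b, -, rfl⟩
    exact (φ b).2

end RestrictedLie

/-! ### Power series in non-commuting variables -/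

/-- Formal power series in non-commuting variables from `X`, as functions on words. -/
def WordSeries (X : Type u) (k : Type v) : Type (max u v) := List X → k

namespace WordSeries

variable {X : Type u} {k : Type v}

section Ring

variable [CommRing k]

instance : AddCommGroup (WordSeries X k) := inferInstanceAs (AddCommGroup (List X → k))

instance : Module k (WordSeries X k) := inferInstanceAs (Module k (List X → k))

omit [CommRing k] in
@[ext] theorem ext {f g : WordSeries X k} (h : ∀ w, f w = g w) : f = g := funext h

@[simp] theorem add_apply (f g : WordSeries X k) (w : List X) : (f + g) w = f w + g w := rfl
@[simp] theorem sub_apply (f g : WordSeries X k) (w : List X) : (f - g) w = f w - g w := rfl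
@[simp] theorem neg_apply (f : WordSeries X k) (w : List X) : (-f) w = -f w := rfl
@[simp] theorem zero_apply (w : List X) : (0 : WordSeries X k) w = 0 := rfl
@[simp] theorem smul_apply (r : k) (f : WordSeries X k) (w : List X) : (r • f) w = r * f w := rfl

/-- The series of the coefficients at the words which begin with a given letter, with this letter
removed. -/
def tail (a : X) (f : WordSeries X k) : WordSeries X k := fun w => f (a :: w)

/-- The coefficient of a product of series (the sum over all factorizations of the word), by
recursion on the word. -/
def mulCoeff (f g : WordSeries X k) : List X → k
  | [] => f [] * g []
  | a :: w => f [] * g (a :: w) + mulCoeff (tail a f) g w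

instance : Mul (WordSeries X k) := ⟨mulCoeff⟩

theorem mul_nil (f g : WordSeries X k) : (f * g) [] = f [] * g [] := rfl

theorem mul_cons (f g : WordSeries X k) (a : X) (w : List X) :
    (f * g) (a :: w) = f [] * g (a :: w) + (tail a f * g) w := rfl

/-- The series `1`. -/
def oneCoeff : WordSeries X k
  | [] => 1
  | _ :: _ => 0

instance : One (WordSeries X k) := ⟨oneCoeff⟩

@[simp] theorem one_nil : (1 : WordSeries X k) [] = 1 := rfl
@[simp] theorem one_cons (a : X) (w : List X) : (1 : WordSeries X k) (a :: w) = 0 := rfl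
@[simp] theorem tail_one (a : X) : tail a (1 : WordSeries X k) = 0 := rfl

theorem tail_mul (a : X) (f g : WordSeries X k) : tail a (f * g) = f [] • tail a g + tail a f * g :=
  rfl
theorem tail_add (a : X) (f g : WordSeries X k) : tail a (f + g) = tail a f + tail a g := rfl
theorem tail_smul (a : X) (r : k) (f : WordSeries X k) : tail a (r • f) = r • tail a f := rfl

protected theorem add_mul (f g h : WordSeries X k) : (f + g) * h = f * h + g * h := by
  ext w
  induction w generalizing f g with
  | nil => simp [mul_nil, add_mul]
  | cons a w ih => simp [mul_cons, tail_add, ih, add_mul]; ring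

protected theorem mul_add (f g h : WordSeries X k) : f * (g + h) = f * g + f * h := by
  ext w
  induction w generalizing f with
  | nil => simp [mul_nil, mul_add]
  | cons a w ih => simp [mul_cons, ih, mul_add]; ring

protected theorem smul_mul (r : k) (f g : WordSeries X k) : (r • f) * g = r • (f * g) := by
  ext w
  induction w generalizing f with
  | nil => simp [mul_nil, mul_assoc]
  | cons a w ih => simp [mul_cons, tail_smul, ih]; ring

protected theorem mul_smul (r : k) (f g : WordSeries X k) : f * (r • g) = r • (f * g) := by
  ext w
  induction w generalizing f with
  | nil => simp [mul_nil]; ring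
  | cons a w ih => simp [mul_cons, ih]; ring

protected theorem mul_assoc (f g h : WordSeries X k) : f * g * h = f * (g * h) := by
  ext w
  induction w generalizing f with
  | nil => simp [mul_nil, mul_assoc]
  | cons a w ih =>
    simp [mul_cons, tail_mul, ih, WordSeries.add_mul, WordSeries.smul_mul, mul_nil]; ring

protected theorem zero_mul (f : WordSeries X k) : 0 * f = 0 := by
  have := WordSeries.smul_mul (0 : k) 0 f
  rwa [zero_smul, zero_smul] at this

protected theorem mul_zero (f : WordSeries X k) : f * 0 = 0 := by
  have := WordSeries.mul_smul (0 : k) f 0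
  rwa [zero_smul, zero_smul] at this

protected theorem one_mul (f : WordSeries X k) : 1 * f = f := by
  ext w
  cases w with
  | nil => simp [mul_nil]
  | cons a w => simp [mul_cons, WordSeries.zero_mul]

protected theorem mul_one (f : WordSeries X k) : f * 1 = f := by
  ext w
  induction w generalizing f with
  | nil => simp [mul_nil]
  | cons a w ih => simp [mul_cons, ih, tail]

instance : Ring (WordSeries X k) :=
  { (inferInstance : AddCommGroup (WordSeries X k)) with
    mul := (· * ·)
    one := 1
    left_distrib := WordSeries.mul_add
    right_distrib := WordSeries.add_mul
    zero_mul := WordSeries.zero_mul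
    mul_zero := WordSeries.mul_zero
    mul_assoc := WordSeries.mul_assoc
    one_mul := WordSeries.one_mul
    mul_one := WordSeries.mul_one }

instance : Algebra k (WordSeries X k) :=
  Algebra.ofModule WordSeries.smul_mul fun r f g => WordSeries.mul_smul r f g

theorem exists_append_of_mul_ne_zero {f g : WordSeries X k} {w : List X} (h : (f * g) w ≠ 0) :
    ∃ u v, w = u ++ v ∧ f u ≠ 0 ∧ g v ≠ 0 := by
  induction w generalizing f with
  | nil => exact ⟨[], [], rfl, left_ne_zero_of_mul h, right_ne_zero_of_mul h⟩
  | cons a w ih =>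
    rw [mul_cons] at h
    by_cases h1 : f [] * g (a :: w) = 0
    · rw [h1, zero_add] at h
      obtain ⟨u, v, rfl, hu, hv⟩ := ih h
      exact ⟨a :: u, v, rfl, hu, hv⟩
    · exact ⟨[], a :: w, rfl, left_ne_zero_of_mul h1, right_ne_zero_of_mul h1⟩

/-- The series of order at least `n`. -/
def ordGE (X : Type u) (k : Type v) [CommRing k] (n : ℕ) : AddSubgroup (WordSeries X k) where
  carrier := {f | ∀ w : List X, w.length < n → f w = 0}
  add_mem' hf hg w hw := by simp [hf w hw, hg w hw]
  zero_mem' _ _ := rfl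
  neg_mem' hf w hw := by simp [hf w hw]

theorem mem_ordGE {n : ℕ} {f : WordSeries X k} :
    f ∈ ordGE X k n ↔ ∀ w : List X, w.length < n → f w = 0 := Iff.rfl

theorem mul_mem_ordGE {m n : ℕ} {f g : WordSeries X k} (hf : f ∈ ordGE X k m)
    (hg : g ∈ ordGE X k n) : f * g ∈ ordGE X k (m + n) := by
  intro w hw
  by_contra h
  obtain ⟨u, v, rfl, hu, hv⟩ := exists_append_of_mul_ne_zero h
  have h1 : m ≤ u.length := not_lt.1 fun h => hu (hf u h)
  have h2 : n ≤ v.length := not_lt.1 fun h => hv (hg v h)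
  rw [List.length_append] at hw
  omega

theorem ordGE_anti {m n : ℕ} (h : m ≤ n) : ordGE X k n ≤ ordGE X k m :=
  fun _ hf w hw => hf w (hw.trans_le h)

theorem mem_ordGE_zero (f : WordSeries X k) : f ∈ ordGE X k 0 := fun _ h => absurd h (by simp)

theorem mul_left_mem_ordGE {n : ℕ} {f g : WordSeries X k} (hg : g ∈ ordGE X k n) :
    f * g ∈ ordGE X k n := by
  simpa using mul_mem_ordGE (mem_ordGE_zero f) hg

/-- The series all of whose words have a given multiset of letters. -/
def IsSupported (C : Multiset X) (f : WordSeries X k) : Prop := ∀ w : List X, f w ≠ 0 → ↑w = C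

theorem IsSupported.mul {C D : Multiset X} {f g : WordSeries X k} (hf : IsSupported C f)
    (hg : IsSupported D g) : IsSupported (C + D) (f * g) := by
  intro w hw
  obtain ⟨u, v, rfl, hu, hv⟩ := exists_append_of_mul_ne_zero hw
  rw [← hf u hu, ← hg v hv, Multiset.coe_add]

theorem IsSupported.sub {C : Multiset X} {f g : WordSeries X k} (hf : IsSupported C f)
    (hg : IsSupported C g) : IsSupported C (f - g) := by
  intro w hw
  by_contra h
  have h1 : f w = 0 := by_contra fun h' => h (hf w h')
  have h2 : g w = 0 := by_contra fun h' => h (hg w h')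
  exact hw (by simp [h1, h2])

theorem isSupported_one : IsSupported 0 (1 : WordSeries X k)
  | [], _ => rfl
  | _ :: _, h => absurd rfl h

theorem IsSupported.pow {C : Multiset X} {f : WordSeries X k} (hf : IsSupported C f) (n : ℕ) :
    IsSupported (n • C) (f ^ n) := by
  induction n with
  | zero => simpa using isSupported_one
  | succ n ih => rw [pow_succ, succ_nsmul]; exact ih.mul hf

theorem IsSupported.mem_ordGE {C : Multiset X} {f : WordSeries X k} (hf : IsSupported C f) :
    f ∈ ordGE X k C.card := by
  intro w hw
  by_contra h
  rw [← hf w h, Multiset.coe_card] at hw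
  exact lt_irrefl _ hw

open Classical in
/-- The variable attached to a letter. -/
noncomputable def var (k : Type v) [CommRing k] (x : X) : WordSeries X k :=
  fun w => if w = [x] then 1 else 0

open Classical in
theorem tail_var (a x : X) : tail a (var k x) = if a = x then 1 else 0 := by
  ext w
  by_cases h : a = x <;> cases w <;> simp [tail, var, h]

@[simp] theorem var_nil (x : X) : var k x [] = 0 := by simp [var]

theorem isSupported_var (x : X) : IsSupported {x} (var k x) := by
  intro w hw
  have : w = [x] := by
    by_contra h
    exact hw (by simp [var, h])
  rw [this]
  rfl

theorem isSupported_lieEval (t : FreeMagma X) : IsSupported (content t) (lieEval (var k) t) := by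
  induction t using magma_induction with
  | of x => exact isSupported_var x
  | mul a b ha hb =>
    rw [content_mul]
    change IsSupported _ ⁅_, _⁆
    rw [Ring.lie_def]
    exact (ha.mul hb).sub (by rw [add_comm]; exact hb.mul ha)

open Classical in
theorem prod_var_apply (l w : List X) :
    ((l.map (var k)).prod : WordSeries X k) w = if w = l then 1 else 0 := by
  induction l generalizing w with
  | nil => cases w <;> simp
  | cons x l ih =>
    rw [List.map_cons, List.prod_cons]
    cases w with
    | nil => simp [mul_nil]
    | cons a w =>
      rw [mul_cons, tail_var]
      by_cases h : a = x <;> simp [h, ih]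

/-- The variables generate a free algebra in the algebra of series. -/
theorem isFreeFamily_var : IsFreeFamily k (var k : X → WordSeries X k) := by
  classical
  have h1 (v : List X →₀ k) (w : List X) :
      FreeAlgebra.lift k (var k) (wordValue v) w = v w.reverse := by
    induction v using Finsupp.induction_linear with
    | zero => simp
    | add f g hf hg => simp [hf, hg]
    | single l r =>
      simp only [wordValue, Finsupp.linearCombination_single, map_smul, smul_apply, map_list_prod,
        List.map_map]
      have : (⇑(FreeAlgebra.lift k (var k : X → WordSeries X k)) ∘ FreeAlgebra.ι k) = var k := by
        ext x : 1
        simp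
      rw [this, prod_var_apply, Finsupp.single_apply]
      by_cases h : w = l.reverse
      · simp [h]
      · have h' : l ≠ w.reverse := fun h' => h (by rw [h', List.reverse_reverse])
        simp [h, h']
  have h2 (g : FreeAlgebra k X) : ∃ v : List X →₀ k, wordValue v = g := by
    refine ⟨_, (wordValue_lift_consOp g (Finsupp.single [] 1)).trans ?_⟩
    simp [wordValue]
  intro a b hab
  obtain ⟨v, rfl⟩ := h2 a
  obtain ⟨v', rfl⟩ := h2 b
  congr 1
  ext w
  have := congrArg (fun f : WordSeries X k => f w.reverse) hab
  simpa [h1] using this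

open Classical in
/-- The inverse of the series `1 + x`. -/
noncomputable def invOneAddVar (k : Type v) [CommRing k] (x : X) : WordSeries X k
  | [] => 1
  | a :: w => if a = x then -invOneAddVar k x w else 0

/-- The unit `1 + x` attached to a letter `x`. -/
noncomputable def oneAddVar (k : Type v) [CommRing k] (x : X) : (WordSeries X k)ˣ where
  val := 1 + var k x
  inv := invOneAddVar k x
  val_inv := by
    classical
    rw [add_mul, one_mul]
    ext w
    cases w with
    | nil => simp [mul_nil, invOneAddVar]
    | cons a w =>
      rw [add_apply, mul_cons, tail_var, invOneAddVar]
      by_cases h : a = x <;> simp [h]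
  inv_val := by
    classical
    ext w
    induction w with
    | nil => simp [mul_nil, invOneAddVar]
    | cons a w ih =>
      rw [mul_cons]
      by_cases h : a = x
      · have h1 : tail a (invOneAddVar k x) =
            -(invOneAddVar k x) := by
          ext w
          simp [tail, invOneAddVar, h]
        have h2 : var k x (a :: w) = (1 : WordSeries X k) w := by
          cases w <;> simp [var, h]
        rw [h1, neg_mul, neg_apply, ih, add_apply, h2]
        simp [invOneAddVar]
      · have h1 : tail a (invOneAddVar k x) = 0 := by
          ext w
          simp [tail, invOneAddVar, h]
        rw [h1, zero_mul]
        simp [var, h]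

instance [CharP k p] : CharP (WordSeries X k) p := by
  rcases subsingleton_or_nontrivial k with h | h
  · refine ⟨fun n => ⟨fun _ => ?_, fun _ => ?_⟩⟩
    · rw [← CharP.cast_eq_zero_iff k p]; exact Subsingleton.elim _ _
    · ext; exact Subsingleton.elim _ _
  · refine charP_of_injective_algebraMap (R := k) (fun r s hrs => ?_) p
    have := congrArg (fun f : WordSeries X k => f []) hrs
    simpa [Algebra.algebraMap_eq_smul_one] using this

end Ring

section Topology

variable [CommRing k] [TopologicalSpace k]

instance : TopologicalSpace (WordSeries X k) := inferInstanceAs (TopologicalSpace (List X → k))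

instance [CompactSpace k] : CompactSpace (WordSeries X k) :=
  inferInstanceAs (CompactSpace (List X → k))

instance [T2Space k] : T2Space (WordSeries X k) := inferInstanceAs (T2Space (List X → k))

instance [TotallyDisconnectedSpace k] : TotallyDisconnectedSpace (WordSeries X k) :=
  inferInstanceAs (TotallyDisconnectedSpace (List X → k))

omit [CommRing k] in
theorem continuous_coeff (w : List X) : Continuous fun f : WordSeries X k => f w :=
  continuous_apply w

instance [IsTopologicalRing k] : ContinuousMul (WordSeries X k) := by
  refine ⟨continuous_pi fun w => ?_⟩
  have h (w : List X) : ∀ {Y : Type (max u v)} [TopologicalSpace Y] (F G : Y → WordSeries X k),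
      Continuous F → Continuous G → Continuous fun y => (F y * G y) w := by
    induction w with
    | nil =>
      intro Y _ F G hF hG
      exact ((continuous_coeff []).comp hF).mul ((continuous_coeff []).comp hG)
    | cons a w ih =>
      intro Y _ F G hF hG
      refine (((continuous_coeff []).comp hF).mul ((continuous_coeff (a :: w)).comp hG)).add
        (ih (fun y => tail a (F y)) G ?_ hG)
      exact continuous_pi fun v => (continuous_coeff (a :: v)).comp hF
  exact h w Prod.fst Prod.snd continuous_fst continuous_snd

instance [TotallyDisconnectedSpace k] : TotallyDisconnectedSpace (WordSeries X k)ˣ := by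
  refine ⟨isTotallyDisconnected_of_image (f := Units.val) Units.continuous_val.continuousOn
    Units.val_injective (isTotallyDisconnected_of_totallyDisconnectedSpace _)⟩

theorem tendsto_oneAddVar :
    Filter.Tendsto (oneAddVar k : X → (WordSeries X k)ˣ) Filter.cofinite (𝓝 1) := by
  have h (F : X → WordSeries X k) (hF : ∀ (a : X) (w : List X) (x : X), x ≠ a → F x (a :: w) = 0)
      (h1 : ∀ x, F x [] = 1) : Filter.Tendsto F Filter.cofinite (𝓝 1) := by
    refine tendsto_pi_nhds.2 fun w => tendsto_nhds_of_eventually_eq ?_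
    cases w with
    | nil => exact Filter.Eventually.of_forall h1
    | cons a w =>
      filter_upwards [(Set.finite_singleton a).compl_mem_cofinite] with x hx
      exact hF a w x hx
  rw [Units.isEmbedding_embedProduct.tendsto_nhds_iff]
  refine Filter.Tendsto.prodMk_nhds (h _ ?_ ?_)
    ((MulOpposite.continuous_op.tendsto _).comp (h _ ?_ ?_))
  · intro a w x hx
    simp [oneAddVar, var, hx.symm]
  · intro x
    simp [oneAddVar]
  · intro a w x hx
    change invOneAddVar k x (a :: w) = 0
    simp [invOneAddVar, hx.symm]
  · exact fun _ => rfl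

end Topology

end WordSeries

/-! ### Commutators in the profinite lower central series -/

section LowerCentral

open scoped commutatorElement

variable {G : Type u} [Group G]

theorem comm_eq (σ τ : G) : comm σ τ = ⁅σ⁻¹, τ⁻¹⁆ := by
  simp [comm, commutatorElement_def]

theorem closure_comm (K K' : Subgroup G) :
    Subgroup.closure {g : G | ∃ σ ∈ K, ∃ τ ∈ K', g = comm σ τ} = ⁅K, K'⁆ := by
  apply le_antisymm
  · rw [Subgroup.closure_le]
    rintro _ ⟨σ, hσ, τ, hτ, rfl⟩
    rw [comm_eq]
    exact Subgroup.commutator_mem_commutator (inv_mem hσ) (inv_mem hτ)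
  · rw [Subgroup.commutator_le]
    intro σ hσ τ hτ
    exact Subgroup.subset_closure ⟨σ⁻¹, inv_mem hσ, τ⁻¹, inv_mem hτ, by simp [comm_eq]⟩

theorem commutator_commutator_le_of_rotate {H₁ H₂ H₃ N : Subgroup G} [N.Normal]
    (h1 : ⁅⁅H₂, H₃⁆, H₁⁆ ≤ N) (h2 : ⁅⁅H₃, H₁⁆, H₂⁆ ≤ N) : ⁅⁅H₁, H₂⁆, H₃⁆ ≤ N := by
  have key (K : Subgroup G) : K ≤ N ↔ K.map (QuotientGroup.mk' N) = ⊥ := by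
    rw [Subgroup.map_eq_bot_iff, QuotientGroup.ker_mk']
  rw [key, Subgroup.map_commutator, Subgroup.map_commutator] at *
  exact Subgroup.commutator_commutator_eq_bot_of_rotate h1 h2

variable [TopologicalSpace G] [IsTopologicalGroup G]

theorem lowerCentral_add_two (i : ℕ) :
    lowerCentral G (i + 2) = (⁅(⊤ : Subgroup G), lowerCentral G (i + 1)⁆).topologicalClosure := by
  rw [lowerCentral, closedCommutator, closure_comm]

theorem isClosed_lowerCentral : ∀ i, IsClosed (lowerCentral G i : Set G)
  | 0 => isClosed_univ
  | 1 => isClosed_univ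
  | _ + 2 => Subgroup.isClosed_topologicalClosure _

theorem commutator_top_lowerCentral_le {i : ℕ} (hi : 1 ≤ i) :
    ⁅(⊤ : Subgroup G), lowerCentral G i⁆ ≤ lowerCentral G (i + 1) := by
  obtain ⟨i, rfl⟩ : ∃ j, i = j + 1 := ⟨i - 1, by omega⟩
  rw [lowerCentral_add_two]
  exact Subgroup.le_topologicalClosure _

/-- By the three subgroups lemma `[G^(i), G^(j)] ⊆ G^(i+j)`, the passage from abstract commutators to
the closures in the definition being by continuity. -/
theorem commutator_lowerCentral_le {i j : ℕ} (hi : 1 ≤ i) (hj : 1 ≤ j) :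
    ⁅lowerCentral G i, lowerCentral G j⁆ ≤ lowerCentral G (i + j) := by
  induction i, hi using Nat.le_induction generalizing j with
  | base =>
    rw [add_comm]
    exact commutator_top_lowerCentral_le hj
  | succ i hi ih =>
    have hN := lowerCentral_normal (G := G) (i + 1 + j)
    have h3 : ⁅⁅(⊤ : Subgroup G), lowerCentral G i⁆, lowerCentral G j⁆ ≤
        lowerCentral G (i + 1 + j) := by
      apply commutator_commutator_le_of_rotate
      · refine (Subgroup.commutator_mono (ih hj) le_rfl).trans ?_
        rw [Subgroup.commutator_comm, add_right_comm]
        exact commutator_top_lowerCentral_le (by omega)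
      · rw [Subgroup.commutator_comm _ (⊤ : Subgroup G), Subgroup.commutator_comm]
        refine (Subgroup.commutator_mono le_rfl (commutator_top_lowerCentral_le hj)).trans ?_
        rw [add_assoc, add_comm 1]
        exact ih (by omega)
    rw [Subgroup.commutator_le] at h3 ⊢
    intro σ hσ τ hτ
    obtain ⟨i, rfl⟩ : ∃ j, i = j + 1 := ⟨i - 1, by omega⟩
    rw [lowerCentral_add_two, ← SetLike.mem_coe, Subgroup.topologicalClosure_coe] at hσ
    have hcl : IsClosed {σ : G | ⁅σ, τ⁆ ∈ lowerCentral G (i + 1 + 1 + j)} := by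
      refine (isClosed_lowerCentral _).preimage (f := fun σ : G => ⁅σ, τ⁆) ?_
      simp only [commutatorElement_def]
      fun_prop
    exact closure_minimal (fun σ hσ => h3 σ hσ τ hτ) hcl hσ

theorem comm_mem_lowerCentral {i j : ℕ} (hi : 1 ≤ i) (hj : 1 ≤ j) {σ τ : G}
    (hσ : σ ∈ lowerCentral G i) (hτ : τ ∈ lowerCentral G j) :
    comm σ τ ∈ lowerCentral G (i + j) := by
  rw [comm_eq]
  exact commutator_lowerCentral_le hi hj
    (Subgroup.commutator_mem_commutator (inv_mem hσ) (inv_mem hτ))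

theorem commEval_mem_lowerCentral {X : Type u} (ι : X → G) (t : FreeMagma X) :
    commEval ι t ∈ lowerCentral G (content t).card := by
  induction t using magma_induction with
  | of x => trivial
  | mul a b ha hb =>
    rw [content_mul, Multiset.card_add]
    exact comm_mem_lowerCentral (content_card_pos a) (content_card_pos b) ha hb

theorem isClosed_zassenhaus (p n : ℕ) : IsClosed (zassenhaus G p n : Set G) :=
  Subgroup.isClosed_topologicalClosure _

theorem pow_mem_zassenhaus {p n i j : ℕ} (hi : 1 ≤ i) (hn : n ≤ i * p ^ j) {σ : G}
    (hσ : σ ∈ lowerCentral G i) : σ ^ p ^ j ∈ zassenhaus G p n :=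
  Subgroup.le_topologicalClosure _ (Subgroup.subset_closure ⟨i, j, hi, hn, σ, hσ, rfl⟩)

theorem commEval_pow_mem_zassenhaus {X : Type u} (ι : X → G) (t : FreeMagma X) {p n j : ℕ}
    (hn : n ≤ (content t).card * p ^ j) : commEval ι t ^ p ^ j ∈ zassenhaus G p n :=
  pow_mem_zassenhaus (content_card_pos t) hn (commEval_mem_lowerCentral ι t)

end LowerCentral

/-! ### The collection process -/

section Collection

variable {X : Type u} {G : Type u} [Group G]

theorem inv_mul_commEval_mul (ι : X → G) (z m : FreeMagma X) :
    (commEval ι m)⁻¹ * commEval ι z * commEval ι m = commEval ι z * commEval ι (z * m) := by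
  change _ = _ * comm _ _
  simp only [comm]
  group

/-- The group generated by a set of commutators closed under `z ↦ [z, m]` is normalized by `m`,
modulo a normal subgroup which contains all commutators of large weight. -/
theorem mem_normalizer_of_elim (ι : X → G) {N : ℕ} {M : Subgroup G} [M.Normal]
    (hM : ∀ t : FreeMagma X, N ≤ (content t).card → commEval ι t ∈ M) {m : FreeMagma X}
    {Z : Set (FreeMagma X)} (hZ : ∀ z ∈ Z, z * m ∈ Z) :
    commEval ι m ∈ Subgroup.normalizer
      ((Subgroup.closure (commEval ι '' Z) ⊔ M : Subgroup G) : Set G) := by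
  set K : Subgroup G := Subgroup.closure (commEval ι '' Z) ⊔ M with hK
  have hgen : ∀ z ∈ Z, commEval ι z ∈ K := fun z hz =>
    Subgroup.mem_sup_left (Subgroup.subset_closure ⟨z, hz, rfl⟩)
  have hMK : M ≤ K := le_sup_right
  have hconj (x : G) (h : ∀ z ∈ Z, x * commEval ι z * x⁻¹ ∈ K) : ∀ g ∈ K, x * g * x⁻¹ ∈ K := by
    have : K ≤ K.comap (MulAut.conj x).toMonoidHom := by
      refine sup_le ?_ fun g hg => hMK (Subgroup.Normal.conj_mem ‹_› g hg x)
      rw [Subgroup.closure_le]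
      rintro _ ⟨z, hz, rfl⟩
      exact h z hz
    exact fun g hg => this hg
  have h1 : ∀ z ∈ Z, (commEval ι m)⁻¹ * commEval ι z * (commEval ι m)⁻¹⁻¹ ∈ K := by
    intro z hz
    rw [inv_inv, inv_mul_commEval_mul]
    exact mul_mem (hgen z hz) (hgen _ (hZ z hz))
  -- by descending induction on the weight, starting with the weights from `N` on
  have h2 : ∀ n, ∀ z ∈ Z, N ≤ n + (content z).card →
      commEval ι m * commEval ι z * (commEval ι m)⁻¹ ∈ K := by
    intro n
    induction n with
    | zero =>
      intro z _ hn
      exact hMK (Subgroup.Normal.conj_mem ‹_› _ (hM z (by omega)) _)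
    | succ n ih =>
      intro z hz hn
      have h3 := ih _ (hZ z hz) (by
        have := content_card_pos m
        rw [content_mul, Multiset.card_add]
        omega)
      have h4 : commEval ι m * commEval ι z * (commEval ι m)⁻¹ =
          commEval ι z * (commEval ι m * commEval ι (z * m) * (commEval ι m)⁻¹)⁻¹ := by
        have h5 := inv_mul_commEval_mul ι z m
        have h6 : commEval ι (z * m) =
            (commEval ι z)⁻¹ * ((commEval ι m)⁻¹ * commEval ι z * commEval ι m) := by
          rw [h5]; group
        rw [h6]
        group
      rw [h4]
      exact mul_mem (hgen z hz) (inv_mem h3)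
  rw [Subgroup.mem_normalizer_iff]
  refine fun g => ⟨hconj _ (fun z hz => h2 N z hz (by omega)) g, fun hg => ?_⟩
  have := hconj _ h1 _ hg
  simpa [mul_assoc] using this

variable {𝓗 : Set (FreeMagma X)} [LinearOrder X] [LinearOrder 𝓗]

/-- The collection process. Let `Y` be a set of letters, and `F` an initial segment of the set of
Hall words in `Y` of weight less than `N`. Then a product of commutators from an alphabet `Z` whose
members of weight less than `N` are in `F`, with right factors above `F`, is an ordered product of
powers of Hall commutators from `F`, modulo commutators of weight at least `N`. -/
theorem exists_collect_of_mem_closure (h𝓗 : IsHallSet 𝓗) (ι : X → G) {N : ℕ} {M : Subgroup G}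
    [M.Normal] (hM : ∀ t : FreeMagma X, N ≤ (content t).card → commEval ι t ∈ M) (Y : Set X)
    (F : Finset 𝓗) (Z : Set (FreeMagma X)) (hFY : ∀ h ∈ F, ∀ x ∈ content h.1, x ∈ Y)
    (hF : ∀ h ∈ F, ∀ h' < h, (∀ x ∈ content h'.1, x ∈ Y) → (content h'.1).card < N → h' ∈ F)
    (hZY : ∀ z ∈ Z, ∀ x ∈ content z, x ∈ Y)
    (hZ : ∀ z ∈ Z, (content z).card < N → ∃ hz : z ∈ 𝓗, (⟨z, hz⟩ : 𝓗) ∈ F ∧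
      ∀ c d, z = c * d → ∃ hd : d ∈ 𝓗, ∀ h ∈ F, h < ⟨d, hd⟩)
    {g : G} (hg : g ∈ Subgroup.closure (commEval ι '' Z)) :
    ∃ l : List (𝓗 × ℤ), (∀ y ∈ l, y.1 ∈ F) ∧ (l.map Prod.fst).Nodup ∧
      g⁻¹ * (l.map fun y => commEval ι y.1.1 ^ y.2).prod ∈ M := by
  classical
  induction hn : F.card generalizing F Z g with
  | zero =>
    refine ⟨[], by simp, by simp, ?_⟩
    rw [List.map_nil, List.prod_nil, mul_one, inv_mem_iff]
    refine (Subgroup.closure_le _).2 ?_ hg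
    rintro _ ⟨z, hz, rfl⟩
    refine hM z (not_lt.1 fun hlt => ?_)
    obtain ⟨_, h, -⟩ := hZ z hz hlt
    simp [Finset.card_eq_zero.1 hn] at h
  | succ n ih =>
    have hne : F.Nonempty := Finset.card_pos.1 (by omega)
    set m := F.max' hne with hm
    have hmF : m ∈ F := F.max'_mem hne
    have hmax : ∀ h ∈ F, h ≤ m := fun h hh => F.le_max' h hh
    set Z' : Set (FreeMagma X) := {t | ∃ z ∈ Z, z ≠ m.1 ∧ ∃ i, t = rightPow m.1 i z} with hZ'
    set K : Subgroup G := Subgroup.closure (commEval ι '' Z') ⊔ M with hK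
    have hZ'm : ∀ z ∈ Z', z * m.1 ∈ Z' := by
      rintro _ ⟨z, hz, hzm, i, rfl⟩
      exact ⟨z, hz, hzm, i + 1, rfl⟩
    have hnorm : ∀ b : ℤ, ∀ g ∈ K, commEval ι m.1 ^ b * g * (commEval ι m.1 ^ b)⁻¹ ∈ K :=
      fun b g => ((Subgroup.mem_normalizer_iff).1
        (zpow_mem (mem_normalizer_of_elim ι hM hZ'm) b) g).1
    -- one step of the collection: powers of the greatest word `m` are moved to the left, which turns
    -- the alphabet `Z` into `Z'`
    have hsplit : ∃ a : ℤ, ∃ x ∈ K, g = commEval ι m.1 ^ a * x := by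
      induction hg using Subgroup.closure_induction with
      | mem y hy =>
        obtain ⟨z, hz, rfl⟩ := hy
        by_cases hzm : z = m.1
        · exact ⟨1, 1, one_mem _, by simp [hzm]⟩
        · exact ⟨0, _, Subgroup.mem_sup_left (Subgroup.subset_closure
            ⟨z, ⟨z, hz, hzm, 0, rfl⟩, rfl⟩), by simp⟩
      | one => exact ⟨0, 1, one_mem _, by simp⟩
      | mul y z _ _ hy hz =>
        obtain ⟨a, x, hx, rfl⟩ := hy
        obtain ⟨b, x', hx', rfl⟩ := hz
        refine ⟨a + b, _, mul_mem (hnorm (-b) x hx) hx', ?_⟩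
        group
      | inv y _ hy =>
        obtain ⟨a, x, hx, rfl⟩ := hy
        refine ⟨-a, _, hnorm a x⁻¹ (inv_mem hx), ?_⟩
        group
    obtain ⟨a, x, hx, rfl⟩ := hsplit
    obtain ⟨y, hy, z, hz, rfl⟩ := Subgroup.mem_sup_of_normal_right.1 hx
    -- the words of the new alphabet which matter are Hall words
    have hword : ∀ z ∈ Z, z ≠ m.1 → ∀ i, (content (rightPow m.1 i z)).card < N →
        ∃ hz : rightPow m.1 i z ∈ 𝓗, (⟨_, hz⟩ : 𝓗) ∈ F.erase m ∧
          ∀ c d, rightPow m.1 i z = c * d → ∃ hd : d ∈ 𝓗, m ≤ ⟨d, hd⟩ := by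
      intro z hz hzm i
      induction i with
      | zero =>
        intro hlt
        obtain ⟨hz𝓗, hzF, hd⟩ := hZ z hz hlt
        refine ⟨hz𝓗, Finset.mem_erase.2 ⟨fun h => hzm (congrArg Subtype.val h), hzF⟩, ?_⟩
        intro c d hcd
        obtain ⟨hd, h⟩ := hd c d hcd
        exact ⟨hd, (h m hmF).le⟩
      | succ i ih =>
        intro hlt
        have hlt' := hlt
        rw [rightPow, content_mul, Multiset.card_add] at hlt'
        obtain ⟨hi, hiF, hd⟩ := ih (by omega)
        obtain ⟨hne, hiF⟩ := Finset.mem_erase.1 hiF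
        have hmem : rightPow m.1 i z * m.1 ∈ 𝓗 := by
          refine (h𝓗.mul_mem_iff _ _).2 ⟨hi, m.2, lt_of_le_of_ne (hmax _ hiF) hne, ?_⟩
          generalize rightPow m.1 i z = t at hd
          cases t with
          | of x => exact .inl ⟨x, rfl⟩
          | mul c d =>
            obtain ⟨hd', h⟩ := hd c d rfl
            exact .inr ⟨c, d, hd', rfl, h⟩
        have hlt'' : (⟨_, hmem⟩ : 𝓗) < m := h𝓗.mul_lt (a := ⟨_, hi⟩) rfl
        refine ⟨hmem, Finset.mem_erase.2 ⟨hlt''.ne, hF m hmF _ hlt'' ?_ hlt⟩, ?_⟩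
        · intro x hx
          change x ∈ content (rightPow m.1 i z * m.1) at hx
          rw [content_mul, Multiset.mem_add] at hx
          exact hx.elim (hFY _ hiF x) (hFY _ hmF x)
        · intro c d hcd
          obtain ⟨-, rfl⟩ := mul_inj' hcd
          exact ⟨m.2, le_rfl⟩
    obtain ⟨l, hl, hnd, hlM⟩ := ih (F.erase m) Z' (fun h hh => hFY h (Finset.mem_of_mem_erase hh))
      (fun h hh h' hlt hY hN => Finset.mem_erase.2
        ⟨(hlt.trans_le (hmax h (Finset.mem_of_mem_erase hh))).ne,
          hF h (Finset.mem_of_mem_erase hh) h' hlt hY hN⟩)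
      (by
        rintro _ ⟨z, hz, -, i, rfl⟩
        induction i with
        | zero => exact hZY z hz
        | succ i ih =>
          intro x hx
          rw [rightPow, content_mul, Multiset.mem_add] at hx
          exact hx.elim (ih x) (hFY m hmF x))
      (by
        rintro _ ⟨z, hz, hzm, i, rfl⟩ hlt
        obtain ⟨h1, h2, h3⟩ := hword z hz hzm i hlt
        refine ⟨h1, h2, fun c d hcd => ?_⟩
        obtain ⟨hd, hmd⟩ := h3 c d hcd
        refine ⟨hd, fun h hh => lt_of_lt_of_le ?_ hmd⟩
        obtain ⟨h4, h5⟩ := Finset.mem_erase.1 hh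
        exact lt_of_le_of_ne (hmax h h5) h4)
      hy (by rw [Finset.card_erase_of_mem hmF, hn]; rfl)
    refine ⟨(m, a) :: l, ?_, ?_, ?_⟩
    · intro y hy
      rcases List.mem_cons.1 hy with rfl | hy
      · exact hmF
      · exact Finset.mem_of_mem_erase (hl y hy)
    · rw [List.map_cons, List.nodup_cons]
      refine ⟨fun h => ?_, hnd⟩
      obtain ⟨y, hy, hym⟩ := List.mem_map.1 h
      exact (Finset.mem_erase.1 (hl y hy)).1 hym
    · rw [List.map_cons, List.prod_cons]
      have h1 := mul_mem (inv_mem hz) hlM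
      convert h1 using 1
      group

/-- Every element of the group generated by the `ι x` is, modulo commutators of weight at least `N`,
a product of powers of different Hall commutators. -/
theorem exists_collect (h𝓗 : IsHallSet 𝓗) (ι : X → G) {N : ℕ} {M : Subgroup G}
    [M.Normal] (hM : ∀ t : FreeMagma X, N ≤ (content t).card → commEval ι t ∈ M)
    {g : G} (hg : g ∈ Subgroup.closure (Set.range ι)) :
    ∃ l : List (𝓗 × ℤ), (l.map Prod.fst).Nodup ∧
      g⁻¹ * (l.map fun y => commEval ι y.1.1 ^ y.2).prod ∈ M := by
  classical
  obtain ⟨Y, hY⟩ : ∃ Y : Finset X, g ∈ Subgroup.closure (ι '' Y) := by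
    induction hg using Subgroup.closure_induction with
    | mem y hy =>
      obtain ⟨x, rfl⟩ := hy
      exact ⟨{x}, Subgroup.subset_closure ⟨x, by simp, rfl⟩⟩
    | one => exact ⟨∅, one_mem _⟩
    | mul y z _ _ hy hz =>
      obtain ⟨Y, hY⟩ := hy
      obtain ⟨Y', hY'⟩ := hz
      exact ⟨Y ∪ Y', mul_mem (Subgroup.closure_mono (Set.image_mono (by simp)) hY)
        (Subgroup.closure_mono (Set.image_mono (by simp)) hY')⟩
    | inv y _ hy =>
      obtain ⟨Y, hY⟩ := hy
      exact ⟨Y, inv_mem hY⟩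
  have hfin : {h : 𝓗 | (∀ x ∈ content h.1, x ∈ Y) ∧ (content h.1).card < N}.Finite := by
    refine ((finite_content_le (N • Y.val)).preimage Subtype.val_injective.injOn).subset ?_
    rintro h ⟨h1, h2⟩
    change content h.1 ≤ N • Y.val
    rw [Multiset.le_iff_count]
    intro x
    by_cases hx : x ∈ content h.1
    · have h3 : Multiset.count x Y.val = 1 := Multiset.count_eq_one_of_mem Y.nodup (h1 x hx)
      rw [Multiset.count_nsmul, h3]
      have := Multiset.count_le_card x (content h.1)
      omega
    · simp [Multiset.count_eq_zero_of_notMem hx]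
  obtain ⟨l, -, h1, h2⟩ := exists_collect_of_mem_closure h𝓗 ι hM (Y : Set X) hfin.toFinset
    (FreeMagma.of '' (Y : Set X)) (fun h hh => (hfin.mem_toFinset.1 hh).1)
    (fun h _ h' _ h1 h2 => hfin.mem_toFinset.2 ⟨h1, h2⟩)
    (by
      rintro _ ⟨y, hy, rfl⟩ x hx
      rw [content_of, Multiset.mem_singleton] at hx
      rwa [hx])
    (by
      rintro _ ⟨y, hy, rfl⟩ hlt
      refine ⟨h𝓗.of_mem y, hfin.mem_toFinset.2 ⟨fun x hx => ?_, hlt⟩,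
        fun c d hcd => (of_ne_mul _ _ _ hcd).elim⟩
      rw [content_of, Multiset.mem_singleton] at hx
      rwa [hx])
    (g := g) (by
      rw [Set.image_image]
      exact hY)
  exact ⟨l, h1, h2⟩

end Collection

/-! ### The Magnus filtration and leading terms -/

namespace WordSeries

section DeepUnits

variable {X : Type u} {k : Type v} [CommRing k]

/-- The units which are congruent to `1` up to order `n`. -/
def deepUnits (X : Type u) (k : Type v) [CommRing k] (n : ℕ) : Subgroup (WordSeries X k)ˣ where
  carrier := {u | (u : WordSeries X k) - 1 ∈ ordGE X k n}
  mul_mem' {u v} hu hv := by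
    have h : ((u * v : (WordSeries X k)ˣ) : WordSeries X k) - 1 =
        u * ((v : WordSeries X k) - 1) + ((u : WordSeries X k) - 1) := by
      rw [Units.val_mul]; noncomm_ring
    change ((u * v : (WordSeries X k)ˣ) : WordSeries X k) - 1 ∈ ordGE X k n
    rw [h]
    exact add_mem (mul_left_mem_ordGE hv) hu
  one_mem' := by
    change ((1 : (WordSeries X k)ˣ) : WordSeries X k) - 1 ∈ ordGE X k n
    rw [Units.val_one, sub_self]
    exact zero_mem _
  inv_mem' {u} hu := by
    have h : ((u⁻¹ : (WordSeries X k)ˣ) : WordSeries X k) - 1 =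
        -((u⁻¹ : (WordSeries X k)ˣ) * ((u : WordSeries X k) - 1)) := by
      rw [mul_sub, Units.inv_mul]; noncomm_ring
    change ((u⁻¹ : (WordSeries X k)ˣ) : WordSeries X k) - 1 ∈ ordGE X k n
    rw [h]
    exact neg_mem (mul_left_mem_ordGE hu)

theorem mem_deepUnits {n : ℕ} {u : (WordSeries X k)ˣ} :
    u ∈ deepUnits X k n ↔ (u : WordSeries X k) - 1 ∈ ordGE X k n := Iff.rfl

theorem deepUnits_anti {m n : ℕ} (h : m ≤ n) : deepUnits X k n ≤ deepUnits X k m :=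
  fun _ hu => ordGE_anti h hu

theorem isClosed_deepUnits [TopologicalSpace k] [T2Space k] [IsTopologicalRing k] (n : ℕ) :
    IsClosed (deepUnits X k n : Set (WordSeries X k)ˣ) := by
  have : (deepUnits X k n : Set (WordSeries X k)ˣ) = ⋂ w : List X, ⋂ _ : w.length < n,
      {u : (WordSeries X k)ˣ | (u : WordSeries X k) w = (1 : WordSeries X k) w} := by
    ext u
    simp [mem_deepUnits, mem_ordGE, sub_eq_zero]
  rw [this]
  exact isClosed_iInter fun w => isClosed_iInter fun _ =>
    isClosed_eq ((continuous_coeff w).comp Units.continuous_val) continuous_const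

/-- The commutator of two units `1 + g + ...` and `1 + h + ...` is `1 + [g, h] + ...`. -/
theorem comm_sub_one_sub_lie_mem {m n : ℕ} (hm : 1 ≤ m) (hn : 1 ≤ n) {u v : (WordSeries X k)ˣ}
    {g h : WordSeries X k} (hu : u ∈ deepUnits X k m) (hv : v ∈ deepUnits X k n)
    (hg : (u : WordSeries X k) - 1 - g ∈ ordGE X k (m + 1))
    (hh : (v : WordSeries X k) - 1 - h ∈ ordGE X k (n + 1)) :
    ((comm u v : (WordSeries X k)ˣ) : WordSeries X k) - 1 - ⁅g, h⁆ ∈ ordGE X k (m + n + 1) := by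
  have huv : u⁻¹ * v⁻¹ ∈ deepUnits X k 1 :=
    mul_mem (inv_mem (deepUnits_anti hm hu)) (inv_mem (deepUnits_anti hn hv))
  set a : WordSeries X k := u - 1 with ha
  set b : WordSeries X k := v - 1 with hb
  have hg' : g ∈ ordGE X k m := by
    have := sub_mem (mem_deepUnits.1 hu) (ordGE_anti (Nat.le_succ m) hg)
    rwa [← ha, sub_sub_cancel] at this
  have hh' : h ∈ ordGE X k n := by
    have := sub_mem (mem_deepUnits.1 hv) (ordGE_anti (Nat.le_succ n) hh)
    rwa [← hb, sub_sub_cancel] at this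
  have hab : a * b - b * a ∈ ordGE X k (m + n) :=
    sub_mem (mul_mem_ordGE hu hv) (by rw [add_comm]; exact mul_mem_ordGE hv hu)
  have h1 : ((comm u v : (WordSeries X k)ˣ) : WordSeries X k) - 1 =
      ((u⁻¹ * v⁻¹ : (WordSeries X k)ˣ) : WordSeries X k) * (a * b - b * a) := by
    have h2 : a * b - b * a = u * v - v * u := by rw [ha, hb]; noncomm_ring
    have h3 : (comm u v : (WordSeries X k)ˣ) = (u⁻¹ * v⁻¹) * (u * v) := by
      simp [comm, mul_assoc]
    have h4 : (1 : (WordSeries X k)ˣ) = (u⁻¹ * v⁻¹) * (v * u) := by group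
    have h5 := congrArg (Units.val) h4
    rw [h2, h3, mul_sub, Units.val_mul _ (u * v), Units.val_mul u v]
    rw [Units.val_one, Units.val_mul _ (v * u), Units.val_mul v u] at h5
    rw [← h5]
  have h6 : ((comm u v : (WordSeries X k)ˣ) : WordSeries X k) - 1 - ⁅g, h⁆ =
      (((u⁻¹ * v⁻¹ : (WordSeries X k)ˣ) : WordSeries X k) - 1) * (a * b - b * a) +
        (((a - g) * b + g * (b - h)) - ((b - h) * a + h * (a - g))) := by
    rw [h1, Ring.lie_def]
    noncomm_ring
  rw [h6]
  refine add_mem ?_ (sub_mem (add_mem ?_ ?_) (add_mem ?_ ?_))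
  · have := mul_mem_ordGE huv hab
    rwa [add_comm] at this
  · have := mul_mem_ordGE hg hv
    rwa [add_right_comm] at this
  · have := mul_mem_ordGE hg' hh
    rwa [← add_assoc] at this
  · have := mul_mem_ordGE hh hu
    rwa [add_right_comm, add_comm n] at this
  · have := mul_mem_ordGE hh' hg
    rwa [← add_assoc, add_comm n] at this

theorem comm_mem_deepUnits {m n : ℕ} (hm : 1 ≤ m) (hn : 1 ≤ n) {u v : (WordSeries X k)ˣ}
    (hu : u ∈ deepUnits X k m) (hv : v ∈ deepUnits X k n) : comm u v ∈ deepUnits X k (m + n) := by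
  have h := comm_sub_one_sub_lie_mem hm hn hu hv (g := (u : WordSeries X k) - 1)
    (h := (v : WordSeries X k) - 1) (by simp [zero_mem]) (by simp [zero_mem])
  have h2 : ⁅(u : WordSeries X k) - 1, (v : WordSeries X k) - 1⁆ ∈ ordGE X k (m + n) := by
    rw [Ring.lie_def]
    exact sub_mem (mul_mem_ordGE hu hv) (by rw [add_comm]; exact mul_mem_ordGE hv hu)
  have := add_mem (ordGE_anti (Nat.le_succ _) h) h2
  simpa [mem_deepUnits] using this

end DeepUnits

section LeadingTerms

variable {X : Type u} {k : Type} [CommRing k]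

theorem lieEval_var_mem_ordGE (t : FreeMagma X) :
    lieEval (var k) t ∈ ordGE X k (content t).card := (isSupported_lieEval t).mem_ordGE

/-- The leading term of a group commutator in the `1 + x` is the corresponding Lie commutator. -/
theorem commEval_oneAddVar_sub_mem (t : FreeMagma X) :
    ((commEval (oneAddVar k) t : (WordSeries X k)ˣ) : WordSeries X k) - 1 - lieEval (var k) t ∈
      ordGE X k ((content t).card + 1) := by
  induction t using magma_induction with
  | of x =>
    have : ((commEval (oneAddVar k) (FreeMagma.of x) : (WordSeries X k)ˣ) : WordSeries X k) - 1 -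
        lieEval (var k) (FreeMagma.of x) = 0 := by
      change 1 + var k x - 1 - var k x = 0
      abel
    rw [this]
    exact zero_mem _
  | mul a b ha hb =>
    rw [content_mul, Multiset.card_add]
    have hmem (t : FreeMagma X)
        (h : ((commEval (oneAddVar k) t : (WordSeries X k)ˣ) : WordSeries X k) - 1 -
          lieEval (var k) t ∈ ordGE X k ((content t).card + 1)) :
        commEval (oneAddVar k) t ∈ deepUnits X k (content t).card := by
      have := add_mem (ordGE_anti (Nat.le_succ _) h) (lieEval_var_mem_ordGE t)
      simpa [mem_deepUnits] using this
    exact comm_sub_one_sub_lie_mem (content_card_pos a) (content_card_pos b) (hmem a ha) (hmem b hb)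
      ha hb

theorem pow_sub_pow_mem_ordGE {n : ℕ} {a g : WordSeries X k} (ha : a ∈ ordGE X k n)
    (hag : a - g ∈ ordGE X k (n + 1)) (N : ℕ) :
    a ^ N ∈ ordGE X k (n * N) ∧ a ^ N - g ^ N ∈ ordGE X k (n * N + 1) := by
  have hg : g ∈ ordGE X k n := by
    have := sub_mem ha (ordGE_anti (Nat.le_succ n) hag)
    simpa using this
  induction N with
  | zero => exact ⟨mem_ordGE_zero _, by simp [zero_mem]⟩
  | succ N ih =>
    have h1 : a ^ (N + 1) - g ^ (N + 1) = a ^ N * (a - g) + (a ^ N - g ^ N) * g := by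
      rw [pow_succ, pow_succ]; noncomm_ring
    refine ⟨?_, ?_⟩
    · rw [pow_succ, Nat.mul_succ]
      exact mul_mem_ordGE ih.1 ha
    · rw [h1]
      refine add_mem ?_ ?_
      · have := mul_mem_ordGE ih.1 hag
        rwa [Nat.mul_succ]
      · have := mul_mem_ordGE ih.2 hg
        rwa [Nat.mul_succ, add_right_comm]

variable {p : ℕ} [Fact p.Prime] [CharP k p]

theorem pow_char_pow_mem_deepUnits {n : ℕ} {u : (WordSeries X k)ˣ} (hu : u ∈ deepUnits X k n)
    (j : ℕ) : u ^ p ^ j ∈ deepUnits X k (n * p ^ j) := by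
  have h := (pow_sub_pow_mem_ordGE hu (g := (u : WordSeries X k) - 1)
    (by rw [sub_self]; exact zero_mem _) (p ^ j)).1
  rwa [sub_pow_char_pow_of_commute _ _ (Commute.one_right _), one_pow] at h

/-- The leading term of a `p`-power power of a group commutator in the `1 + x`. -/
theorem commEval_pow_sub_mem (t : FreeMagma X) (j : ℕ) :
    ((commEval (oneAddVar k) t ^ p ^ j : (WordSeries X k)ˣ) : WordSeries X k) - 1 -
      lieEval (var k) t ^ p ^ j ∈ ordGE X k ((content t).card * p ^ j + 1) := by
  have h1 := commEval_oneAddVar_sub_mem (k := k) t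
  have h2 := add_mem (ordGE_anti (Nat.le_succ _) h1) (lieEval_var_mem_ordGE t)
  rw [sub_add_cancel] at h2
  have h := (pow_sub_pow_mem_ordGE h2 h1 (p ^ j)).2
  rwa [sub_pow_char_pow_of_commute _ _ (Commute.one_right _), one_pow] at h

end LeadingTerms

section Lead

variable {X : Type u} {k : Type v} [CommRing k]

/-- The homogeneous component of degree `n` of `u - 1`, as a function on the words of length `n`. -/
def lead (n : ℕ) (u : (WordSeries X k)ˣ) : {w : List X // w.length = n} → k :=
  fun w => ((u : WordSeries X k) - 1) w.1

theorem lead_mul {n : ℕ} (hn : 1 ≤ n) {u v : (WordSeries X k)ˣ} (hu : u ∈ deepUnits X k n)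
    (hv : v ∈ deepUnits X k n) : lead n (u * v) = lead n u + lead n v := by
  ext w
  have h : ((u * v : (WordSeries X k)ˣ) : WordSeries X k) - 1 =
      ((u : WordSeries X k) - 1) + (v - 1) + (u - 1) * (v - 1) := by
    rw [Units.val_mul]; noncomm_ring
  have h1 := mul_mem_ordGE hu hv w.1 (by rw [w.2]; omega)
  rw [lead, h, add_apply, h1, add_zero]
  rfl

@[simp] theorem lead_one (n : ℕ) : lead n (1 : (WordSeries X k)ˣ) = 0 := by
  ext w
  simp [lead]

/-- The leading component as a homomorphism. -/
def leadHom (X : Type u) (k : Type v) [CommRing k] {n : ℕ} (hn : 1 ≤ n) :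
    deepUnits X k n →* Multiplicative ({w : List X // w.length = n} → k) where
  toFun u := Multiplicative.ofAdd (lead n u.1)
  map_one' := by simp
  map_mul' u v := by
    rw [← ofAdd_add, ← lead_mul hn u.2 v.2]
    rfl

theorem lead_zpow {n : ℕ} (hn : 1 ≤ n) {u : (WordSeries X k)ˣ} (hu : u ∈ deepUnits X k n) (b : ℤ) :
    lead n (u ^ b) = b • lead n u :=
  congrArg Multiplicative.toAdd (map_zpow (leadHom X k hn) ⟨u, hu⟩ b)

theorem lead_list_prod {n : ℕ} (hn : 1 ≤ n) (l : List (WordSeries X k)ˣ)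
    (hl : ∀ u ∈ l, u ∈ deepUnits X k n) : lead n l.prod = (l.map (lead n)).sum := by
  induction l with
  | nil => simp
  | cons u l ih =>
    have h1 : ∀ v ∈ l, v ∈ deepUnits X k n := fun v hv => hl v (List.mem_cons_of_mem _ hv)
    rw [List.prod_cons, lead_mul hn (hl u List.mem_cons_self) (list_prod_mem h1), ih h1]
    rfl

theorem lead_eq_zero_iff {n : ℕ} {u : (WordSeries X k)ˣ} (hu : u ∈ deepUnits X k n) :
    lead n u = 0 ↔ u ∈ deepUnits X k (n + 1) := by
  constructor
  · intro h w hw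
    rcases Nat.lt_succ_iff_lt_or_eq.1 hw with h1 | h1
    · exact hu w h1
    · exact congrFun h ⟨w, h1⟩
  · intro h
    ext w
    exact h w.1 (by rw [w.2]; omega)

theorem continuous_lead [TopologicalSpace k] [IsTopologicalRing k] (n : ℕ) :
    Continuous (lead n : (WordSeries X k)ˣ → _) := by
  refine continuous_pi fun w => ?_
  exact ((continuous_coeff w.1).comp Units.continuous_val).sub continuous_const

end Lead

end WordSeries

/-! ### Sums of leading terms -/

section LevelSum

open WordSeries

variable {X : Type u} {𝓗 : Set (FreeMagma X)} {p : ℕ} {n : ℕ}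

/-- The multiset of letters of the monomials of `P(w) ^ p ^ j`. -/
noncomputable def levelContent (i : LevelIndex p 𝓗 n) : Multiset X :=
  p ^ i.1.2 • content (bracketing i.1.1)

/-- The polynomial `P(w) ^ p ^ j`, as a power series. -/
noncomputable def levelTerm (i : LevelIndex p 𝓗 n) : WordSeries X (ZMod p) :=
  hallLie (var (ZMod p)) i.1.1 ^ p ^ i.1.2

theorem card_content_bracketing (i : LevelIndex p 𝓗 n) :
    (content (bracketing i.1.1)).card * p ^ i.1.2 = n := by
  rw [card_content, ← wordLength_eq, i.2]

theorem card_levelContent (i : LevelIndex p 𝓗 n) : (levelContent i).card = n := by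
  rw [levelContent, Multiset.card_nsmul, mul_comm, card_content_bracketing]

theorem isSupported_levelTerm (i : LevelIndex p 𝓗 n) :
    IsSupported (levelContent i) (levelTerm i) := (isSupported_lieEval _).pow _

theorem levelTerm_eq_zero {i : LevelIndex p 𝓗 n} {w : List X} (h : levelContent i ≠ w) :
    levelTerm i w = 0 := by_contra fun h' => h (isSupported_levelTerm i w h').symm

variable [Fact p.Prime]

omit [Fact p.Prime] in
theorem levelIndex_injective : Function.Injective
    fun i : LevelIndex p 𝓗 n => ((i.1.2, i.1.1) : ℕ × hallWords 𝓗) := by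
  rintro ⟨⟨w, j⟩, hi⟩ ⟨⟨w', j'⟩, hi'⟩ h
  simp only [Prod.mk.injEq] at h
  obtain ⟨rfl, rfl⟩ := h
  rfl

theorem levelIndex_exponent_le (i : LevelIndex p 𝓗 n) : i.1.2 ≤ n := by
  have h1 : i.1.2 < p ^ i.1.2 := Nat.lt_pow_self (Fact.out : p.Prime).one_lt
  have h2 := card_content_bracketing i
  have h3 := content_card_pos (bracketing i.1.1)
  nlinarith

theorem finite_levelContent_eq (C : Multiset X) :
    {i : LevelIndex p 𝓗 n | levelContent i = C}.Finite := by
  have hinj : Function.Injective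
      fun i : LevelIndex p 𝓗 n => (bracketing i.1.1, i.1.2) := by
    intro i i' h
    simp only [Prod.mk.injEq] at h
    refine levelIndex_injective (Prod.ext h.2 (Subtype.ext ?_))
    rw [← foliage_bracketing i.1.1, h.1, foliage_bracketing]
  refine (((finite_content_le C).prod (Set.finite_Iic n)).preimage hinj.injOn).subset ?_
  rintro i rfl
  refine ⟨?_, levelIndex_exponent_le i⟩
  change content _ ≤ levelContent i
  rw [levelContent, ← Nat.sub_add_cancel (Nat.pow_pos (n := i.1.2) (Fact.out : p.Prime).pos),
    succ_nsmul]
  exact Multiset.le_add_left _ _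

theorem finite_levelIndex [Finite X] : Finite (LevelIndex p 𝓗 n) := by
  have h : ({w : List X | w.length ≤ n} ×ˢ Set.Iic n).Finite :=
    (List.finite_length_le X n).prod (Set.finite_Iic n)
  have hinj : Function.Injective fun i : LevelIndex p 𝓗 n =>
      ((FreeMonoid.toList (i.1.1 : FreeMonoid X), i.1.2) : List X × ℕ) := by
    intro i i' h
    simp only [Prod.mk.injEq] at h
    exact levelIndex_injective (Prod.ext h.2 (Subtype.ext (FreeMonoid.toList.injective h.1)))
  have h2 := h.preimage (f := fun i : LevelIndex p 𝓗 n =>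
      ((FreeMonoid.toList (i.1.1 : FreeMonoid X), i.1.2) : List X × ℕ)) hinj.injOn
  refine Set.finite_univ_iff.1 (h2.subset fun i _ => ⟨?_, levelIndex_exponent_le i⟩)
  have h3 := card_content_bracketing i
  rw [card_content, foliage_bracketing] at h3
  change FreeMonoid.length (i.1.1 : FreeMonoid X) ≤ n
  have := Nat.pow_pos (n := i.1.2) (Fact.out : p.Prime).pos
  nlinarith

/-- The sum `∑ c_i P(w) ^ p ^ j` over the (possibly infinite) index set of level `n`, as a function
on words of length `n`; only the finitely many indices with the letters of a given word contribute
to its coefficient. -/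
noncomputable def levelSum (𝓗 : Set (FreeMagma X)) (p : ℕ) [Fact p.Prime] (n : ℕ) :
    (LevelIndex p 𝓗 n → ZMod p) →+ ({w : List X // w.length = n} → ZMod p) where
  toFun c w := ∑ i ∈ (finite_levelContent_eq (w.1 : Multiset X)).toFinset, c i * levelTerm i w.1
  map_zero' := by ext w; simp
  map_add' c c' := by ext w; simp [add_mul, Finset.sum_add_distrib]

theorem levelSum_apply (c : LevelIndex p 𝓗 n → ZMod p)
    (w : {w : List X // w.length = n}) : levelSum 𝓗 p n c w =
      ∑ i ∈ (finite_levelContent_eq (w.1 : Multiset X)).toFinset, c i * levelTerm i w.1 := rfl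

open Classical in
theorem levelSum_single (i : LevelIndex p 𝓗 n) (b : ZMod p) :
    levelSum 𝓗 p n (Pi.single i b) = fun w => b * levelTerm i w.1 := by
  ext w
  rw [levelSum_apply]
  by_cases h : levelContent i = w.1
  · rw [Finset.sum_eq_single i]
    · simp
    · intro j _ hj
      simp [Pi.single_eq_of_ne hj]
    · intro h'
      exact (h' ((Set.Finite.mem_toFinset _).2 h)).elim
  · rw [levelTerm_eq_zero h, mul_zero]
    refine Finset.sum_eq_zero fun j hj => ?_
    have hj' : j ≠ i := by
      rintro rfl
      have hj' := (Set.Finite.mem_toFinset _).1 hj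
      exact h hj'
    simp [Pi.single_eq_of_ne hj']

theorem continuous_levelSum : Continuous (levelSum 𝓗 p n) := by
  refine continuous_pi fun w => ?_
  simp only [levelSum_apply]
  fun_prop

variable [LinearOrder X] [LinearOrder 𝓗]

theorem injective_levelSum (h𝓗 : IsHallSet 𝓗) :
    Function.Injective (levelSum 𝓗 p n) := by
  rw [injective_iff_map_eq_zero]
  intro c hc
  ext i
  have hT := finite_levelContent_eq (p := p) (𝓗 := 𝓗) (n := n) (levelContent i)
  have hsum : ∑ j ∈ hT.toFinset, c j • levelTerm j = 0 := by
    ext w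
    have happ : (∑ j ∈ hT.toFinset, c j • levelTerm j) w =
        ∑ j ∈ hT.toFinset, c j * levelTerm j w := Finset.sum_apply w _ _
    rw [happ, WordSeries.zero_apply]
    by_cases h : levelContent i = w
    · have hw : w.length = n := by
        have := card_levelContent i
        rwa [h, Multiset.coe_card] at this
      have h1 := congrFun hc ⟨w, hw⟩
      rw [levelSum_apply] at h1
      simp only [← h] at h1
      exact h1
    · refine Finset.sum_eq_zero fun j hj => ?_
      rw [levelTerm_eq_zero, mul_zero]
      rw [(Set.Finite.mem_toFinset _).1 hj]
      exact h
  have hli := (linearIndependent_hallLie_pow h𝓗 p (isFreeFamily_var (X := X) (k := ZMod p))).comp _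
    (levelIndex_injective (p := p) (𝓗 := 𝓗) (n := n))
  exact linearIndependent_iff'.1 hli _ c hsum i ((Set.Finite.mem_toFinset _).2 rfl)

end LevelSum

/-! ### Leading terms of ordered products of Hall commutators -/

section OrderedProducts

open WordSeries

variable {X : Type u} {p : ℕ} [Fact p.Prime]

/-- The leading term of a power `τ ^ a` of a commutator of weight `d`, when `p ^ j` divides `a`:
it is a multiple of the `p ^ j`-th power of the Lie commutator, in degree `d p ^ j`. -/
theorem commEval_zpow_lead (t : FreeMagma X) {m j : ℕ} (hm : 1 ≤ m) (b : ℤ)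
    (hmj : m ≤ (content t).card * p ^ j) :
    commEval (oneAddVar (ZMod p)) t ^ ((p : ℤ) ^ j * b) ∈ deepUnits X (ZMod p) m ∧
      lead m (commEval (oneAddVar (ZMod p)) t ^ ((p : ℤ) ^ j * b)) = fun w =>
        (if (content t).card * p ^ j = m then (b : ZMod p) else 0) *
          (lieEval (var (ZMod p)) t ^ p ^ j) w.1 := by
  set v := commEval (oneAddVar (ZMod p)) t ^ p ^ j with hv
  have hpow : commEval (oneAddVar (ZMod p)) t ^ ((p : ℤ) ^ j * b) = v ^ b := by
    rw [zpow_mul, hv, ← zpow_natCast]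
    norm_cast
  have h1 := commEval_pow_sub_mem (k := ZMod p) (p := p) t j
  have h2 : lieEval (var (ZMod p)) t ^ p ^ j ∈ ordGE X (ZMod p) ((content t).card * p ^ j) := by
    have := ((isSupported_lieEval (k := ZMod p) t).pow (p ^ j)).mem_ordGE
    rwa [Multiset.card_nsmul, mul_comm] at this
  have h3 : v ∈ deepUnits X (ZMod p) ((content t).card * p ^ j) := by
    have := add_mem (ordGE_anti (Nat.le_succ _) h1) h2
    rwa [sub_add_cancel] at this
  have h4 : v ∈ deepUnits X (ZMod p) m := deepUnits_anti hmj h3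
  rw [hpow]
  refine ⟨zpow_mem h4 b, ?_⟩
  rw [lead_zpow hm h4]
  ext w
  split_ifs with h
  · have h5 := h1 w.1 (by rw [w.2, ← h]; omega)
    rw [WordSeries.sub_apply, sub_eq_zero] at h5
    simp only [Pi.smul_apply, lead]
    rw [h5, zsmul_eq_mul]
  · have h5 := h3 w.1 (by rw [w.2]; omega)
    simp only [Pi.smul_apply, lead]
    rw [h5, smul_zero, zero_mul]

variable {𝓗 : Set (FreeMagma X)} [LinearOrder X] [LinearOrder 𝓗]

/-- If an ordered product of powers of Hall commutators is trivial in degree `m`, then so is each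
of its factors, as the polynomials `P(w) ^ p ^ j` are linearly independent. -/
theorem exists_dvd_of_prod_mem (h𝓗 : IsHallSet 𝓗) {m : ℕ} (hm : 1 ≤ m) {l : List (𝓗 × ℤ)}
    (hl : (l.map Prod.fst).Nodup)
    (hdvd : ∀ y ∈ l, ∃ j : ℕ, ∃ b : ℤ, y.2 = (p : ℤ) ^ j * b ∧ m ≤ (content y.1.1).card * p ^ j)
    (hprod : (l.map fun y => commEval (oneAddVar (ZMod p)) y.1.1 ^ y.2).prod ∈
      deepUnits X (ZMod p) (m + 1)) :
    ∀ y ∈ l, ∃ j : ℕ, ∃ b : ℤ, y.2 = (p : ℤ) ^ j * b ∧ m + 1 ≤ (content y.1.1).card * p ^ j := by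
  classical
  choose! j b hb hmj using hdvd
  have hl' : l.Nodup := List.Nodup.of_map _ hl
  set c : 𝓗 × ℤ → ZMod p := fun y => if (content y.1.1).card * p ^ j y = m then (b y : ZMod p) else 0
    with hc
  have hlead : ∀ y ∈ l, commEval (oneAddVar (ZMod p)) y.1.1 ^ y.2 ∈ deepUnits X (ZMod p) m ∧
      lead m (commEval (oneAddVar (ZMod p)) y.1.1 ^ y.2) = fun w =>
        c y * (lieEval (var (ZMod p)) y.1.1 ^ p ^ j y) w.1 := by
    intro y hy
    have := commEval_zpow_lead (p := p) y.1.1 hm (b y) (hmj y hy)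
    rwa [← hb y hy] at this
  have hmem : ∀ u ∈ l.map fun y => commEval (oneAddVar (ZMod p)) y.1.1 ^ y.2,
      u ∈ deepUnits X (ZMod p) m := by
    intro u hu
    obtain ⟨y, hy, rfl⟩ := List.mem_map.1 hu
    exact (hlead y hy).1
  have h0 := (lead_eq_zero_iff (list_prod_mem hmem)).2 hprod
  rw [lead_list_prod hm _ hmem, List.map_map, ← List.sum_toFinset _ hl'] at h0
  have hsum : ∑ y ∈ l.toFinset, c y • lieEval (var (ZMod p)) y.1.1 ^ p ^ j y = 0 := by
    ext w
    have happ : (∑ y ∈ l.toFinset, c y • lieEval (var (ZMod p)) y.1.1 ^ p ^ j y) w =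
        ∑ y ∈ l.toFinset, c y * (lieEval (var (ZMod p)) y.1.1 ^ p ^ j y) w := Finset.sum_apply w _ _
    rw [happ, WordSeries.zero_apply]
    by_cases hw : w.length = m
    · have h1 := congrFun h0 ⟨w, hw⟩
      rw [Finset.sum_apply, Pi.zero_apply] at h1
      rw [← h1]
      refine Finset.sum_congr rfl fun y hy => ?_
      rw [Function.comp_apply, (hlead y (List.mem_toFinset.1 hy)).2]
    · refine Finset.sum_eq_zero fun y hy => ?_
      simp only [hc]
      split_ifs with h
      · have h1 := (isSupported_lieEval (k := ZMod p) y.1.1).pow (p ^ j y) w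
        by_contra h2
        have h3 := congrArg Multiset.card (h1 (right_ne_zero_of_mul h2))
        rw [Multiset.coe_card, Multiset.card_nsmul, mul_comm, h] at h3
        exact hw h3
      · exact zero_mul _
  have hinj : Function.Injective fun y : {y // y ∈ l.toFinset} =>
      ((j y.1, (hallWordsEquiv h𝓗).symm y.1.1) : ℕ × hallWords 𝓗) := by
    rintro ⟨y, hy⟩ ⟨y', hy'⟩ h
    simp only [Prod.mk.injEq, EmbeddingLike.apply_eq_iff_eq] at h
    exact Subtype.ext (List.inj_on_of_nodup_map hl (List.mem_toFinset.1 hy)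
      (List.mem_toFinset.1 hy') h.2)
  have hli := (linearIndependent_hallLie_pow h𝓗 p (isFreeFamily_var (X := X) (k := ZMod p))).comp _
    hinj
  have hfam : ((fun jw : ℕ × hallWords 𝓗 => hallLie (var (ZMod p)) jw.2 ^ p ^ jw.1) ∘
      fun y : {y // y ∈ l.toFinset} =>
        ((j y.1, (hallWordsEquiv h𝓗).symm y.1.1) : ℕ × hallWords 𝓗)) =
      fun y : {y // y ∈ l.toFinset} => lieEval (var (ZMod p)) y.1.1.1 ^ p ^ j y.1 := by
    ext y : 1
    simp [← lieEval_hallWordsEquiv h𝓗]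
  rw [hfam] at hli
  have hzero := linearIndependent_iff'.1 hli Finset.univ (fun y => c y.1) (by
    rw [← hsum, ← Finset.sum_coe_sort l.toFinset])
  intro y hy
  by_cases h : (content y.1.1).card * p ^ j y = m
  · have h1 := hzero ⟨y, List.mem_toFinset.2 hy⟩ (Finset.mem_univ _)
    simp only [hc, if_pos h] at h1
    obtain ⟨d, hd⟩ := (ZMod.intCast_zmod_eq_zero_iff_dvd _ _).1 h1
    refine ⟨j y + 1, d, ?_, ?_⟩
    · rw [hb y hy, hd]; ring
    · have h2 := (Fact.out : p.Prime).two_le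
      rw [pow_succ, ← mul_assoc, h]
      nlinarith
  · exact ⟨j y, b y, hb y hy, Nat.lt_of_le_of_ne (hmj y hy) (Ne.symm h)⟩

end OrderedProducts

/-! ### The Magnus homomorphism of a free profinite group -/

namespace WordSeries

section Restrict

variable {X : Type u} {k : Type v} [CommRing k]

open Classical in
/-- Setting the variables outside `Y` equal to zero. -/
noncomputable def restrict (Y : Set X) (f : WordSeries X k) : WordSeries X k :=
  fun w => if ∀ a ∈ w, a ∈ Y then f w else 0

theorem restrict_of_forall {Y : Set X} (f : WordSeries X k) {w : List X} (h : ∀ a ∈ w, a ∈ Y) :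
    restrict Y f w = f w := if_pos h

theorem restrict_of_not {Y : Set X} (f : WordSeries X k) {w : List X} (h : ¬∀ a ∈ w, a ∈ Y) :
    restrict Y f w = 0 := if_neg h

@[simp] theorem restrict_nil (Y : Set X) (f : WordSeries X k) : restrict Y f [] = f [] :=
  restrict_of_forall f (by simp)

theorem restrict_one (Y : Set X) : restrict Y (1 : WordSeries X k) = 1 := by
  ext w
  cases w with
  | nil => simp
  | cons a w => by_cases h : ∀ b ∈ a :: w, b ∈ Y <;> simp [restrict, h]

theorem tail_restrict_of_mem {Y : Set X} {a : X} (ha : a ∈ Y) (f : WordSeries X k) :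
    tail a (restrict Y f) = restrict Y (tail a f) := by
  ext w
  have : (∀ b ∈ a :: w, b ∈ Y) ↔ ∀ b ∈ w, b ∈ Y := by simp [ha]
  change restrict Y f (a :: w) = restrict Y (tail a f) w
  by_cases h : ∀ b ∈ w, b ∈ Y
  · rw [restrict_of_forall _ (this.2 h), restrict_of_forall _ h]
    rfl
  · rw [restrict_of_not _ (this.not.2 h), restrict_of_not _ h]

theorem tail_restrict_of_notMem {Y : Set X} {a : X} (ha : a ∉ Y) (f : WordSeries X k) :
    tail a (restrict Y f) = 0 := by
  ext w
  simp [tail, restrict, ha]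

theorem restrict_mul (Y : Set X) (f g : WordSeries X k) :
    restrict Y (f * g) = restrict Y f * restrict Y g := by
  ext w
  induction w generalizing f with
  | nil => simp [mul_nil]
  | cons a w ih =>
    rw [mul_cons, restrict_nil]
    by_cases ha : a ∈ Y
    · rw [tail_restrict_of_mem ha, ← ih]
      by_cases hw : ∀ b ∈ w, b ∈ Y
      · have : ∀ b ∈ a :: w, b ∈ Y := by simpa [ha] using hw
        rw [restrict_of_forall _ this, restrict_of_forall _ this, restrict_of_forall _ hw, mul_cons]
      · have : ¬∀ b ∈ a :: w, b ∈ Y := by simpa [ha] using hw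
        rw [restrict_of_not _ this, restrict_of_not _ this, restrict_of_not _ hw]
        simp
    · have : ¬∀ b ∈ a :: w, b ∈ Y := fun h => ha (h a List.mem_cons_self)
      rw [tail_restrict_of_notMem ha, restrict_of_not _ this, restrict_of_not _ this]
      simp

/-- `restrict` as a homomorphism of monoids. -/
noncomputable def restrictHom (Y : Set X) : WordSeries X k →* WordSeries X k where
  toFun := restrict Y
  map_one' := restrict_one Y
  map_mul' := restrict_mul Y

theorem restrict_oneAddVar_of_mem {Y : Set X} {x : X} (hx : x ∈ Y) :
    Units.map (restrictHom Y) (oneAddVar k x) = oneAddVar k x := by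
  ext w
  change restrict Y (1 + var k x) w = (1 + var k x) w
  by_cases hw : ∀ b ∈ w, b ∈ Y
  · rw [restrict_of_forall _ hw]
  · have h1 : w ≠ [x] := by
      rintro rfl
      simp [hx] at hw
    rw [restrict_of_not _ hw]
    cases w <;> simp_all [var]

theorem restrict_oneAddVar_of_notMem {Y : Set X} {x : X} (hx : x ∉ Y) :
    Units.map (restrictHom Y) (oneAddVar k x) = 1 := by
  ext w
  change restrict Y (1 + var k x) w = (1 : WordSeries X k) w
  by_cases hw : ∀ b ∈ w, b ∈ Y
  · have h1 : w ≠ [x] := by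
      rintro rfl
      simp [hx] at hw
    rw [restrict_of_forall _ hw]
    simp [var, h1]
  · rw [restrict_of_not _ hw]
    cases w <;> simp_all

theorem continuous_restrict [TopologicalSpace k] (Y : Set X) :
    Continuous (restrict Y : WordSeries X k → WordSeries X k) := by
  refine continuous_pi fun w => ?_
  by_cases hw : ∀ b ∈ w, b ∈ Y
  · simp only [restrict_of_forall _ hw]
    exact continuous_coeff w
  · simp only [restrict_of_not _ hw]
    exact continuous_const

end Restrict

end WordSeries

section Magnus

open WordSeries

variable {X S : Type u} [Group S] [TopologicalSpace S] [IsTopologicalGroup S] {ι : X → S}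
  {p : ℕ} [Fact p.Prime]

omit [TopologicalSpace S] [IsTopologicalGroup S] in
theorem map_commEval {T : Type u} [Group T] (φ : S →* T) (ι : X → S) (t : FreeMagma X) :
    φ (commEval ι t) = commEval (fun x => φ (ι x)) t := by
  induction t using magma_induction with
  | of x => rfl
  | mul a b ha hb =>
    change φ (comm _ _) = comm _ _
    rw [← ha, ← hb]
    simp [comm]

/-- The Magnus homomorphism `x ↦ 1 + x`. -/
theorem IsFreeProfinite.exists_magnus (hι : IsFreeProfinite ι) (p : ℕ) [Fact p.Prime] :
    ∃ μ : S →ₜ* (WordSeries X (ZMod p))ˣ, ∀ x, μ (ι x) = oneAddVar (ZMod p) x :=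
  (hι.existsUnique_lift _ _ tendsto_oneAddVar).exists

theorem IsFreeProfinite.eq_top_of_isClosed (hι : IsFreeProfinite ι) {K : Subgroup S}
    (hK : IsClosed (K : Set S)) (h : ∀ x, ι x ∈ K) (s : S) : s ∈ K := by
  have h1 : (Subgroup.closure (Set.range ι)).topologicalClosure ≤ K := by
    refine Subgroup.topologicalClosure_minimal _ ?_ hK
    rw [Subgroup.closure_le]
    rintro _ ⟨x, rfl⟩
    exact h x
  rw [hι.generates] at h1
  exact h1 trivial

variable {μ : S →ₜ* (WordSeries X (ZMod p))ˣ}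

omit [IsTopologicalGroup S] in
theorem isClosed_comap_deepUnits (μ : S →ₜ* (WordSeries X (ZMod p))ˣ) (n : ℕ) :
    IsClosed ((deepUnits X (ZMod p) n).comap (μ : S →* (WordSeries X (ZMod p))ˣ) : Set S) :=
  (isClosed_deepUnits n).preimage μ.continuous_toFun

/-- The Magnus homomorphism maps the `i`-th step of the lower central series to series congruent to
`1` up to order `i`. -/
theorem lowerCentral_le_comap (hι : IsFreeProfinite ι) (hμ : ∀ x, μ (ι x) = oneAddVar (ZMod p) x)
    {i : ℕ} (hi : 1 ≤ i) :
    lowerCentral S i ≤ (deepUnits X (ZMod p) i).comap (μ : S →* (WordSeries X (ZMod p))ˣ) := by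
  have hone : ∀ s, s ∈ (deepUnits X (ZMod p) 1).comap (μ : S →* (WordSeries X (ZMod p))ˣ) := by
    refine hι.eq_top_of_isClosed (isClosed_comap_deepUnits μ 1) fun x => ?_
    change μ (ι x) ∈ deepUnits X (ZMod p) 1
    rw [hμ, mem_deepUnits]
    intro w hw
    have : w = [] := List.length_eq_zero_iff.1 (by omega)
    subst this
    simp [oneAddVar]
  induction i, hi using Nat.le_induction with
  | base => exact fun s _ => hone s
  | succ i hi ih =>
    obtain ⟨i, rfl⟩ : ∃ j, i = j + 1 := ⟨i - 1, by omega⟩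
    refine Subgroup.topologicalClosure_minimal _ ?_ (isClosed_comap_deepUnits μ _)
    rw [Subgroup.closure_le]
    rintro _ ⟨σ, -, τ, hτ, rfl⟩
    change μ (comm σ τ) ∈ deepUnits X (ZMod p) (i + 1 + 1)
    have h := comm_mem_deepUnits le_rfl hi (hone σ) (ih hτ)
    rw [add_comm] at h
    simpa [comm] using h

theorem zassenhaus_le_comap (hι : IsFreeProfinite ι) (hμ : ∀ x, μ (ι x) = oneAddVar (ZMod p) x)
    (n : ℕ) :
    zassenhaus S p n ≤ (deepUnits X (ZMod p) n).comap (μ : S →* (WordSeries X (ZMod p))ˣ) := by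
  refine Subgroup.topologicalClosure_minimal _ ?_ (isClosed_comap_deepUnits μ _)
  rw [Subgroup.closure_le]
  rintro _ ⟨i, j, hi, hn, σ, hσ, rfl⟩
  change μ (σ ^ p ^ j) ∈ deepUnits X (ZMod p) n
  rw [map_pow]
  exact deepUnits_anti hn (pow_char_pow_mem_deepUnits (lowerCentral_le_comap hι hμ hi hσ) j)

omit [Fact p.Prime] in
theorem zassenhaus_anti {m n : ℕ} (h : m ≤ n) : zassenhaus S p n ≤ zassenhaus S p m := by
  refine Subgroup.topologicalClosure_mono (Subgroup.closure_mono ?_)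
  rintro _ ⟨i, j, hi, hn, σ, hσ, rfl⟩
  exact ⟨i, j, hi, h.trans hn, σ, hσ, rfl⟩

variable {𝓗 : Set (FreeMagma X)} [LinearOrder X] [LinearOrder 𝓗]

/-- An abstract word in the generators which lies in the `n`-th step of the Magnus filtration lies in
the `n`-th step of the Zassenhaus filtration, and its leading term is a combination of the
`P(w) ^ p ^ j`. The word is collected; the exponents of the Hall commutators are then divisible by
sufficiently high powers of `p`. -/
theorem mem_zassenhaus_of_mem_closure (hι : IsFreeProfinite ι)
    (hμ : ∀ x, μ (ι x) = oneAddVar (ZMod p) x) (h𝓗 : IsHallSet 𝓗) {n : ℕ} (hn : 1 ≤ n) {f : S}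
    (hf : f ∈ Subgroup.closure (Set.range ι)) (hfn : μ f ∈ deepUnits X (ZMod p) n) :
    f ∈ zassenhaus S p n ∧ lead n (μ f) ∈ (levelSum 𝓗 p n).range := by
  classical
  obtain ⟨l, hl, hM⟩ := exists_collect h𝓗 ι (N := n + 1) (M := zassenhaus S p (n + 1))
    (fun t ht => by
      have := commEval_pow_mem_zassenhaus ι t (p := p) (n := n + 1) (j := 0) (by simpa using ht)
      simpa using this) hf
  set T : S := (l.map fun y => commEval ι y.1.1 ^ y.2).prod with hT
  have hcomm (t : FreeMagma X) : μ (commEval ι t) = commEval (oneAddVar (ZMod p)) t := by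
    have := map_commEval (μ : S →* (WordSeries X (ZMod p))ˣ) ι t
    simp only [MonoidHom.coe_coe, hμ] at this
    exact this
  have hμT : μ T = (l.map fun y => commEval (oneAddVar (ZMod p)) y.1.1 ^ y.2).prod := by
    rw [hT, map_list_prod, List.map_map]
    simp [Function.comp_def, hcomm]
  have hMμ : μ (f⁻¹ * T) ∈ deepUnits X (ZMod p) (n + 1) := zassenhaus_le_comap hι hμ _ hM
  have hTn : μ T ∈ deepUnits X (ZMod p) n := by
    have := mul_mem hfn (deepUnits_anti (Nat.le_succ n) hMμ)
    rwa [← map_mul, mul_inv_cancel_left] at this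
  have hdvd : ∀ m, 1 ≤ m → m ≤ n → ∀ y ∈ l, ∃ j : ℕ, ∃ b : ℤ, y.2 = (p : ℤ) ^ j * b ∧
      m ≤ (content y.1.1).card * p ^ j := by
    intro m hm
    induction m, hm using Nat.le_induction with
    | base => exact fun _ y _ => ⟨0, y.2, by simp, by
      rw [pow_zero, mul_one]
      exact content_card_pos y.1.1⟩
    | succ m hm ih =>
      intro hmn
      refine exists_dvd_of_prod_mem h𝓗 hm hl (ih (by omega)) ?_
      rw [← hμT]
      exact deepUnits_anti hmn hTn
  have hTz : T ∈ zassenhaus S p n := by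
    refine list_prod_mem fun u hu => ?_
    obtain ⟨y, hy, rfl⟩ := List.mem_map.1 hu
    obtain ⟨j, b, hb, hle⟩ := hdvd n hn le_rfl y hy
    rw [hb, zpow_mul]
    refine zpow_mem ?_ b
    have := commEval_pow_mem_zassenhaus ι y.1.1 hle
    exact_mod_cast this
  have hfact : ∀ y ∈ l, commEval (oneAddVar (ZMod p)) y.1.1 ^ y.2 ∈ deepUnits X (ZMod p) n ∧
      lead n (commEval (oneAddVar (ZMod p)) y.1.1 ^ y.2) ∈ (levelSum 𝓗 p n).range := by
    intro y hy
    obtain ⟨j, b, hb, hle⟩ := hdvd n hn le_rfl y hy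
    obtain ⟨h1, h2⟩ := commEval_zpow_lead (p := p) y.1.1 hn b hle
    rw [hb]
    refine ⟨h1, ?_⟩
    rw [h2]
    split_ifs with h
    · let i : LevelIndex p 𝓗 n := ⟨((hallWordsEquiv h𝓗).symm y.1, j), by
        have h3 : bracketing ((hallWordsEquiv h𝓗).symm y.1) = y.1.1 :=
          congrArg Subtype.val ((hallWordsEquiv h𝓗).apply_symm_apply y.1)
        rw [wordLength_eq, h3, ← card_content, h]⟩
      refine ⟨Pi.single i (b : ZMod p), ?_⟩
      rw [levelSum_single]
      ext w
      simp [levelTerm, i, ← lieEval_hallWordsEquiv h𝓗]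
    · simp only [zero_mul]
      exact zero_mem _
  have hleadT : lead n (μ T) ∈ (levelSum 𝓗 p n).range := by
    rw [hμT, lead_list_prod hn]
    · refine list_sum_mem fun u hu => ?_
      simp only [List.map_map, List.mem_map, Function.comp_apply] at hu
      obtain ⟨y, hy, rfl⟩ := hu
      exact (hfact y hy).2
    · intro u hu
      obtain ⟨y, hy, rfl⟩ := List.mem_map.1 hu
      exact (hfact y hy).1
  constructor
  · have := mul_mem hTz (inv_mem (zassenhaus_anti (Nat.le_succ n) hM))
    simpa using this
  · have h1 : lead n (μ T) = lead n (μ f) + lead n (μ (f⁻¹ * T)) := by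
      rw [← lead_mul hn hfn (deepUnits_anti (Nat.le_succ n) hMμ), ← map_mul, mul_inv_cancel_left]
    rw [(lead_eq_zero_iff (deepUnits_anti (Nat.le_succ n) hMμ)).2 hMμ, add_zero] at h1
    rwa [← h1]

variable [CompactSpace S] [TotallyDisconnectedSpace S]

omit [LinearOrder X] in
/-- The abstract words in the generators are dense in each step of the Magnus filtration: an element
of it may be replaced by its image under the retraction which takes almost all generators to `1`,
and then only finitely many coefficients of its Magnus series have to vanish. -/
theorem mem_closure_of_mem_deepUnits (hι : IsFreeProfinite ι)
    (hμ : ∀ x, μ (ι x) = oneAddVar (ZMod p) x) {n : ℕ} {σ : S}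
    (hσ : μ σ ∈ deepUnits X (ZMod p) n) :
    σ ∈ closure {f | f ∈ Subgroup.closure (Set.range ι) ∧ μ f ∈ deepUnits X (ZMod p) n} := by
  classical
  rw [mem_closure_iff]
  intro U hU hσU
  obtain ⟨N, hN⟩ := ProfiniteGrp.exist_openNormalSubgroup_sub_open_nhds_of_one
    (U := (σ * ·) ⁻¹' U) (hU.preimage (continuous_const_mul σ)) (by simpa using hσU)
  set Y : Set X := {x | ι x ∉ N} with hY
  have hNopen : IsOpen (N : Set S) := N.isOpen'
  have hNclosed : IsClosed (N : Set S) := N.toOpenSubgroup.isClosed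
  have hYfin : Y.Finite := by
    have := hι.tendsto_one (hNopen.mem_nhds (one_mem N))
    exact this
  obtain ⟨r, hr, -⟩ := hι.existsUnique_lift S (fun x => if x ∈ Y then ι x else 1) (by
    refine tendsto_nhds_of_eventually_eq ?_
    filter_upwards [hYfin.compl_mem_cofinite] with x hx
    exact if_neg hx)
  have hrN : ∀ s, s⁻¹ * r s ∈ N := by
    let K : Subgroup S := ((QuotientGroup.mk' N.toSubgroup).comp (r : S →* S)).eqLocus
      (QuotientGroup.mk' N.toSubgroup)
    have hK (s : S) : s ∈ K ↔ s⁻¹ * r s ∈ N := by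
      change (QuotientGroup.mk (r s) : S ⧸ N.toSubgroup) = QuotientGroup.mk s ↔ _
      rw [eq_comm, QuotientGroup.eq]
      rfl
    have hKc : IsClosed (K : Set S) := by
      have : (K : Set S) = (fun s => s⁻¹ * r s) ⁻¹' N := Set.ext hK
      rw [this]
      exact hNclosed.preimage (continuous_inv.mul r.continuous_toFun)
    intro s
    refine (hK s).1 (hι.eq_top_of_isClosed hKc (fun x => ?_) s)
    rw [hK, hr]
    split_ifs with hx
    · simp [one_mem]
    · rw [mul_one]
      exact inv_mem (not_not.1 hx)
  have hrμ : ∀ s, μ (r s) = Units.map (restrictHom Y) (μ s) := by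
    let K : Subgroup S := ((μ : S →* (WordSeries X (ZMod p))ˣ).comp (r : S →* S)).eqLocus
      ((Units.map (restrictHom Y)).comp (μ : S →* (WordSeries X (ZMod p))ˣ))
    have hKc : IsClosed (K : Set S) := by
      have : (K : Set S) = {s | (μ (r s) : WordSeries X (ZMod p)) = restrict Y (μ s)} := by
        ext s
        exact Units.ext_iff
      rw [this]
      exact isClosed_eq (Units.continuous_val.comp (μ.continuous_toFun.comp r.continuous_toFun))
        ((continuous_restrict Y).comp (Units.continuous_val.comp μ.continuous_toFun))
    intro s
    refine hι.eq_top_of_isClosed hKc (fun x => ?_) s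
    change μ (r (ι x)) = Units.map (restrictHom Y) (μ (ι x))
    rw [hr, hμ]
    split_ifs with hx
    · rw [hμ, restrict_oneAddVar_of_mem hx]
    · rw [map_one, restrict_oneAddVar_of_notMem hx]
  -- the condition on `s` under which `r s` lies in the `n`-th step is open
  have hWfin : {w : List X | w.length < n ∧ ∀ a ∈ w, a ∈ Y}.Finite := by
    have := hYfin.to_subtype
    refine ((List.finite_length_lt Y n).image (List.map Subtype.val)).subset ?_
    rintro w ⟨hw, hwY⟩
    exact ⟨w.pmap Subtype.mk hwY, by simpa using hw, by simp [List.map_pmap]⟩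
  set V : Set S := {s | σ⁻¹ * s ∈ N} ∩
    ⋂ w ∈ {w : List X | w.length < n ∧ ∀ a ∈ w, a ∈ Y},
      {s | (μ s : WordSeries X (ZMod p)) w = (1 : WordSeries X (ZMod p)) w} with hV
  have hVopen : IsOpen V := by
    refine (hNopen.preimage (continuous_const_mul σ⁻¹)).inter
      (hWfin.isOpen_biInter fun w _ => ?_)
    exact (isOpen_discrete {(1 : WordSeries X (ZMod p)) w}).preimage
      ((continuous_coeff w).comp (Units.continuous_val.comp μ.continuous_toFun))
  have hσV : σ ∈ V := by
    refine ⟨by simp [one_mem], Set.mem_iInter₂.2 fun w hw => ?_⟩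
    exact sub_eq_zero.1 (hσ w hw.1)
  have hdense : σ ∈ closure (Subgroup.closure (Set.range ι) : Set S) := by
    rw [← Subgroup.topologicalClosure_coe, hι.generates]
    trivial
  obtain ⟨s, hsV, hs⟩ := mem_closure_iff.1 hdense V hVopen hσV
  refine ⟨r s, ?_, ?_, ?_⟩
  · have h1 : σ⁻¹ * r s ∈ N := by
      have := mul_mem hsV.1 (hrN s)
      rwa [mul_assoc, mul_inv_cancel_left] at this
    have h2 := hN h1
    simpa using h2
  · have h1 : Subgroup.closure (Set.range ι) ≤
        (Subgroup.closure (Set.range ι)).comap (r : S →* S) := by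
      rw [Subgroup.closure_le]
      rintro _ ⟨x, rfl⟩
      change r (ι x) ∈ Subgroup.closure (Set.range ι)
      rw [hr]
      split_ifs
      · exact Subgroup.subset_closure ⟨x, rfl⟩
      · exact one_mem _
    exact h1 hs
  · rw [hrμ, mem_deepUnits]
    intro w hw
    change restrict Y (μ s) w - (1 : WordSeries X (ZMod p)) w = 0
    by_cases hwY : ∀ a ∈ w, a ∈ Y
    · rw [restrict_of_forall _ hwY, sub_eq_zero]
      exact Set.mem_iInter₂.1 hsV.2 w ⟨hw, hwY⟩
    · rw [restrict_of_not _ hwY]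
      cases w with
      | nil => simp at hwY
      | cons a w => simp

/-- The Zassenhaus filtration is the Magnus filtration, and the leading terms of degree `n` are
combinations of the `P(w) ^ p ^ j`. -/
theorem mem_zassenhaus_of_mem_deepUnits (hι : IsFreeProfinite ι)
    (hμ : ∀ x, μ (ι x) = oneAddVar (ZMod p) x) (h𝓗 : IsHallSet 𝓗) {n : ℕ} (hn : 1 ≤ n) {σ : S}
    (hσ : μ σ ∈ deepUnits X (ZMod p) n) :
    σ ∈ zassenhaus S p n ∧ lead n (μ σ) ∈ (levelSum 𝓗 p n).range := by
  have hcl : IsClosed {s : S | s ∈ zassenhaus S p n ∧ lead n (μ s) ∈ (levelSum 𝓗 p n).range} := by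
    refine (isClosed_zassenhaus p n).inter ?_
    have h1 : IsClosed (Set.range (levelSum 𝓗 p n)) :=
      (isCompact_range continuous_levelSum).isClosed
    exact h1.preimage ((continuous_lead n).comp μ.continuous_toFun)
  exact closure_minimal (fun f hf => mem_zassenhaus_of_mem_closure hι hμ h𝓗 hn hf.1 hf.2) hcl
    (mem_closure_of_mem_deepUnits hι hμ hσ)

end Magnus

/-! ### The successive quotients of the Zassenhaus filtration -/

section Quotients

open WordSeries

theorem IsProfiniteFpBasis.isFpBasis {p : ℕ} [Fact p.Prime] {I Q : Type u} [Finite I] [Group Q]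
    [TopologicalSpace Q] {b : I → Q} (hb : IsProfiniteFpBasis p b) : IsFpBasis p b := by
  classical
  obtain ⟨e, he⟩ := hb
  have hcomm : ∀ x y : Q, x * y = y * x := by
    intro x y
    rw [← e.apply_symm_apply x, ← e.apply_symm_apply y, ← map_mul, mul_comm, map_mul]
  have hexp : ∀ x : Q, x ^ p = 1 := by
    intro x
    rw [← e.apply_symm_apply x, ← map_pow]
    have : (e.symm x) ^ p = 1 := by
      refine Multiplicative.toAdd.injective (funext fun i => ?_)
      simp
    rw [this, map_one]
  refine ⟨hcomm, hexp, ?_⟩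
  let _ : AddCommGroup (Additive Q) :=
    { (inferInstance : AddGroup (Additive Q)) with add_comm := hcomm }
  let _ : Module (ZMod p) (Additive Q) := AddCommGroup.zmodModule (n := p) (G := Additive Q) hexp
  let φ : (I → ZMod p) →+ Additive Q :=
    { toFun := fun c => Additive.ofMul (e (Multiplicative.ofAdd c))
      map_zero' := by
        rw [ofAdd_zero, map_one]
        rfl
      map_add' := fun c c' => by
        rw [ofAdd_add, map_mul]
        rfl }
  let φl : (I → ZMod p) →ₗ[ZMod p] Additive Q := φ.toZModLinearMap p
  have hφ : Function.Bijective φl :=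
    (Additive.ofMul.bijective.comp e.bijective).comp Multiplicative.ofAdd.bijective
  have hφb : (fun i => Additive.ofMul (b i)) = φl ∘ Pi.basisFun (ZMod p) I := by
    ext i
    rw [Function.comp_apply, Pi.basisFun_apply, ← he i]
    rfl
  change LinearIndependent (ZMod p) (fun i => Additive.ofMul (b i)) ∧
    Submodule.span (ZMod p) (Set.range fun i => Additive.ofMul (b i)) = ⊤
  rw [hφb]
  refine ⟨(Pi.basisFun (ZMod p) I).linearIndependent.map' φl (LinearMap.ker_eq_bot.2 hφ.1), ?_⟩
  rw [Set.range_comp, ← Submodule.map_span, (Pi.basisFun (ZMod p) I).span_eq, Submodule.map_top,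
    LinearMap.range_eq_top.2 hφ.2]

variable {X S : Type u} [Group S] [TopologicalSpace S] [IsTopologicalGroup S] [CompactSpace S]
  {ι : X → S} {p : ℕ} [Fact p.Prime] {μ : S →ₜ* (WordSeries X (ZMod p))ˣ}
  {𝓗 : Set (FreeMagma X)}

open Classical in
/-- A closed subgroup of a product of copies of `ZMod p` which contains the unit vectors is the whole
product. -/
theorem eq_top_of_single_mem {I : Type*} {K : AddSubgroup (I → ZMod p)}
    (hK : IsClosed (K : Set (I → ZMod p))) (h : ∀ i, Pi.single i 1 ∈ K) : K = ⊤ := by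
  refine (AddSubgroup.eq_top_iff' K).2 fun c => ?_
  have hsum : HasSum (fun i => Pi.single i (c i)) c :=
    Pi.hasSum.2 fun j => by
      have := hasSum_single (f := fun i => (Pi.single i (c i) : I → ZMod p) j) j
        (fun i hi => Pi.single_eq_of_ne hi.symm _)
      simpa using this
  refine hK.mem_of_tendsto hsum (Filter.Eventually.of_forall fun s => sum_mem fun i _ => ?_)
  have h1 : (Pi.single i (c i) : I → ZMod p) = (c i).val • Pi.single i 1 := by
    rw [← Pi.single_smul]
    simp
  rw [h1]
  exact nsmul_mem (h i) _

omit [CompactSpace S] [Fact p.Prime] in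
theorem hallTau_pow_mem_zassenhaus (ι : X → S) {n : ℕ} (i : LevelIndex p 𝓗 n) :
    hallTau ι i.1.1 ^ p ^ i.1.2 ∈ zassenhaus S p n :=
  commEval_pow_mem_zassenhaus ι _ (card_content_bracketing i).ge

omit [CompactSpace S] [IsTopologicalGroup S] in
theorem lead_hallTau_pow (hμ : ∀ x, μ (ι x) = oneAddVar (ZMod p) x) {n : ℕ}
    (i : LevelIndex p 𝓗 n) :
    lead n (μ (hallTau ι i.1.1 ^ p ^ i.1.2)) = fun w => levelTerm i w.1 := by
  have h1 : μ (hallTau ι i.1.1) = commEval (oneAddVar (ZMod p)) (bracketing i.1.1) := by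
    have := map_commEval (μ : S →* (WordSeries X (ZMod p))ˣ) ι (bracketing i.1.1)
    simp only [MonoidHom.coe_coe, hμ] at this
    exact this
  ext w
  have h2 := commEval_pow_sub_mem (k := ZMod p) (p := p) (bracketing i.1.1) i.1.2 w.1 (by
    rw [card_content_bracketing, w.2]
    exact Nat.lt_succ_self n)
  rw [WordSeries.sub_apply, sub_eq_zero] at h2
  rw [map_pow, h1]
  exact h2

/-- The leading term of degree `n` as a homomorphism on the `n`-th step of the Zassenhaus
filtration. -/
def zassenhausLead (hι : IsFreeProfinite ι) (hμ : ∀ x, μ (ι x) = oneAddVar (ZMod p) x) {n : ℕ}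
    (hn : 1 ≤ n) :
    zassenhaus S p n →* Multiplicative ({w : List X // w.length = n} → ZMod p) :=
  (leadHom X (ZMod p) hn).comp (((μ : S →* (WordSeries X (ZMod p))ˣ).comp
    (zassenhaus S p n).subtype).codRestrict (deepUnits X (ZMod p) n)
      fun s => zassenhaus_le_comap hι hμ n s.2)

variable [TotallyDisconnectedSpace S] [LinearOrder X] [LinearOrder 𝓗]

theorem ker_zassenhausLead (hι : IsFreeProfinite ι) (hμ : ∀ x, μ (ι x) = oneAddVar (ZMod p) x)
    (h𝓗 : IsHallSet 𝓗) {n : ℕ} (hn : 1 ≤ n) :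
    (zassenhausLead hι hμ hn).ker = (zassenhaus S p (n + 1)).subgroupOf (zassenhaus S p n) := by
  ext s
  rw [MonoidHom.mem_ker, Subgroup.mem_subgroupOf]
  have h1 : μ s.1 ∈ deepUnits X (ZMod p) n := zassenhaus_le_comap hι hμ n s.2
  have h2 : zassenhausLead hι hμ hn s = 1 ↔ lead n (μ s.1) = 0 := Iff.rfl
  rw [h2, lead_eq_zero_iff h1]
  exact ⟨fun h => (mem_zassenhaus_of_mem_deepUnits hι hμ h𝓗 (by omega) h).1,
    fun h => zassenhaus_le_comap hι hμ _ h⟩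

/-- The leading terms are exactly the values of `levelSum`: they form a closed group, by compactness,
which contains the `P(w) ^ p ^ j`. -/
theorem range_zassenhausLead (hι : IsFreeProfinite ι) (hμ : ∀ x, μ (ι x) = oneAddVar (ZMod p) x)
    (h𝓗 : IsHallSet 𝓗) {n : ℕ} (hn : 1 ≤ n) :
    (AddMonoidHom.toMultiplicative (levelSum 𝓗 p n)).range = (zassenhausLead hι hμ hn).range := by
  classical
  have hcont : Continuous (zassenhausLead hι hμ hn) :=
    continuous_ofAdd.comp
      ((continuous_lead n).comp (μ.continuous_toFun.comp continuous_subtype_val))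
  have : CompactSpace (zassenhaus S p n) :=
    isCompact_iff_compactSpace.1 (isClosed_zassenhaus p n).isCompact
  apply le_antisymm
  · let K : AddSubgroup (LevelIndex p 𝓗 n → ZMod p) := AddSubgroup.comap (levelSum 𝓗 p n)
      (Subgroup.toAddSubgroup' (zassenhausLead hι hμ hn).range)
    have hK : IsClosed (K : Set (LevelIndex p 𝓗 n → ZMod p)) := by
      have h1 : IsClosed (Set.range (zassenhausLead hι hμ hn)) := (isCompact_range hcont).isClosed
      exact h1.preimage (continuous_ofAdd.comp continuous_levelSum)
    have htop := eq_top_of_single_mem hK fun i => by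
      refine ⟨⟨_, hallTau_pow_mem_zassenhaus ι i⟩, ?_⟩
      change Multiplicative.ofAdd (lead n (μ (hallTau ι i.1.1 ^ p ^ i.1.2))) =
        Multiplicative.ofAdd _
      rw [lead_hallTau_pow hμ, levelSum_single]
      simp
    rintro _ ⟨c, rfl⟩
    have : Multiplicative.toAdd c ∈ K := htop ▸ AddSubgroup.mem_top _
    exact this
  · rintro _ ⟨s, rfl⟩
    exact (mem_zassenhaus_of_mem_deepUnits hι hμ h𝓗 hn (zassenhaus_le_comap hι hμ n s.2)).2

/-- By leading terms, the quotient is identified with the closed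
subspace spanned by the `P(w) ^ p ^ j`, which is a product of copies of `ZMod p`. -/
theorem isProfiniteFpBasis_hallTau (hι : IsFreeProfinite ι) (h𝓗 : IsHallSet 𝓗) {n : ℕ}
    (hn : 1 ≤ n) :
    IsProfiniteFpBasis p (fun i : LevelIndex p 𝓗 n =>
      (QuotientGroup.mk ⟨hallTau ι i.1.1 ^ p ^ i.1.2, hallTau_pow_mem_zassenhaus ι i⟩ :
        ZassenhausQuotient S p n)) := by
  classical
  obtain ⟨μ, hμ⟩ := hι.exists_magnus p
  have hcont : Continuous (zassenhausLead hι hμ hn) :=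
    continuous_ofAdd.comp
      ((continuous_lead n).comp (μ.continuous_toFun.comp continuous_subtype_val))
  have hker := ker_zassenhausLead hι hμ h𝓗 hn
  let Λ : ZassenhausQuotient S p n →* Multiplicative ({w : List X // w.length = n} → ZMod p) :=
    QuotientGroup.lift _ (zassenhausLead hι hμ hn) fun s hs => by
      rw [← hker] at hs
      exact hs
  have hΛ : Function.Injective Λ := by
    rw [injective_iff_map_eq_one]
    intro q
    induction q using QuotientGroup.induction_on with
    | H s =>
      intro hs
      rw [QuotientGroup.eq_one_iff, ← hker]
      exact hs
  have hΛcont : Continuous Λ := hcont.quotient_lift _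
  have : CompactSpace (zassenhaus S p n) :=
    isCompact_iff_compactSpace.1 (isClosed_zassenhaus p n).isCompact
  have hemb : Topology.IsClosedEmbedding Λ := hΛcont.isClosedEmbedding hΛ
  let Ψ := AddMonoidHom.toMultiplicative (levelSum 𝓗 p n)
  have hΨ : Function.Injective Ψ := injective_levelSum h𝓗
  have hΨcont : Continuous Ψ := continuous_ofAdd.comp (continuous_levelSum.comp continuous_toAdd)
  have hrange : Ψ.range = Λ.range := by
    rw [range_zassenhausLead hι hμ h𝓗 hn]
    ext v
    constructor
    · rintro ⟨s, rfl⟩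
      exact ⟨QuotientGroup.mk s, rfl⟩
    · rintro ⟨q, rfl⟩
      induction q using QuotientGroup.induction_on with
      | H s => exact ⟨s, rfl⟩
  let e : Multiplicative (LevelIndex p 𝓗 n → ZMod p) ≃* ZassenhausQuotient S p n :=
    ((MonoidHom.ofInjective hΨ).trans (MulEquiv.subgroupCongr hrange)).trans
      (MonoidHom.ofInjective hΛ).symm
  have he : ∀ c, Λ (e c) = Ψ c := by
    intro c
    have := (MonoidHom.ofInjective hΛ).apply_symm_apply
      (MulEquiv.subgroupCongr hrange (MonoidHom.ofInjective hΨ c))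
    exact congrArg Subtype.val this
  have hecont : Continuous e := by
    rw [hemb.isEmbedding.continuous_iff]
    exact hΨcont.congr fun c => (he c).symm
  have : T2Space (ZassenhausQuotient S p n) := hemb.isEmbedding.t2Space
  have : CompactSpace (Multiplicative (LevelIndex p 𝓗 n → ZMod p)) :=
    inferInstanceAs (CompactSpace (LevelIndex p 𝓗 n → ZMod p))
  refine ⟨⟨e, hecont, Continuous.continuous_symm_of_equiv_compact_to_t2 (f := e.toEquiv) hecont⟩,
    fun i => hΛ ?_⟩
  refine (he _).trans ?_
  change Multiplicative.ofAdd (levelSum 𝓗 p n (Pi.single i 1)) =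
    Multiplicative.ofAdd (lead n (μ (hallTau ι i.1.1 ^ p ^ i.1.2)))
  rw [lead_hallTau_pow hμ, levelSum_single]
  simp

end Quotients

end HallZassenhaus

theorem proposition4p6 (p : ℕ) [Fact p.Prime] {X : Type u} [Nonempty X] [LinearOrder X]
    (𝓗 : Set (FreeMagma X)) [LinearOrder 𝓗] (h𝓗 : IsHallSet 𝓗) :
    (∀ (k : Type v) [Field k] [CharP k p],
      (IsFreeRestrictedLie k p (resLieι k p : X → resLieSubalgebra k p X) ∧
        LinearIndependent k (fun jw : ℕ × hallWords 𝓗 =>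
          (hallLie (FreeAlgebra.ι k) jw.2 : FreeAlgebra k X) ^ p ^ jw.1) ∧
        Submodule.span k (Set.range fun jw : ℕ × hallWords 𝓗 =>
          (hallLie (FreeAlgebra.ι k) jw.2 : FreeAlgebra k X) ^ p ^ jw.1) =
          (resLieSubalgebra k p X).toSubmodule) ∧
      ∀ (L : Type (max u v)) [LieRing L] [LieAlgebra k L] [RestrictedLieAlgebra k p L] (ι : X → L),
        IsFreeRestrictedLie k p ι →
          LinearIndependent k (hallLiePow k p ι : ℕ × hallWords 𝓗 → L) ∧
          Submodule.span k (Set.range (hallLiePow k p ι : ℕ × hallWords 𝓗 → L)) = ⊤) ∧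
    (∀ (S : Type u) [Group S] [TopologicalSpace S] [IsTopologicalGroup S] [CompactSpace S]
      [TotallyDisconnectedSpace S] (ι : X → S), IsFreeProfinite ι → ∀ n : ℕ, 1 ≤ n →
      ∃ hmem : ∀ wj : LevelIndex p 𝓗 n, hallTau ι wj.1.1 ^ p ^ wj.1.2 ∈ zassenhaus S p n,
        IsProfiniteFpBasis p (fun wj : LevelIndex p 𝓗 n =>
          (QuotientGroup.mk ⟨hallTau ι wj.1.1 ^ p ^ wj.1.2, hmem wj⟩ : ZassenhausQuotient S p n)) ∧
        (Finite X → IsFpBasis p (fun wj : LevelIndex p 𝓗 n =>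
          (QuotientGroup.mk ⟨hallTau ι wj.1.1 ^ p ^ wj.1.2, hmem wj⟩ :
            ZassenhausQuotient S p n)))) := by
  refine ⟨fun k _ _ => ⟨⟨isFreeRestrictedLie_resLieι, hallLie_pow_basis h𝓗⟩,
    fun L _ _ _ ι hι => hι.hallLiePow_basis h𝓗⟩, fun S _ _ _ _ _ ι hι n hn =>
    ⟨hallTau_pow_mem_zassenhaus ι, isProfiniteFpBasis_hallTau hι h𝓗 hn, fun _ => ?_⟩⟩
  have := finite_levelIndex (p := p) (𝓗 := 𝓗) (n := n)
  exact (isProfiniteFpBasis_hallTau hι h𝓗 hn).isFpBasis
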